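/- **Setting.** Let $L\ge 4$ and let $s_{ij}=s_{ji}$ ($1\le i\neq j\le L$) be complex variables. For a permutation $\sigma$ of $\{1,\dots,L\}$ fixing $1,2,3$ and for $i\in\{4,\dots,L+1\}$, put $z_1=0$, $z_2=1$, $z_{km}=z_k-z_m$, and for $z_3\in\mathbb C\setminus\{0,1\}$ $$\hat{\mathscr F}^\sigma_{L,i}(z_3)=\frac1{(-2\pi i)^{L-3}}\int_{(\mathbb P^1_{\mathbb C})^{L-3}}\prod_{1\le k<m\le L}|z_{km}|^{2s_{km}}\;\sigma\Big[\prod_{k=i}^{L}\Big(\frac{s_{1k}}{z_k}+\sum_{j=k+1}^{L}\frac{s_{kj}}{z_{kj}}\Big)\prod_{m=4}^{i-1}\ \sum_{\substack{n=2\\ n\ne3}}^{m-1}\frac{s_{nm}}{z_{nm}}\Big]\frac{\bar z_3}{\bar z_L}\prod_{k=4}^{L}\frac{dz_k\,d\bar z_k}{\bar z_{k}-\bar z_{k-1}} ,$$ where $\sigma$ acts on the labels inside the brackets and $dz\,d\bar z$ denotes $2i$ times Lebesgue measure, so that $\frac{1}{-2\pi i}dz\,d\bar z=-\frac1\pi\,dx\,dy$.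 Let $\hat{\mathscr F}_L(z_3)$ be the vector of these $(L-2)!$ functions. It satisfies the Knizhnik--Zamolodchikov equation $\partial_{z_3}\hat{\mathscr F}_L=\big(\frac{e_0}{z_3}+\frac{e_1}{z_3-1}\big)\hat{\mathscr F}_L$, whose matrix $e_0$ is as follows. In row $(i,\sigma)$ the diagonal entry is the sum of $s_{ab}$ over all pairs $a,b$ from $\{1,3,\sigma(i),\dots,\sigma(L)\}$. For each nonempty $S=\{k_r<\dots<k_1\}\subseteq\{i,\dots,L\}$ expand the left-normed bracket $[\dots[[\sigma(k_1),\sigma(k_2)],\sigma(k_3)],\dots,\sigma(k_r)]=\sum_w c_w w$ into words; each $w$ contributes $(-1)^r\big(s_{1\sigma(k_1)}+\sum_{j>k_1}s_{\sigma(k_1)\sigma(j)}\big)c_w$ to the column $(i+r,\sigma')$ where $(\sigma'(4),\dots,\sigma'(L))$ is $(\sigma(4),\dots,\sigma(i-1))$, followed by $w$, followed by the $\sigma(k)$, $k\in\{i,\dots,L\}\setminus S$, with $k$ increasing. All other entries are $0$. The regularized value at $0$ is $$\hat{\mathscr F}_L(0)=\lim_{z_3\to0}|z_3|^{-2e_0}\hat{\mathscr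 F}_L(z_3).$$ **Statement.** There is $\varepsilon>0$, depending only on $L$, such that the following holds. Let $R_\varepsilon$ be the set of all $s$ with $|s_{ij}|<\varepsilon$ for all $i,j$ and $\operatorname{Re}s_{ij}>0$ for all distinct $i,j\in\{1,4,\dots,L\}$. 1. For $s\in R_\varepsilon$ all the integrals above converge absolutely, the limit $\hat{\mathscr F}_L(0)$ exists, and $\hat{\mathscr F}^\sigma_{L,i}(0)=0$ for all $i\ge5$ and all $\sigma$. 2. (Physical limit.) Let $s_{3i}\to0$ for all $i$, the other variables being fixed, within $R_\varepsilon$. If $\sigma$ also fixes $4$, then $\hat{\mathscr F}^\sigma_{L,4}(0)$ tends to the absolutely convergent $(L-1)$-point closed-string integral $$\frac1{(-2\pi i)^{L-4}}\int_{(\mathbb P^1_{\mathbb C})^{L-4}}\frac1{\bar w_L}\prod_{5\le i<j\le L}|w_{ij}|^{2s_{ij}}\;\sigma\Big[\prod_{k=5}^{L}\Big(\frac{s_{1k}}{w_k}+\sum_{j=k+1}^{L}\frac{s_{kj}}{w_{kj}}\Big)\Big]\prod_{k=5}^{L}|w_k|^{2s_{1k}}|1-w_k|^{2s_{4k}}\frac{dw_k\,d\bar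 w_k}{\bar w_{k}-\bar w_{k-1}},\qquad w_4=1$$ (equal to $1$ for $L=4$). All other components of $\hat{\mathscr F}_L(0)$ tend to $0$. 3. (Neighbourhood of the origin.) The same holds for analytic continuations in $s$: on any polydisc $\{|s_{ij}|<r\}$ to which the function $\hat{\mathscr F}^\sigma_{L,i}(0)$ of $s$ (and, when $i=4$ and $\sigma(4)=4$, also the $(L-1)$-point integral) extends holomorphically from $R_\varepsilon$, the extension of $\hat{\mathscr F}^\sigma_{L,i}(0)$ vanishes identically if $i\geq 5$, and as $s_{3\bullet}\to0$ it tends to the extension of the $(L-1)$-point integral if $i=4$, $\sigma(4)=4$, and to $0$ otherwise. -/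

import Mathlib

open Filter Topology MeasureTheory

noncomputable section

/-- The Mandelstam variables `s_{ij} = s_{ji}`, `1 ≤ i, j ≤ L`, as a point of a finite-dimensional
complex space with the sup norm. (The diagonal coordinates never enter a formula below.) -/
abbrev Mandelstam (L : ℕ) : Type := Sym2 (Finset.Icc 1 L) → ℂ

/-- The variable `s_{ij}`, for labels `i, j` in `{1, …, L}`. -/
def mand {L : ℕ} (s : Mandelstam L) (i j : ℕ) : ℂ :=
  if h : i ∈ Finset.Icc 1 L ∧ j ∈ Finset.Icc 1 L then s s(⟨i, h.1⟩, ⟨j, h.2⟩) else 0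

/-- Permutations of `{1, …, L}` that fix `1, 2, 3`. -/
abbrev LabelPerm (L : ℕ) : Type := Equiv.Perm (Finset.Icc 4 L)

/-- The action of such a permutation on all labels. -/
def LabelPerm.act {L : ℕ} (σ : LabelPerm L) : Equiv.Perm ℕ :=
  Equiv.Perm.ofSubtype (p := fun k => k ∈ Finset.Icc 4 L) σ

/-- The components `(i, σ)` of the vector `𝓕̂_L`, where `i ∈ {4, …, L + 1}`; there are `(L - 2)!`. -/
abbrev CompIdx (L : ℕ) : Type := Finset.Icc 4 (L + 1) × LabelPerm L

/-- The positions `z_1 = 0`, `z_2 = 1`, `z_3`, and the integrated `z_4, …, z_L`. -/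
def position {L : ℕ} (z₃ : ℂ) (x : Finset.Icc 4 L → ℂ) (k : ℕ) : ℂ :=
  if h : k ∈ Finset.Icc 4 L then x ⟨k, h⟩
  else if k = 2 then 1 else if k = 3 then z₃ else 0

/-- `|a|^{2 t}` for a complex exponent `t`. -/
def absPow (a t : ℂ) : ℂ := ((‖a‖ : ℝ) : ℂ) ^ (2 * t)

/-- The complex conjugate. -/
def cbar (a : ℂ) : ℂ := (starRingEnd ℂ) a

/-- The integrand of the component `(i, σ)` of `𝓕̂_L(z_3)`, with respect to Lebesgue measure
in `z_4, …, z_L`. -/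
def fhatIntegrand (L : ℕ) (s : Mandelstam L) (z₃ : ℂ) (a : CompIdx L)
    (x : Finset.Icc 4 L → ℂ) : ℂ :=
  let z := position z₃ x
  let i : ℕ := a.1
  let p := a.2.act
  (∏ k ∈ Finset.Icc 1 L, ∏ m ∈ Finset.Ioc k L, absPow (z k - z m) (mand s k m))
    * ((∏ k ∈ Finset.Icc i L, (mand s 1 (p k) / z (p k)
          + ∑ j ∈ Finset.Ioc k L, mand s (p k) (p j) / (z (p k) - z (p j))))
      * ∏ m ∈ Finset.Ico 4 i, ∑ n ∈ (Finset.Ico 2 m).erase 3,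
          mand s (p n) (p m) / (z (p n) - z (p m)))
    * (cbar z₃ / cbar (z L) * ∏ k ∈ Finset.Icc 4 L, 1 / (cbar (z k) - cbar (z (k - 1))))

/-- `𝓕̂_{L,i}^σ(z_3)`. The measure `dz dz̄ / (-2πi)` is `-1/π` times Lebesgue measure of the plane,
that is, `dz dz̄` stands for `2i dx dy`. -/
def fhat (L : ℕ) (s : Mandelstam L) (z₃ : ℂ) (a : CompIdx L) : ℂ :=
  (-1 / (Real.pi : ℂ)) ^ (L - 3) * ∫ x : Finset.Icc 4 L → ℂ, fhatIntegrand L s z₃ a x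

/-- The expansion of the left-normed bracket `[…[[c_1, c_2], c_3], …, c_r]` in the free associative
algebra, as a list of signed words. The input is the list `[c_r, …, c_2, c_1]`. -/
def bracketWords : List ℕ → List (ℤ × List ℕ)
  | [] => []
  | [c] => [(1, [c])]
  | x :: y :: c =>
    (bracketWords (y :: c)).map (fun t => (t.1, t.2 ++ [x]))
      ++ (bracketWords (y :: c)).map (fun t => (-t.1, x :: t.2))

/-- The labels `[σ(i), …, σ(L)]` of the variables that the component `(i, σ)` attaches to `z_1`. -/
def fstWord {L : ℕ} (a : CompIdx L) : List ℕ :=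
  (List.range' (a.1 : ℕ) (L + 1 - a.1)).map a.2.act

/-- The labels `[σ(4), …, σ(i - 1)]` of the variables that the component `(i, σ)` attaches
to `z_2`. -/
def sndWord {L : ℕ} (a : CompIdx L) : List ℕ :=
  (List.range' 4 ((a.1 : ℕ) - 4)).map a.2.act

/-- The residue matrix `e_0` at `z_3 = 0` of the Knizhnik–Zamolodchikov equation
`∂𝓕̂_L/∂z_3 = (e_0 / z_3 + e_1 / (z_3 - 1)) 𝓕̂_L`, in the basis of components `(i, σ)`.

Its diagonal entry at `(i, σ)` is the sum of the `s_{ab}` over all pairs of labels from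
`{1, 3, σ(i), …, σ(L)}` (for `i = 4` this is `s_max`). Besides, for every nonempty set
`S = {k_r < … < k_1}` of positions in `{i, …, L}`, the variables at these positions move
from `z_1` to `z_2`, in the order of the bracket `[…[σ(k_1), σ(k_2)], …, σ(k_r)]`, with the
coefficient `(-1)^r (s_{1σ(k_1)} + ∑_{j > k_1} s_{σ(k_1)σ(j)})`; the others stay in order.
For `L = 4` this is `e_0 = !![s_13 + s_14 + s_34, -s_14; 0, s_13]`. -/
def kzE0 (L : ℕ) (s : Mandelstam L) : Matrix (CompIdx L) (CompIdx L) ℂ := fun a b =>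
  let i : ℕ := a.1
  let p := a.2.act
  let pos : List ℕ := List.range' i (L + 1 - i)
  (if a = b then
      mand s 1 3
        + ∑ k ∈ Finset.Icc i L, (mand s 1 (p k) + mand s 3 (p k)
            + ∑ j ∈ Finset.Ioc k L, mand s (p k) (p j))
    else 0)
  + (pos.sublists.map fun S =>
      let k₁ := S.getLastD 0
      (-1) ^ S.length
        * (mand s 1 (p k₁) + ∑ j ∈ Finset.Ioc k₁ L, mand s (p k₁) (p j))
        * ((bracketWords (S.map p)).map fun t =>
            if fstWord b = (pos.filter (fun k => k ∉ S)).map p ∧ sndWord b = sndWord a ++ t.2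
            then (t.1 : ℂ) else 0).sum).sum

/-- The vector `|z_3|^{-2 e_0} 𝓕̂_L(z_3)`. -/
def fhatReg (L : ℕ) (s : Mandelstam L) (z₃ : ℂ) : CompIdx L → ℂ :=
  (NormedSpace.exp ((-(2 * ((Real.log ‖z₃‖ : ℝ) : ℂ))) • kzE0 L s)).mulVec (fhat L s z₃)

/-- The regularized value `𝓕̂_L(0) = lim_{z_3 → 0} |z_3|^{-2 e_0} 𝓕̂_L(z_3)`. -/
def fhatZero (L : ℕ) (s : Mandelstam L) : CompIdx L → ℂ :=
  limUnder (𝓝[≠] (0 : ℂ)) (fhatReg L s)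

/-- The positions `w_1 = 0`, `w_4 = 1` and the integrated `w_5, …, w_L`. -/
def position' {L : ℕ} (x : Finset.Icc 5 L → ℂ) (k : ℕ) : ℂ :=
  if h : k ∈ Finset.Icc 5 L then x ⟨k, h⟩ else if k = 4 then 1 else 0

/-- The integrand of the `(L - 1)`-point closed-string integral with permutation `σ`, with respect
to Lebesgue measure in `w_5, …, w_L`. -/
def closedStringIntegrand (L : ℕ) (s : Mandelstam L) (σ : LabelPerm L)
    (x : Finset.Icc 5 L → ℂ) : ℂ :=
  let w := position' x
  let p := σ.act
  1 / cbar (w L)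
    * (∏ i ∈ Finset.Icc 5 L, ∏ j ∈ Finset.Ioc i L, absPow (w i - w j) (mand s i j))
    * (∏ k ∈ Finset.Icc 5 L, (mand s 1 (p k) / w (p k)
          + ∑ j ∈ Finset.Ioc k L, mand s (p k) (p j) / (w (p k) - w (p j))))
    * ∏ k ∈ Finset.Icc 5 L, absPow (w k) (mand s 1 k) * absPow (1 - w k) (mand s 4 k)
        / (cbar (w k) - cbar (w (k - 1)))

/-- The `(L - 1)`-point closed-string integral with permutation `σ` (a permutation fixing
`1, 2, 3, 4`). -/
def closedStringIntegral (L : ℕ) (s : Mandelstam L) (σ : LabelPerm L) : ℂ :=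
  (-1 / (Real.pi : ℂ)) ^ (L - 4) * ∫ x : Finset.Icc 5 L → ℂ, closedStringIntegrand L s σ x

/-- A region of convergence: all variables are smaller than `ε`, and `Re s_{ij} > 0` for
distinct `i, j ∈ {1, 4, …, L}`. The variables `s_{2i}` and `s_{3i}` are only small. -/
def convRegion (L : ℕ) (ε : ℝ) : Set (Mandelstam L) :=
  {s | s ∈ Metric.ball 0 ε ∧ ∀ i ∈ insert 1 (Finset.Icc 4 L), ∀ j ∈ insert 1 (Finset.Icc 4 L),
    i ≠ j → 0 < (mand s i j).re}

/-- The variables `s_{3i}` all vanish. -/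
def IsPhysical {L : ℕ} (s : Mandelstam L) : Prop := ∀ i ∈ Finset.Icc 1 L, mand s 3 i = 0

/-- The filter `s_{3•} → 0`: all variables `s_{3i}` of `t` tend to those of `s` (which are `0` for
a physical `s`), while the other variables of `t` are kept equal to those of `s`. -/
def physLimit {L : ℕ} (s : Mandelstam L) : Filter (Mandelstam L) :=
  𝓝[{t | ∀ i j : ℕ, i ≠ 3 → j ≠ 3 → mand t i j = mand s i j}] s

end

noncomputable section

/-- The radial kernel `r ^ (δ - 2)` for `r ≤ 1` and `r ^ (-2)` for `r ≥ 1`. -/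
def kern (δ r : ℝ) : ℝ := (min r 1) ^ δ / r ^ 2

/-- The weak singularity `r ^ (-η)`, cut off at `1`. -/
def sing (η r : ℝ) : ℝ := (min r 1) ^ (-η)

lemma kern_nonneg {δ r : ℝ} (hr : 0 ≤ r) : 0 ≤ kern δ r := by
  unfold kern; positivity

lemma sing_nonneg {η r : ℝ} (hr : 0 ≤ r) : 0 ≤ sing η r := by
  unfold sing; positivity

lemma one_le_sing {η r : ℝ} (hr : 0 < r) (hη : 0 ≤ η) : 1 ≤ sing η r := by
  unfold sing
  exact Real.one_le_rpow_of_pos_of_le_one_of_nonpos (by positivity) (min_le_right _ _) (by linarith)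

lemma sing_antitone {η r q : ℝ} (hr : 0 < r) (h : r ≤ q) (hη : 0 ≤ η) : sing η q ≤ sing η r := by
  unfold sing
  exact Real.rpow_le_rpow_of_nonpos (by positivity) (min_le_min_right _ h) (by linarith)

lemma sing_mul {η θ r : ℝ} (hr : 0 < r) : sing η r * sing θ r = sing (η + θ) r := by
  unfold sing
  rw [← Real.rpow_add (by positivity)]; ring_nf

lemma sing_mono {η θ r : ℝ} (hr : 0 < r) (h : η ≤ θ) : sing η r ≤ sing θ r := by
  unfold sing
  exact Real.rpow_le_rpow_of_exponent_ge (by positivity) (min_le_right _ _) (by linarith)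

lemma sing_half {η d q : ℝ} (hd : 0 < d) (h : d ≤ 2 * q) (h0 : 0 ≤ η) (h1 : η ≤ 1) :
    sing η q ≤ 2 * sing η d := by
  have h2 : min d 1 / 2 ≤ min q 1 := by
    rcases le_total q 1 with h3 | h3
    · rw [min_eq_left h3]; linarith [min_le_left d 1]
    · rw [min_eq_right h3]; linarith [min_le_right d 1]
  have hm : 0 < min d 1 := by positivity
  unfold sing
  calc (min q 1) ^ (-η) ≤ (min d 1 / 2) ^ (-η) :=
        Real.rpow_le_rpow_of_nonpos (by positivity) h2 (by linarith)
    _ = 2 ^ η * (min d 1) ^ (-η) := by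
        rw [Real.div_rpow hm.le (by norm_num), Real.rpow_neg (by norm_num : (0 : ℝ) ≤ 2)]
        field_simp
    _ ≤ 2 * (min d 1) ^ (-η) := by
        gcongr
        calc (2 : ℝ) ^ η ≤ 2 ^ (1 : ℝ) := Real.rpow_le_rpow_of_exponent_le (by norm_num) h1
          _ = 2 := by norm_num

lemma kern_mul_sing {δ η r : ℝ} (hr : 0 < r) : kern (δ + η) r * sing η r = kern δ r := by
  unfold kern sing
  rw [div_mul_eq_mul_div, ← Real.rpow_add (by positivity)]; ring_nf

lemma kern_antitone {δ r q : ℝ} (hr : 0 < r) (h : r ≤ q) (h2 : δ ≤ 2) :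
    kern δ q ≤ kern δ r := by
  have key : ∀ t : ℝ, 0 < t → kern δ t = (min t 1) ^ (δ - 2) * (max t 1) ^ (-2 : ℝ) := by
    intro t ht
    unfold kern
    rw [Real.rpow_sub (by positivity)]
    have : t ^ 2 = (min t 1) ^ (2 : ℝ) * (max t 1) ^ (2 : ℝ) := by
      rw [← Real.mul_rpow (by positivity) (by positivity), min_mul_max]; norm_num
    rw [this, Real.rpow_neg (by positivity)]
    field_simp
  rw [key r hr, key q (hr.trans_le h)]
  have hq := hr.trans_le h
  apply mul_le_mul
  · exact Real.rpow_le_rpow_of_nonpos (by positivity) (min_le_min_right _ h) (by linarith)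
  · exact Real.rpow_le_rpow_of_nonpos (by positivity) (max_le_max_right _ h) (by norm_num)
  · positivity
  · positivity

/-- A weak singularity at one point can be moved to the centre of the kernel. -/
lemma kern_mul_sing_le {δ η r q d : ℝ} (hr : 0 < r) (hq : 0 < q) (hd : 0 < d) (h : d ≤ r + q)
    (h0 : 0 ≤ η) (h1 : η ≤ 1) (h2 : δ + η ≤ 2) :
    kern δ r * sing η q ≤ 2 * sing η d * (kern δ r + kern δ q) := by
  have hs := sing_nonneg (η := η) hd.le
  have hk := kern_nonneg (δ := δ) hr.le
  have hk' := kern_nonneg (δ := δ) hq.le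
  rcases le_total r q with hrq | hrq
  · have := sing_half hd (by linarith : d ≤ 2 * q) h0 h1
    nlinarith [mul_le_mul_of_nonneg_left this hk, mul_nonneg hs hk']
  · have h3 := sing_half hd (by linarith : d ≤ 2 * r) h0 h1
    calc kern δ r * sing η q = kern (δ + η) r * sing η r * sing η q := by rw [kern_mul_sing hr]
      _ ≤ kern (δ + η) q * sing η r * sing η q := by
        have := kern_antitone hq hrq h2
        have := sing_nonneg (η := η) hr.le
        have := sing_nonneg (η := η) hq.le
        gcongr
      _ = kern δ q * sing η r := by rw [mul_right_comm, kern_mul_sing hq]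
      _ ≤ kern δ q * (2 * sing η d) := by gcongr
      _ ≤ _ := by nlinarith [mul_nonneg hs hk]

lemma inv_mul_inv_le_kern {η r q d : ℝ} (hr : 0 < r) (hq : 0 < q) (hd : 0 < d) (h : d ≤ r + q)
    (h0 : 0 ≤ η) (h1 : η ≤ 1) :
    r⁻¹ * q⁻¹ ≤ 2 * sing η d * (kern η r + kern η q) := by
  wlog hrq : r ≤ q generalizing r q
  · have := this hq hr (by linarith) (by linarith)
    rw [mul_comm, add_comm (kern η r)]; exact this
  have hs := sing_nonneg (η := η) hd.le
  have hk' := kern_nonneg (δ := η) hq.le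
  have hk := kern_nonneg (δ := η) hr.le
  suffices H : r⁻¹ * q⁻¹ ≤ sing η q * kern η r by
    have h3 := sing_half hd (by linarith : d ≤ 2 * q) h0 h1
    nlinarith [mul_le_mul_of_nonneg_right h3 hk, mul_nonneg hs hk']
  have h3 : r / q ≤ sing η q * (min r 1) ^ η := by
    have e : sing η q * (min r 1) ^ η = (min r 1 / min q 1) ^ η := by
      unfold sing
      rw [Real.div_rpow (by positivity) (by positivity), Real.rpow_neg (by positivity)]; field_simp
    rw [e]
    have hle : r / q ≤ min r 1 / min q 1 := by
      rw [div_le_div_iff₀ hq (by positivity)]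
      rcases le_total r 1 with h4 | h4
      · rw [min_eq_left h4]; gcongr; exact min_le_left _ _
      · rw [min_eq_right h4, min_eq_right (h4.trans hrq)]; linarith
    have hle1 : min r 1 / min q 1 ≤ 1 := by
      rw [div_le_one (by positivity)]; exact min_le_min_right _ hrq
    calc r / q ≤ min r 1 / min q 1 := hle
      _ = (min r 1 / min q 1) ^ (1 : ℝ) := (Real.rpow_one _).symm
      _ ≤ _ := Real.rpow_le_rpow_of_exponent_ge (by positivity) hle1 h1
  calc r⁻¹ * q⁻¹ = (r / q) / r ^ 2 := by field_simp
    _ ≤ (sing η q * (min r 1) ^ η) / r ^ 2 := by gcongr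
    _ = _ := by unfold kern; ring

lemma kern_mul_sing_le_add {η r q : ℝ} (hr : 0 < r) (hq : 0 < q) (h0 : 0 ≤ η) (h1 : η ≤ 1) :
    kern (2 * η) r * sing η q ≤ kern η r + kern η q := by
  have hk := kern_nonneg (δ := η) hr.le
  have hk' := kern_nonneg (δ := η) hq.le
  rcases le_total r q with h | h
  · have := sing_antitone hr h h0
    have e := kern_mul_sing (δ := η) (η := η) hr
    rw [← two_mul] at e
    nlinarith [kern_nonneg (δ := 2 * η) hr.le]
  · have := kern_antitone hq h (by linarith : 2 * η ≤ 2)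
    have e := kern_mul_sing (δ := η) (η := η) hq
    rw [← two_mul] at e
    nlinarith [sing_nonneg (η := η) hq.le]

@[fun_prop] lemma measurable_kern (δ : ℝ) : Measurable (kern δ) := by
  unfold kern; fun_prop

@[fun_prop] lemma measurable_sing (η : ℝ) : Measurable (sing η) := by
  unfold sing; fun_prop

/-- A kernel with decay at infinity is integrable over the plane, uniformly in its centre. -/
lemma exists_lintegral_kern_le {δ κ : ℝ} (h0 : 0 < δ) (h1 : δ ≤ 2) (hκ : 0 < κ) :
    ∃ M : NNReal, ∀ c : ℂ,
      ∫⁻ x : ℂ, ENNReal.ofReal (kern δ ‖x - c‖ * (1 + ‖x‖) ^ (-κ)) ≤ M := by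
  set k : ℝ → ℝ := fun r => kern δ r * (max r 1) ^ (-κ)
  have hkm : Measurable k := by fun_prop
  have hint : Integrable (fun x : ℂ => k ‖x‖) := by
    rw [integrable_fun_norm_addHaar]
    simp only [Complex.finrank_real_complex, Nat.add_one_sub_one, pow_one, smul_eq_mul]
    rw [← Set.Ioc_union_Ioi_eq_Ioi zero_le_one]
    refine IntegrableOn.union ?_ ?_
    · have : IntegrableOn (fun r : ℝ => r ^ (δ - 1)) (Set.Ioc 0 1) := by
        rw [← intervalIntegrable_iff_integrableOn_Ioc_of_le zero_le_one]
        exact intervalIntegral.intervalIntegrable_rpow' (by linarith)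
      refine this.congr_fun (fun r hr => ?_) measurableSet_Ioc
      simp only [k, kern, min_eq_left hr.2, max_eq_right hr.2, Real.one_rpow, mul_one]
      rw [Real.rpow_sub hr.1, Real.rpow_one]; have := hr.1; field_simp
    · have : IntegrableOn (fun r : ℝ => r ^ (-1 - κ)) (Set.Ioi 1) :=
        integrableOn_Ioi_rpow_of_lt (by linarith) zero_lt_one
      refine this.congr_fun (fun r hr => ?_) measurableSet_Ioi
      have hr' : (1 : ℝ) < r := hr
      have hr0 : 0 < r := by linarith
      simp only [k, kern, min_eq_right hr'.le, max_eq_left hr'.le, Real.one_rpow]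
      rw [show -1 - κ = -κ - 1 by ring, Real.rpow_sub hr0, Real.rpow_one]; field_simp
  have hfin : ∫⁻ x : ℂ, ENNReal.ofReal (k ‖x‖) ≠ ⊤ := by
    have := hint.lintegral_lt_top
    exact this.ne
  lift ∫⁻ x : ℂ, ENNReal.ofReal (k ‖x‖) to NNReal using hfin with I hI
  refine ⟨I + I, fun c => ?_⟩
  have hb : ∀ᵐ x : ℂ, ENNReal.ofReal (kern δ ‖x - c‖ * (1 + ‖x‖) ^ (-κ)) ≤
      ENNReal.ofReal (k ‖x - c‖) + ENNReal.ofReal (k ‖x‖) := by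
    have n1 : ∀ᵐ x : ℂ, x ≠ c := by simp [ae_iff]
    have n2 : ∀ᵐ x : ℂ, x ≠ 0 := by simp [ae_iff]
    filter_upwards [n1, n2] with x hx hx0
    have p1 : 0 < ‖x - c‖ := norm_pos_iff.2 (sub_ne_zero.2 hx)
    have p2 : 0 < ‖x‖ := norm_pos_iff.2 hx0
    rcases le_total ‖x - c‖ ‖x‖ with h | h
    · refine le_trans (ENNReal.ofReal_le_ofReal ?_) le_self_add
      refine mul_le_mul_of_nonneg_left ?_ (kern_nonneg p1.le)
      exact Real.rpow_le_rpow_of_nonpos (by positivity) (max_le (by linarith) (by linarith))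
        (by linarith)
    · refine le_trans (ENNReal.ofReal_le_ofReal ?_) le_add_self
      refine mul_le_mul (kern_antitone p2 h h1) ?_ (by positivity) (kern_nonneg p2.le)
      exact Real.rpow_le_rpow_of_nonpos (by positivity) (max_le (by linarith) (by linarith))
        (by linarith)
  calc _ ≤ ∫⁻ x : ℂ, (ENNReal.ofReal (k ‖x - c‖) + ENNReal.ofReal (k ‖x‖)) :=
        lintegral_mono_ae hb
    _ = _ := by
        rw [lintegral_add_left (by fun_prop),
          lintegral_sub_right_eq_self (fun x : ℂ => ENNReal.ofReal (k ‖x‖)) c, ← hI]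
        simp

end

noncomputable section

/-- The singular weight at the two exceptional points `1` and `p`. -/
def sing₂ (η : ℝ) (p x : ℂ) : ℝ := sing η ‖x - 1‖ + sing η ‖x - p‖

@[fun_prop] lemma measurable_sing₂ (η : ℝ) (p : ℂ) : Measurable (sing₂ η p) := by
  unfold sing₂; fun_prop

lemma sing₂_nonneg (η : ℝ) (p x : ℂ) : 0 ≤ sing₂ η p x :=
  add_nonneg (sing_nonneg (norm_nonneg _)) (sing_nonneg (norm_nonneg _))

lemma one_le_sing₂ {η : ℝ} {p x : ℂ} (h1 : x ≠ 1) (hη : 0 ≤ η) : 1 ≤ sing₂ η p x :=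
  (one_le_sing (norm_pos_iff.2 (sub_ne_zero.2 h1)) hη).trans
    (le_add_of_nonneg_right (sing_nonneg (norm_nonneg _)))

lemma sing₂_mul_le {η θ : ℝ} {p x : ℂ} (h1 : x ≠ 1) (hp : x ≠ p) (hη : 0 ≤ η) (hθ : 0 ≤ θ) :
    sing₂ η p x * sing₂ θ p x ≤ 3 * sing₂ (η + θ) p x := by
  have key : ∀ r q : ℝ, 0 < r → 0 < q →
      sing η r * sing θ q ≤ sing (η + θ) r + sing (η + θ) q := by
    intro r q hr hq
    rcases le_total r q with h | h
    · have := mul_le_mul_of_nonneg_left (sing_antitone hr h hθ) (sing_nonneg (η := η) hr.le)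
      rw [sing_mul hr] at this
      linarith [sing_nonneg (η := η + θ) hq.le]
    · have := mul_le_mul_of_nonneg_right (sing_antitone hq h hη) (sing_nonneg (η := θ) hq.le)
      rw [sing_mul hq] at this
      linarith [sing_nonneg (η := η + θ) hr.le]
  have a := norm_pos_iff.2 (sub_ne_zero.2 h1)
  have b := norm_pos_iff.2 (sub_ne_zero.2 hp)
  unfold sing₂
  have k1 := key _ _ a b
  have k2 := key _ _ b a
  rw [add_mul, mul_add, mul_add, sing_mul a, sing_mul b]
  have := sing_nonneg (η := η + θ) a.le
  have := sing_nonneg (η := η + θ) b.le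
  linarith

/-- The factor of one variable `x` in the dominating function; `c` runs over the other points. -/
def stepKer {ι : Type*} [Fintype ι] (δ η κ : ℝ) (p : ℂ) (c : ι → ℂ) (x : ℂ) : ℝ :=
  (∑ k, ‖x - c k‖⁻¹ + ‖x - p‖⁻¹) * (∑ k, ‖x - c k‖⁻¹ + ‖x - 1‖⁻¹)
    * (∏ k, (min ‖x - c k‖ 1) ^ δ) * sing₂ η p x * (1 + ‖x‖) ^ (-κ)

lemma stepKer_nonneg {ι : Type*} [Fintype ι] (δ η κ : ℝ) (p : ℂ) (c : ι → ℂ) (x : ℂ) :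
    0 ≤ stepKer δ η κ p c x := by
  have := sing₂_nonneg η p x
  unfold stepKer
  positivity

/-- The sum of the kernels that occur in the estimate of `stepKer`. -/
def kern₃ (δ η r : ℝ) : ℝ := kern δ r + kern (2 * η) r + kern η r

@[fun_prop] lemma measurable_kern₃ (δ η : ℝ) : Measurable (kern₃ δ η) := by
  unfold kern₃; fun_prop

lemma kern₃_nonneg {δ η r : ℝ} (hr : 0 ≤ r) : 0 ≤ kern₃ δ η r := by
  have := kern_nonneg (δ := δ) hr
  have := kern_nonneg (δ := 2 * η) hr
  have := kern_nonneg (δ := η) hr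
  unfold kern₃; positivity

lemma stepKer_le {ι : Type*} [Fintype ι] {δ η : ℝ} (κ : ℝ) {p : ℂ} {c : ι → ℂ} {x : ℂ}
    (hδ : 0 ≤ δ) (hδ1 : δ ≤ 1) (hη : 0 ≤ η) (hη1 : η ≤ 1 / 2) (hp : p ≠ 1)
    (hc1 : ∀ k, c k ≠ 1) (hcp : ∀ k, c k ≠ p) (hx : ∀ k, x ≠ c k) (hx1 : x ≠ 1) (hxp : x ≠ p) :
    stepKer δ η κ p c x ≤
      (∑ k, (2 * Fintype.card ι + 24) * sing₂ (3 * η) p (c k)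
          * (kern₃ δ η ‖x - c k‖ + kern₃ δ η ‖x - 1‖ + kern₃ δ η ‖x - p‖)
        + 8 * sing (2 * η) ‖p - 1‖ * (kern₃ δ η ‖x - 1‖ + kern₃ δ η ‖x - p‖))
      * (1 + ‖x‖) ^ (-κ) := by
  unfold stepKer
  refine mul_le_mul_of_nonneg_right ?_ (by positivity)
  have ha : 0 < ‖x - 1‖ := norm_pos_iff.2 (sub_ne_zero.2 hx1)
  have hb : 0 < ‖x - p‖ := norm_pos_iff.2 (sub_ne_zero.2 hxp)
  have hr : ∀ k, 0 < ‖x - c k‖ := fun k => norm_pos_iff.2 (sub_ne_zero.2 (hx k))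
  have hca : ∀ k, 0 < ‖c k - 1‖ := fun k => norm_pos_iff.2 (sub_ne_zero.2 (hc1 k))
  have hcb : ∀ k, 0 < ‖c k - p‖ := fun k => norm_pos_iff.2 (sub_ne_zero.2 (hcp k))
  have hpp : 0 < ‖p - 1‖ := norm_pos_iff.2 (sub_ne_zero.2 hp)
  have tri : ∀ u v : ℂ, ‖u - v‖ ≤ ‖x - u‖ + ‖x - v‖ := fun u v => by
    calc ‖u - v‖ = ‖(x - v) - (x - u)‖ := by ring_nf
      _ ≤ _ := (norm_sub_le _ _).trans (by linarith)
  set a := ‖x - 1‖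
  set b := ‖x - p‖
  set B := sing₂ η p x with hB
  have hB0 : 0 ≤ B := sing₂_nonneg _ _ _
  -- a kernel times the weight
  have move : ∀ (θ : ℝ) (_ : θ + η ≤ 2) (k : ι), kern θ ‖x - c k‖ * B ≤
      2 * sing₂ η p (c k) * (kern θ ‖x - c k‖ + kern θ a + kern θ b) := by
    intro θ hθ k
    have h1 := kern_mul_sing_le (δ := θ) (η := η) (hr k) ha (hca k) (tri _ _) hη (by linarith) hθ
    have h2 := kern_mul_sing_le (δ := θ) (η := η) (hr k) hb (hcb k) (tri _ _) hη (by linarith) hθ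
    have s1 := sing_nonneg (η := η) (hca k).le
    have s2 := sing_nonneg (η := η) (hcb k).le
    have k1 := kern_nonneg (δ := θ) ha.le
    have k2 := kern_nonneg (δ := θ) hb.le
    have e : B = sing η a + sing η b := rfl
    rw [e]; unfold sing₂
    nlinarith [mul_nonneg s1 k2, mul_nonneg s2 k1]
  have hab : (kern (2 * η) a + kern (2 * η) b) * B ≤ 4 * (kern η a + kern η b) := by
    have e : B = sing η a + sing η b := rfl
    have h1 := kern_mul_sing_le_add (η := η) ha ha hη (by linarith)
    have h2 := kern_mul_sing_le_add (η := η) ha hb hη (by linarith)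
    have h3 := kern_mul_sing_le_add (η := η) hb ha hη (by linarith)
    have h4 := kern_mul_sing_le_add (η := η) hb hb hη (by linarith)
    rw [e]; linarith
  have K0 : ∀ θ : ℝ, 0 ≤ kern θ a ∧ 0 ≤ kern θ b ∧ ∀ k, 0 ≤ kern θ ‖x - c k‖ := fun θ =>
    ⟨kern_nonneg ha.le, kern_nonneg hb.le, fun k => kern_nonneg (hr k).le⟩
  -- the three types of terms
  have t1 : ∀ k, kern δ ‖x - c k‖ * B ≤ 2 * sing₂ (3 * η) p (c k)
      * (kern₃ δ η ‖x - c k‖ + kern₃ δ η a + kern₃ δ η b) := by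
    intro k
    refine (move δ (by linarith) k).trans ?_
    have := sing₂_nonneg η p (c k)
    have mono : sing₂ η p (c k) ≤ sing₂ (3 * η) p (c k) :=
      add_le_add (sing_mono (hca k) (by linarith)) (sing_mono (hcb k) (by linarith))
    obtain ⟨_, _, _⟩ := K0 δ
    have h0 := (K0 δ).2.2 k
    have h1 := (K0 (2 * η)).2.2 k
    have h2 := (K0 η).2.2 k
    have h3 := (K0 (2 * η))
    have h4 := (K0 η)
    unfold kern₃
    gcongr <;> linarith
  have t2 : ∀ k, ‖x - c k‖⁻¹ * (a⁻¹ + b⁻¹) * B ≤ 24 * sing₂ (3 * η) p (c k)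
      * (kern₃ δ η ‖x - c k‖ + kern₃ δ η a + kern₃ δ η b) := by
    intro k
    have i1 := inv_mul_inv_le_kern (η := 2 * η) (hr k) ha (hca k) (tri _ _) (by linarith)
      (by linarith)
    have i2 := inv_mul_inv_le_kern (η := 2 * η) (hr k) hb (hcb k) (tri _ _) (by linarith)
      (by linarith)
    have s1 := sing_nonneg (η := 2 * η) (hca k).le
    have s2 := sing_nonneg (η := 2 * η) (hcb k).le
    obtain ⟨k1, k2, k3⟩ := K0 (2 * η)
    obtain ⟨k1', k2', k3'⟩ := K0 η
    obtain ⟨k1'', k2'', k3''⟩ := K0 δ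
    have i3 : ‖x - c k‖⁻¹ * (a⁻¹ + b⁻¹) ≤ 2 * sing₂ (2 * η) p (c k)
        * (kern (2 * η) ‖x - c k‖ + (kern (2 * η) a + kern (2 * η) b)) := by
      unfold sing₂
      nlinarith [mul_nonneg s1 k2, mul_nonneg s2 k1]
    have S2 := sing₂_nonneg (2 * η) p (c k)
    have S1 := one_le_sing₂ (p := p) (hc1 k) hη
    have S3 := sing₂_mul_le (hc1 k) (hcp k) (by linarith : 0 ≤ 2 * η) hη
    rw [show 2 * η + η = 3 * η by ring] at S3
    have m := move (2 * η) (by linarith) k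
    set E := kern₃ δ η ‖x - c k‖ + kern₃ δ η a + kern₃ δ η b with hE
    have E1 : kern (2 * η) ‖x - c k‖ + kern (2 * η) a + kern (2 * η) b + (kern η a + kern η b)
        ≤ E := by
      rw [hE]; unfold kern₃; linarith [k3 k, k3' k, k3'' k]
    have E0 : 0 ≤ E := by linarith [k3 k]
    have i4 : (kern (2 * η) ‖x - c k‖ + (kern (2 * η) a + kern (2 * η) b)) * B
        ≤ 4 * sing₂ η p (c k) * E := by
      nlinarith [k3 k]
    calc _ ≤ 2 * sing₂ (2 * η) p (c k)
          * (kern (2 * η) ‖x - c k‖ + (kern (2 * η) a + kern (2 * η) b)) * B := by gcongr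
      _ ≤ 2 * sing₂ (2 * η) p (c k) * (4 * sing₂ η p (c k) * E) := by
          rw [mul_assoc]; gcongr
      _ = 8 * (sing₂ (2 * η) p (c k) * sing₂ η p (c k)) * E := by ring
      _ ≤ 8 * (3 * sing₂ (3 * η) p (c k)) * E := by gcongr
      _ = _ := by ring
  have t3 : a⁻¹ * b⁻¹ * B ≤ 8 * sing (2 * η) ‖p - 1‖ * (kern₃ δ η a + kern₃ δ η b) := by
    have i1 := inv_mul_inv_le_kern (η := 2 * η) ha hb hpp
      (by rw [add_comm]; exact tri _ _) (by linarith) (by linarith)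
    have s := sing_nonneg (η := 2 * η) hpp.le
    calc _ ≤ 2 * sing (2 * η) ‖p - 1‖ * (kern (2 * η) a + kern (2 * η) b) * B := by gcongr
      _ = 2 * sing (2 * η) ‖p - 1‖ * ((kern (2 * η) a + kern (2 * η) b) * B) := by ring
      _ ≤ 2 * sing (2 * η) ‖p - 1‖ * (4 * (kern₃ δ η a + kern₃ δ η b)) := by
          refine mul_le_mul_of_nonneg_left (hab.trans ?_) (by positivity)
          obtain ⟨k1, k2, k3⟩ := K0 (2 * η)
          obtain ⟨k1'', k2'', k3''⟩ := K0 δ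
          unfold kern₃; linarith
      _ = _ := by ring
  -- the algebra
  set g : ι → ℝ := fun k => (min ‖x - c k‖ 1) ^ δ with hg
  have g0 : ∀ k, 0 ≤ g k := fun k => by simp only [hg]; positivity
  have g1 : ∀ k, g k ≤ 1 := fun k =>
    Real.rpow_le_one (by positivity) (min_le_right _ _) hδ
  have P0 : 0 ≤ ∏ k, g k := Finset.prod_nonneg fun k _ => g0 k
  have P1 : ∏ k, g k ≤ 1 := Finset.prod_le_one (fun k _ => g0 k) fun k _ => g1 k
  have Pk : ∀ k, ∏ k, g k ≤ g k := fun k => by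
    classical
    rw [← Finset.mul_prod_erase Finset.univ _ (Finset.mem_univ k)]
    exact mul_le_of_le_one_right (g0 k) (Finset.prod_le_one (fun k _ => g0 k) fun k _ => g1 k)
  set S := ∑ k, ‖x - c k‖⁻¹ with hS
  have S0 : 0 ≤ S := Finset.sum_nonneg fun k _ => by positivity
  have q1 : S ^ 2 * (∏ k, g k) ≤ Fintype.card ι * ∑ k, kern δ ‖x - c k‖ := by
    have c1 : S ^ 2 ≤ Fintype.card ι * ∑ k, (‖x - c k‖⁻¹) ^ 2 := by
      rw [hS, ← Finset.card_univ]; exact sq_sum_le_card_mul_sum_sq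
    calc _ ≤ (Fintype.card ι * ∑ k, (‖x - c k‖⁻¹) ^ 2) * (∏ k, g k) := by gcongr
      _ = Fintype.card ι * ∑ k, (‖x - c k‖⁻¹) ^ 2 * (∏ k, g k) := by
          rw [mul_assoc, Finset.sum_mul]
      _ ≤ Fintype.card ι * ∑ k, (‖x - c k‖⁻¹) ^ 2 * g k := by
          gcongr with k; exact Pk k
      _ = _ := by
          congr 1; refine Finset.sum_congr rfl fun k _ => ?_
          simp only [hg, kern]; rw [inv_pow]; field_simp
  have q2 : (S + b⁻¹) * (S + a⁻¹) * (∏ k, g k) ≤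
      Fintype.card ι * ∑ k, kern δ ‖x - c k‖ + S * (a⁻¹ + b⁻¹) + a⁻¹ * b⁻¹ := by
    have : 0 ≤ S * (a⁻¹ + b⁻¹) + a⁻¹ * b⁻¹ := by positivity
    nlinarith [mul_le_mul_of_nonneg_left P1 this]
  calc _ ≤ (Fintype.card ι * ∑ k, kern δ ‖x - c k‖ + S * (a⁻¹ + b⁻¹) + a⁻¹ * b⁻¹) * B := by
        gcongr
    _ = ∑ k, (Fintype.card ι * (kern δ ‖x - c k‖ * B) + ‖x - c k‖⁻¹ * (a⁻¹ + b⁻¹) * B)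
        + a⁻¹ * b⁻¹ * B := by
        rw [Finset.sum_add_distrib, ← Finset.mul_sum, ← Finset.sum_mul, ← Finset.sum_mul,
          ← Finset.sum_mul]; ring
    _ ≤ _ := by
        refine add_le_add (Finset.sum_le_sum fun k _ => ?_) t3
        have := t1 k
        have := t2 k
        have hN : (0 : ℝ) ≤ Fintype.card ι := by positivity
        nlinarith [mul_le_mul_of_nonneg_left (t1 k) hN]

lemma measurable_stepKer {ι : Type*} [Fintype ι] (δ η κ : ℝ) (p : ℂ) (c : ι → ℂ) :
    Measurable (stepKer δ η κ p c) := by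
  unfold stepKer; fun_prop

/-- Integrating out one variable. -/
lemma exists_lintegral_stepKer_le (ι : Type*) [Fintype ι] {δ η κ d : ℝ} (hδ : 0 < δ) (hδ1 : δ ≤ 1)
    (hη : 0 < η) (hη1 : η ≤ 1 / 2) (hκ : 0 < κ) (hd : 0 < d) :
    ∃ M : NNReal, ∀ (p : ℂ) (c : ι → ℂ), d ≤ ‖p - 1‖ → (∀ k, c k ≠ 1) → (∀ k, c k ≠ p) →
      ∫⁻ x : ℂ, ENNReal.ofReal (stepKer δ η κ p c x) ≤
        ENNReal.ofReal (M * ∏ k, sing₂ (3 * η) p (c k)) := by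
  obtain ⟨M, hM⟩ : ∃ M : NNReal, ∀ c : ℂ,
      ∫⁻ x : ℂ, ENNReal.ofReal (kern₃ δ η ‖x - c‖ * (1 + ‖x‖) ^ (-κ)) ≤ M := by
    obtain ⟨M1, h1⟩ := exists_lintegral_kern_le hδ (by linarith) hκ
    obtain ⟨M2, h2⟩ := exists_lintegral_kern_le (by linarith : 0 < 2 * η) (by linarith) hκ
    obtain ⟨M3, h3⟩ := exists_lintegral_kern_le hη (by linarith) hκ
    refine ⟨M1 + M2 + M3, fun c => ?_⟩
    have : ∀ x : ℂ, ENNReal.ofReal (kern₃ δ η ‖x - c‖ * (1 + ‖x‖) ^ (-κ)) =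
        ENNReal.ofReal (kern δ ‖x - c‖ * (1 + ‖x‖) ^ (-κ))
        + ENNReal.ofReal (kern (2 * η) ‖x - c‖ * (1 + ‖x‖) ^ (-κ))
        + ENNReal.ofReal (kern η ‖x - c‖ * (1 + ‖x‖) ^ (-κ)) := by
      intro x
      have := kern_nonneg (δ := δ) (norm_nonneg (x - c))
      have := kern_nonneg (δ := 2 * η) (norm_nonneg (x - c))
      have := kern_nonneg (δ := η) (norm_nonneg (x - c))
      rw [← ENNReal.ofReal_add (by positivity) (by positivity),
        ← ENNReal.ofReal_add (by positivity) (by positivity)]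
      unfold kern₃; ring_nf
    simp_rw [this]
    rw [lintegral_add_right _ (by fun_prop), lintegral_add_right _ (by fun_prop)]
    push_cast
    gcongr
    · exact h1 c
    · exact h2 c
    · exact h3 c
  set N : ℝ := (Fintype.card ι : ℝ) with hN
  set s := sing (2 * η) d with hs
  have hs0 : 0 ≤ s := sing_nonneg hd.le
  refine ⟨⟨(2 * N + 24) * N * (3 * M) + 8 * s * (2 * M), by positivity⟩,
    fun p c hp hc1 hcp => ?_⟩
  have hpne : p ≠ 1 := fun h => by simp [h] at hp; linarith
  have hsp : sing (2 * η) ‖p - 1‖ ≤ s := sing_antitone hd hp (by linarith)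
  set F : ℂ → ℂ → ℝ := fun c x => kern₃ δ η ‖x - c‖ * (1 + ‖x‖) ^ (-κ) with hF
  have F0 : ∀ c x, 0 ≤ F c x := fun c x =>
    mul_nonneg (kern₃_nonneg (norm_nonneg _)) (by positivity)
  have Fm : ∀ c, Measurable fun x => ENNReal.ofReal (F c x) := fun c => by
    simp only [hF]; fun_prop
  have hb : ∀ᵐ x : ℂ, ENNReal.ofReal (stepKer δ η κ p c x) ≤
      ∑ k, ENNReal.ofReal ((2 * N + 24) * sing₂ (3 * η) p (c k)) *
        (ENNReal.ofReal (F (c k) x) + ENNReal.ofReal (F 1 x) + ENNReal.ofReal (F p x))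
      + ENNReal.ofReal (8 * s) * (ENNReal.ofReal (F 1 x) + ENNReal.ofReal (F p x)) := by
    have n1 : ∀ᵐ x : ℂ, x ≠ 1 := by simp [ae_iff]
    have n2 : ∀ᵐ x : ℂ, x ≠ p := by simp [ae_iff]
    have n3 : ∀ᵐ x : ℂ, ∀ k, x ≠ c k := by
      rw [ae_all_iff]; intro k; simp [ae_iff]
    filter_upwards [n1, n2, n3] with x h1 h2 h3
    have := stepKer_le κ hδ.le hδ1 hη.le hη1 hpne hc1 hcp h3 h1 h2
    refine (ENNReal.ofReal_le_ofReal this).trans ?_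
    have s0 := fun k => sing₂_nonneg (3 * η) p (c k)
    have : ∀ k, ENNReal.ofReal ((2 * N + 24) * sing₂ (3 * η) p (c k)) *
        (ENNReal.ofReal (F (c k) x) + ENNReal.ofReal (F 1 x) + ENNReal.ofReal (F p x)) =
        ENNReal.ofReal ((2 * N + 24) * sing₂ (3 * η) p (c k) * (F (c k) x + F 1 x + F p x)) := by
      intro k
      have := s0 k
      rw [← ENNReal.ofReal_add (F0 _ _) (F0 _ _), ← ENNReal.ofReal_add (add_nonneg (F0 _ _) (F0 _ _))
        (F0 _ _), ← ENNReal.ofReal_mul (by positivity)]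
    simp_rw [this]
    rw [← ENNReal.ofReal_add (F0 _ _) (F0 _ _), ← ENNReal.ofReal_mul (by positivity),
      ← ENNReal.ofReal_sum_of_nonneg, ← ENNReal.ofReal_add]
    · refine ENNReal.ofReal_le_ofReal ?_
      rw [add_mul, Finset.sum_mul]
      have e1 : ∀ k, (2 * N + 24) * sing₂ (3 * η) p (c k) * (F (c k) x + F 1 x + F p x) =
          (2 * N + 24) * sing₂ (3 * η) p (c k)
          * (kern₃ δ η ‖x - c k‖ + kern₃ δ η ‖x - 1‖ + kern₃ δ η ‖x - p‖)
          * (1 + ‖x‖) ^ (-κ) := fun k => by simp only [hF]; ring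
      simp_rw [e1]
      refine add_le_add_right ?_ _
      have : F 1 x + F p x = (kern₃ δ η ‖x - 1‖ + kern₃ δ η ‖x - p‖) * (1 + ‖x‖) ^ (-κ) := by
        simp only [hF]; ring
      rw [this, ← mul_assoc]
      have := kern₃_nonneg (δ := δ) (η := η) (norm_nonneg (x - 1))
      have := kern₃_nonneg (δ := δ) (η := η) (norm_nonneg (x - p))
      refine mul_le_mul_of_nonneg_right ?_ (by positivity)
      refine mul_le_mul_of_nonneg_right ?_ (by positivity)
      linarith
    · refine Finset.sum_nonneg fun k _ => ?_
      have := s0 k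
      have := F0 (c k) x
      have := F0 1 x
      have := F0 p x
      positivity
    · have := F0 1 x
      have := F0 p x
      positivity
    · intro k _
      have := s0 k
      have := F0 (c k) x
      have := F0 1 x
      have := F0 p x
      positivity
  have Sk : ∀ k, 1 ≤ sing₂ (3 * η) p (c k) := fun k => one_le_sing₂ (hc1 k) (by linarith)
  have one_le_prod : ∀ t : Finset ι, 1 ≤ ∏ k ∈ t, sing₂ (3 * η) p (c k) := fun t => by
    calc (1 : ℝ) = ∏ k ∈ t, (1 : ℝ) := by simp
      _ ≤ _ := Finset.prod_le_prod (fun _ _ => zero_le_one) fun i _ => Sk i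
  set Q := ∏ k, sing₂ (3 * η) p (c k) with hQ
  have hQk : ∀ k, sing₂ (3 * η) p (c k) ≤ Q := by
    intro k
    classical
    rw [hQ, ← Finset.mul_prod_erase Finset.univ _ (Finset.mem_univ k)]
    exact le_mul_of_one_le_right (by linarith [Sk k]) (one_le_prod _)
  have hQ1 : 1 ≤ Q := one_le_prod _
  refine (lintegral_mono_ae hb).trans ?_
  rw [lintegral_add_right _ (by fun_prop), lintegral_finsetSum _ (by fun_prop)]
  rw [lintegral_const_mul _ (by fun_prop), lintegral_add_right _ (Fm p)]
  have e2 : ∀ k, ∫⁻ x, ENNReal.ofReal ((2 * N + 24) * sing₂ (3 * η) p (c k)) *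
      (ENNReal.ofReal (F (c k) x) + ENNReal.ofReal (F 1 x) + ENNReal.ofReal (F p x)) ≤
      ENNReal.ofReal ((2 * N + 24) * Q * (3 * M)) := by
    intro k
    rw [lintegral_const_mul _ (by fun_prop), lintegral_add_right _ (Fm p),
      lintegral_add_right _ (Fm 1),
      ENNReal.ofReal_mul (p := (2 * N + 24) * Q) (by positivity)]
    refine mul_le_mul' (ENNReal.ofReal_le_ofReal ?_) ?_
    · exact mul_le_mul_of_nonneg_left (hQk k) (by positivity)
    · calc _ ≤ (M : ENNReal) + M + M := by
            gcongr
            · exact hM _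
            · exact hM _
            · exact hM _
        _ = ENNReal.ofReal (3 * M) := by
            rw [ENNReal.ofReal_mul (by norm_num), ENNReal.ofReal_coe_nnreal]; norm_num; ring
  calc _ ≤ ∑ k : ι, ENNReal.ofReal ((2 * N + 24) * Q * (3 * M))
        + ENNReal.ofReal (8 * s) * ((M : ENNReal) + M) := by
        gcongr with k
        · exact e2 k
        · exact hM _
        · exact hM _
    _ = ENNReal.ofReal (N * ((2 * N + 24) * Q * (3 * M)) + 8 * s * (2 * M)) := by
        rw [ENNReal.ofReal_add (by positivity) (by positivity), Finset.sum_const, Finset.card_univ,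
          nsmul_eq_mul, ENNReal.ofReal_mul (p := N) (by positivity), hN, ENNReal.ofReal_natCast,
          ENNReal.ofReal_mul (p := 8 * s) (by positivity), ENNReal.ofReal_mul (p := 2) (by norm_num),
          ENNReal.ofReal_coe_nnreal]
        norm_num; rw [two_mul (M : ENNReal)]
    _ ≤ _ := by
        refine ENNReal.ofReal_le_ofReal ?_
        change _ ≤ ((2 * N + 24) * N * (3 * M) + 8 * s * (2 * M)) * Q
        have : 8 * s * (2 * (M : ℝ)) ≤ 8 * s * (2 * M) * Q := le_mul_of_one_le_right
          (by positivity) hQ1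
        nlinarith

end

noncomputable section

/-- The dominating function. The variables are integrated out in the order of increasing rank `ρ`;
a variable is linked to variables of larger rank, to `0`, and to the points `1` and `p`. -/
def domFun {ι : Type*} [Fintype ι] (ρ : ι → ℕ) (δ η κ : ℝ) (p : ℂ) (x : ι → ℂ) : ℝ :=
  ∏ j, ((∑ l with ρ j < ρ l, ‖x j - x l‖⁻¹ + ‖x j‖⁻¹ + ‖x j - p‖⁻¹)
    * (∑ l with ρ j < ρ l, ‖x j - x l‖⁻¹ + ‖x j‖⁻¹ + ‖x j - 1‖⁻¹)
    * ((∏ l with ρ j < ρ l, (min ‖x j - x l‖ 1) ^ δ) * (min ‖x j‖ 1) ^ δ)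
    * sing₂ η p (x j) * (1 + ‖x j‖) ^ (-κ))

lemma domFun_nonneg {ι : Type*} [Fintype ι] (ρ : ι → ℕ) (δ η κ : ℝ) (p : ℂ) (x : ι → ℂ) :
    0 ≤ domFun ρ δ η κ p x := by
  refine Finset.prod_nonneg fun j _ => ?_
  have := sing₂_nonneg η p (x j)
  positivity

lemma measurable_domFun {ι : Type*} [Fintype ι] (ρ : ι → ℕ) (δ η κ : ℝ) (p : ℂ) :
    Measurable (domFun ρ δ η κ p) := by
  unfold domFun; fun_prop

lemma domFun_cons {n : ℕ} (δ η κ : ℝ) (p x₀ : ℂ) (y : Fin n → ℂ) :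
    domFun (Fin.val (n := n + 1)) δ η κ p (Fin.cons x₀ y) =
      stepKer δ η κ p (Fin.cons 0 y : Fin (n + 1) → ℂ) x₀
        * domFun (Fin.val (n := n)) δ η κ p y := by
  have hf : ∀ {m : ℕ} (j : Fin m), Finset.univ.filter (fun l : Fin m => (j : ℕ) < l)
      = Finset.Ioi j := by intro m j; ext; simp
  unfold domFun stepKer
  rw [Fin.prod_univ_succ]
  simp only [hf, Fin.prod_univ_succ, Fin.sum_univ_succ, Fin.cons_zero, Fin.cons_succ,
    Fin.sum_Ioi_zero, Fin.prod_Ioi_zero, Fin.sum_Ioi_succ, Fin.prod_Ioi_succ, sub_zero]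
  congr 1
  ring

lemma ae_apply_ne {ι : Type*} [Fintype ι] (c : ℂ) : ∀ᵐ x : ι → ℂ, ∀ j, x j ≠ c := by
  rw [ae_all_iff]; intro j
  rw [ae_iff]
  simp only [ne_eq, not_not]
  exact Measure.pi_hyperplane (fun _ : ι => (volume : Measure ℂ)) j c

lemma exists_lintegral_domFun_fin_le {δ κ d : ℝ} (hδ : 0 < δ) (hδ1 : δ ≤ 1) (hκ : 0 < κ)
    (hd : 0 < d) (n : ℕ) : ∀ η : ℝ, 0 < η → 4 ^ n * η ≤ 1 / 2 →
    ∃ M : NNReal, ∀ p : ℂ, d ≤ ‖p‖ → d ≤ ‖p - 1‖ →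
      ∫⁻ x : Fin n → ℂ, ENNReal.ofReal (domFun Fin.val δ η κ p x) ≤ M := by
  induction n with
  | zero =>
    intro η _ _
    refine ⟨1, fun p _ _ => ?_⟩
    simp [domFun, volume_pi]
  | succ n ih =>
    intro η hη hη1
    have h4 : (1 : ℝ) ≤ 4 ^ n := one_le_pow₀ (by norm_num)
    have hη2 : η ≤ 1 / 2 := by rw [pow_succ] at hη1; nlinarith
    obtain ⟨M₁, hM₁⟩ := ih (4 * η) (by linarith) (by rw [pow_succ] at hη1; linarith)
    obtain ⟨M₂, hM₂⟩ := exists_lintegral_stepKer_le (Fin (n + 1)) hδ hδ1 hη hη2 hκ hd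
    have hs := sing_nonneg (η := 3 * η) hd.le
    set C : NNReal := ⟨M₂ * (1 + sing (3 * η) d) * 3 ^ n, by positivity⟩
    have hC : (C : ℝ) = M₂ * (1 + sing (3 * η) d) * 3 ^ n := rfl
    refine ⟨C * M₁, fun p hp hp1 => ?_⟩
    have hp0 : (0 : ℂ) ≠ p := fun h => by simp [← h] at hp; linarith
    have hpm := (volume_preserving_piFinSuccAbove (fun _ : Fin (n + 1) => ℂ) 0).symm
    rw [← hpm.lintegral_comp (measurable_domFun _ _ _ _ _).ennreal_ofReal]
    have e : ∀ q : ℂ × (Fin n → ℂ), (MeasurableEquiv.piFinSuccAbove (fun _ : Fin (n + 1) => ℂ) 0).symm q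
        = Fin.cons q.1 q.2 := fun q => by
      simp [MeasurableEquiv.piFinSuccAbove_symm_apply, Fin.insertNthEquiv]
    simp_rw [e, domFun_cons]
    rw [Measure.volume_eq_prod, lintegral_prod_symm']
    swap
    · have := (measurable_domFun (Fin.val (n := n + 1)) δ η κ p).ennreal_ofReal.comp
        (MeasurableEquiv.piFinSuccAbove (fun _ : Fin (n + 1) => ℂ) 0).symm.measurable
      simpa only [Function.comp_def, e, domFun_cons] using this
    have inner : ∀ᵐ y : Fin n → ℂ, ∫⁻ x : ℂ, ENNReal.ofReal
        (stepKer δ η κ p (Fin.cons 0 y : Fin (n + 1) → ℂ) x * domFun Fin.val δ η κ p y)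
        ≤ C * ENNReal.ofReal (domFun Fin.val δ (4 * η) κ p y) := by
      filter_upwards [ae_apply_ne (ι := Fin n) 1, ae_apply_ne (ι := Fin n) p] with y h1 hyp
      have D0 := domFun_nonneg (Fin.val (n := n)) δ η κ p y
      simp_rw [ENNReal.ofReal_mul (stepKer_nonneg _ _ _ _ _ _)]
      rw [lintegral_mul_const _ (measurable_stepKer _ _ _ _ _).ennreal_ofReal]
      have st := hM₂ p (Fin.cons 0 y) hp1 (Fin.cases (by simp) (by simpa using h1))
        (Fin.cases (by simpa using hp0) (by simpa using hyp))
      refine (mul_le_mul_left st _).trans ?_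
      have e1 : (C : ENNReal) = ENNReal.ofReal C := by simp
      rw [← ENNReal.ofReal_mul' D0, e1, ← ENNReal.ofReal_mul (p := (C : ℝ)) C.2]
      refine ENNReal.ofReal_le_ofReal ?_
      rw [Fin.prod_univ_succ]
      simp only [Fin.cons_zero, Fin.cons_succ]
      have z : sing₂ (3 * η) p 0 ≤ 1 + sing (3 * η) d := by
        unfold sing₂
        refine add_le_add (le_of_eq ?_) ?_
        · simp [sing]
        · exact sing_antitone hd (by simpa using hp) (by linarith)
      have w : (∏ j, sing₂ (3 * η) p (y j)) * domFun Fin.val δ η κ p y ≤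
          3 ^ n * domFun Fin.val δ (4 * η) κ p y := by
        have e3 : (3 : ℝ) ^ n = ∏ _j : Fin n, (3 : ℝ) := by simp
        unfold domFun
        rw [e3, ← Finset.prod_mul_distrib, ← Finset.prod_mul_distrib]
        have s0 := fun (θ : ℝ) (j : Fin n) => sing₂_nonneg θ p (y j)
        refine Finset.prod_le_prod (fun j _ => ?_) fun j _ => ?_
        · have := s0 (3 * η) j
          have := s0 η j
          positivity
        · have := sing₂_mul_le (h1 j) (hyp j) (by linarith : 0 ≤ 3 * η) hη.le
          rw [show 3 * η + η = 4 * η by ring] at this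
          set A := (∑ l : Fin n with Fin.val j < Fin.val l, ‖y j - y l‖⁻¹ + ‖y j‖⁻¹ + ‖y j - p‖⁻¹)
            * (∑ l : Fin n with Fin.val j < Fin.val l, ‖y j - y l‖⁻¹ + ‖y j‖⁻¹ + ‖y j - 1‖⁻¹)
            * ((∏ l : Fin n with Fin.val j < Fin.val l, (min ‖y j - y l‖ 1) ^ δ) * (min ‖y j‖ 1) ^ δ)
          set D := (1 + ‖y j‖) ^ (-κ)
          have hAD : 0 ≤ A * D := by positivity
          calc _ = (sing₂ (3 * η) p (y j) * sing₂ η p (y j)) * (A * D) := by ring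
            _ ≤ (3 * sing₂ (4 * η) p (y j)) * (A * D) := by gcongr
            _ = _ := by ring
      have := Finset.prod_nonneg fun (j : Fin n) (_ : j ∈ Finset.univ) =>
        sing₂_nonneg (3 * η) p (y j)
      calc _ = (M₂ * sing₂ (3 * η) p 0) * ((∏ j, sing₂ (3 * η) p (y j))
            * domFun Fin.val δ η κ p y) := by ring
        _ ≤ (M₂ * (1 + sing (3 * η) d)) * (3 ^ n * domFun Fin.val δ (4 * η) κ p y) := by
            gcongr
        _ = _ := by rw [hC]; ring
    calc _ ≤ ∫⁻ y : Fin n → ℂ, C * ENNReal.ofReal (domFun Fin.val δ (4 * η) κ p y) :=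
          lintegral_mono_ae inner
      _ ≤ _ := by
          rw [lintegral_const_mul _ (measurable_domFun _ _ _ _ _).ennreal_ofReal]
          push_cast
          gcongr
          exact hM₁ p hp hp1

/-- The dominating function is integrable, uniformly in the position of `p`. -/
lemma exists_lintegral_domFun_le {ι : Type*} [Fintype ι] {ρ : ι → ℕ} (hρ : Function.Injective ρ)
    {δ η κ d : ℝ} (hδ : 0 < δ) (hδ1 : δ ≤ 1) (hκ : 0 < κ) (hd : 0 < d) (hη : 0 < η)
    (hη1 : 4 ^ Fintype.card ι * η ≤ 1 / 2) :
    ∃ M : NNReal, ∀ p : ℂ, d ≤ ‖p‖ → d ≤ ‖p - 1‖ →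
      ∫⁻ x : ι → ℂ, ENNReal.ofReal (domFun ρ δ η κ p x) ≤ M := by
  obtain ⟨M, hM⟩ := exists_lintegral_domFun_fin_le hδ hδ1 hκ hd _ η hη hη1
  refine ⟨M, fun p hp hp1 => ?_⟩
  obtain ⟨e, he⟩ : ∃ e : Fin (Fintype.card ι) ≃ ι, ∀ i j, ρ (e i) < ρ (e j) ↔ i < j := by
    let : LinearOrder ι := LinearOrder.lift' ρ hρ
    let e := Fintype.orderIsoFinOfCardEq ι rfl
    exact ⟨e.toEquiv, fun i j => (e.lt_iff_lt (x := i) (y := j))⟩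
  refine le_trans (le_of_eq ?_) (hM p hp hp1)
  have hpm := volume_measurePreserving_piCongrLeft (fun _ : ι => ℂ) e
  rw [← hpm.lintegral_comp (measurable_domFun _ _ _ _ _).ennreal_ofReal]
  refine lintegral_congr fun x => ?_
  congr 1
  have ex : ∀ i, (MeasurableEquiv.piCongrLeft (fun _ : ι => ℂ) e) x (e i) = x i := fun i => by
    rw [MeasurableEquiv.coe_piCongrLeft, Equiv.piCongrLeft_apply_apply]
  unfold domFun
  rw [← e.prod_comp]
  refine Finset.prod_congr rfl fun j _ => ?_
  simp only [Finset.sum_filter, Finset.prod_filter]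
  rw [← e.sum_comp, ← e.prod_comp]
  simp only [ex, he, Fin.lt_def]

end

noncomputable section

/-- The length of the broken line from `a` through the points `w k`, `k ∈ t`, to `b`. -/
def chainLen (w : ℕ → ℂ) (b : ℂ) : ℂ → List ℕ → ℝ
  | a, [] => ‖a - b‖
  | a, k :: t => ‖a - w k‖ + chainLen w b (w k) t

/-- The product of the inverse lengths of the segments of this broken line. -/
def chainInv (w : ℕ → ℂ) (b : ℂ) : ℂ → List ℕ → ℝ
  | a, [] => ‖a - b‖⁻¹
  | a, k :: t => ‖a - w k‖⁻¹ * chainInv w b (w k) t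

lemma chainLen_nonneg (w : ℕ → ℂ) (b a : ℂ) (t : List ℕ) : 0 ≤ chainLen w b a t := by
  induction t generalizing a with
  | nil => exact norm_nonneg _
  | cons k t ih => exact add_nonneg (norm_nonneg _) (ih _)

lemma chainInv_nonneg (w : ℕ → ℂ) (b a : ℂ) (t : List ℕ) : 0 ≤ chainInv w b a t := by
  induction t generalizing a with
  | nil => exact inv_nonneg.2 (norm_nonneg _)
  | cons k t ih => exact mul_nonneg (inv_nonneg.2 (norm_nonneg _)) (ih _)

lemma norm_sub_le_chainLen (w : ℕ → ℂ) (b a : ℂ) (t : List ℕ) : ‖a - b‖ ≤ chainLen w b a t := by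
  induction t generalizing a with
  | nil => exact le_rfl
  | cons k t ih =>
    calc ‖a - b‖ = ‖(a - w k) + (w k - b)‖ := by ring_nf
      _ ≤ _ := (norm_add_le _ _).trans (add_le_add le_rfl (ih _))

lemma norm_apply_sub_le_chainLen (w : ℕ → ℂ) (b a : ℂ) (t : List ℕ) {k : ℕ} (hk : k ∈ t) :
    ‖w k - b‖ ≤ chainLen w b a t := by
  induction t generalizing a with
  | nil => simp at hk
  | cons j t ih =>
    rcases List.mem_cons.1 hk with rfl | h
    · exact (norm_sub_le_chainLen w b _ t).trans (le_add_of_nonneg_left (norm_nonneg _))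
    · exact (ih _ h).trans (le_add_of_nonneg_left (norm_nonneg _))

/-- The effect of removing one point from a broken line: it has neighbours `u` and `v`. -/
lemma exists_chain_erase (w : ℕ → ℂ) (b a : ℂ) (t : List ℕ) (x : ℕ) (hx : x ∈ t)
    (hd : (a :: (t.map w ++ [b])).Nodup) :
    ∃ (u v : ℂ) (s q : ℝ), 0 ≤ s ∧ 0 ≤ q ∧ u ≠ v ∧ u ≠ w x ∧ w x ≠ v ∧
      (u = a ∨ ∃ l ∈ t, l ≠ x ∧ u = w l) ∧ (v = b ∨ ∃ l ∈ t, l ≠ x ∧ v = w l) ∧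
      chainLen w b a t = ‖u - w x‖ + ‖w x - v‖ + s ∧
      chainInv w b a t = ‖u - w x‖⁻¹ * ‖w x - v‖⁻¹ * q ∧
      chainLen w b a (t.erase x) = ‖u - v‖ + s ∧
      chainInv w b a (t.erase x) = ‖u - v‖⁻¹ * q := by
  induction t generalizing a with
  | nil => simp at hx
  | cons k t ih =>
    have hd' : (w k :: (t.map w ++ [b])).Nodup := by
      simpa using (List.nodup_cons.1 hd).2
    by_cases hkx : k = x
    · subst hkx
      have ha := (List.nodup_cons.1 hd).1
      have hk := (List.nodup_cons.1 hd').1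
      simp only [List.map_cons, List.cons_append, List.mem_cons, List.mem_append, List.mem_map,
        not_or] at ha hk
      cases t with
      | nil =>
        refine ⟨a, b, 0, 1, le_rfl, zero_le_one, ?_, ?_, ?_, Or.inl rfl, Or.inl rfl, ?_⟩
        · simp at ha; tauto
        · tauto
        · simp at hk; tauto
        · simp [chainLen, chainInv]
      | cons j t =>
        refine ⟨a, w j, chainLen w b (w j) t, chainInv w b (w j) t, chainLen_nonneg _ _ _ _,
          chainInv_nonneg _ _ _ _, ?_, ?_, ?_, Or.inl rfl, Or.inr ⟨j, by simp, ?_, rfl⟩, ?_⟩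
        · rintro rfl; exact ha.2.1 ⟨j, by simp, rfl⟩
        · tauto
        · intro h; exact hk.1 ⟨j, by simp, h.symm⟩
        · rintro rfl; exact hk.1 ⟨j, by simp, rfl⟩
        · simp [chainLen, chainInv]
          constructor <;> ring
    · have hxt : x ∈ t := (List.mem_cons.1 hx).resolve_left (Ne.symm hkx)
      obtain ⟨u, v, s, q, hs, hq, h1, h2, h3, h4, h5, e1, e2, e3, e4⟩ := ih (w k) hxt hd'
      refine ⟨u, v, ‖a - w k‖ + s, ‖a - w k‖⁻¹ * q, by positivity, by positivity, h1, h2, h3,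
        Or.inr ?_, ?_, ?_, ?_, ?_, ?_⟩
      · rcases h4 with rfl | ⟨l, hl, hlx, rfl⟩
        · exact ⟨k, by simp, hkx, rfl⟩
        · exact ⟨l, by simp [hl], hlx, rfl⟩
      · rcases h5 with rfl | ⟨l, hl, hlx, rfl⟩
        · exact Or.inl rfl
        · exact Or.inr ⟨l, by simp [hl], hlx, rfl⟩
      · rw [chainLen, e1]; ring
      · rw [chainInv, e2]; ring
      · rw [List.erase_cons_tail (by simpa using hkx), chainLen, e3]; ring
      · rw [List.erase_cons_tail (by simpa using hkx), chainInv, e4]; ring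

/-- A broken line from `a` to `b` is dominated by a product over its vertices, each of which is
linked only to vertices of larger rank and to the end points. -/
lemma chainLen_mul_chainInv_le (w : ℕ → ℂ) (a b : ℂ) (ρ : ℕ → ℕ) (T : Finset ℕ)
    (hρ : Set.InjOn ρ T) (n : ℕ) :
    ∀ t : List ℕ, t.length = n → (∀ k ∈ t, k ∈ T) → (a :: (t.map w ++ [b])).Nodup →
    chainLen w b a t * chainInv w b a t ≤
      (t.map fun k => ∑ l ∈ T with ρ k < ρ l, ‖w k - w l‖⁻¹ + ‖w k - b‖⁻¹ + ‖w k - a‖⁻¹).prod := by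
  induction n with
  | zero =>
    intro t ht _ hd
    obtain rfl := List.length_eq_zero_iff.1 ht
    simp only [chainLen, chainInv, List.map_nil, List.prod_nil]
    exact mul_inv_le_one
  | succ n ih =>
    intro t ht hT hd
    set U : ℕ → ℝ := fun k => ∑ l ∈ T with ρ k < ρ l, ‖w k - w l‖⁻¹ + ‖w k - b‖⁻¹ + ‖w k - a‖⁻¹
      with hU
    have hne : t.toFinset.Nonempty := by
      rw [List.toFinset_nonempty_iff]; rintro rfl; simp at ht
    obtain ⟨x, hx, hmin⟩ := Finset.exists_min_image t.toFinset ρ hne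
    simp only [List.mem_toFinset] at hx hmin
    have hlt : ∀ l ∈ t, l ≠ x → ρ x < ρ l := fun l hl hlx =>
      lt_of_le_of_ne (hmin l hl) fun h => hlx (hρ (hT l hl) (hT x hx) h.symm)
    obtain ⟨u, v, s, q, hs, hq, h1, h2, h3, h4, h5, e1, e2, e3, e4⟩ :=
      exists_chain_erase w b a t x hx hd
    have hsub : (a :: ((t.erase x).map w ++ [b])).Sublist (a :: (t.map w ++ [b])) :=
      List.Sublist.cons_cons a ((List.erase_sublist.map w).append_right [b])
    have IH := ih (t.erase x) (by rw [List.length_erase_of_mem hx, ht]; rfl)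
      (fun k hk => hT k (List.mem_of_mem_erase hk)) (hd.sublist hsub)
    rw [← List.prod_map_erase U hx]
    have r1 : 0 < ‖u - w x‖ := norm_pos_iff.2 (sub_ne_zero.2 h2)
    have r2 : 0 < ‖w x - v‖ := norm_pos_iff.2 (sub_ne_zero.2 h3)
    have d0 : 0 < ‖u - v‖ := norm_pos_iff.2 (sub_ne_zero.2 h1)
    have tri : ‖u - v‖ ≤ ‖u - w x‖ + ‖w x - v‖ := norm_sub_le_norm_sub_add_norm_sub _ _ _
    have hUx : ‖u - w x‖⁻¹ + ‖w x - v‖⁻¹ ≤ U x := by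
      have pos : ∀ l, 0 ≤ ‖w x - w l‖⁻¹ := fun l => by positivity
      have mem : ∀ l ∈ t, l ≠ x → l ∈ T.filter fun l => ρ x < ρ l := fun l hl hlx =>
        Finset.mem_filter.2 ⟨hT l hl, hlt l hl hlx⟩
      have single : ∀ l ∈ t, l ≠ x → ‖w x - w l‖⁻¹ ≤ ∑ l ∈ T with ρ x < ρ l, ‖w x - w l‖⁻¹ :=
        fun l hl hlx => Finset.single_le_sum (f := fun l => ‖w x - w l‖⁻¹) (fun l _ => pos l)
          (mem l hl hlx)
      have i1 : 0 ≤ ‖w x - a‖⁻¹ := by positivity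
      have i2 : 0 ≤ ‖w x - b‖⁻¹ := by positivity
      have i3 : 0 ≤ ∑ l ∈ T with ρ x < ρ l, ‖w x - w l‖⁻¹ := Finset.sum_nonneg fun l _ => pos l
      rw [norm_sub_rev u]
      simp only [hU]
      rcases h4 with rfl | ⟨l, hl, hlx, rfl⟩ <;> rcases h5 with rfl | ⟨m, hm, hmx, rfl⟩
      · linarith
      · linarith [single m hm hmx]
      · linarith [single l hl hlx]
      · have hlm : l ≠ m := by rintro rfl; exact h1 rfl
        have := Finset.sum_le_sum_of_subset_of_nonneg (f := fun l => ‖w x - w l‖⁻¹)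
          (s := {l, m}) (t := T.filter fun l => ρ x < ρ l)
          (by intro k hk; rcases Finset.mem_insert.1 hk with rfl | hk
              · exact mem _ hl hlx
              · rw [Finset.mem_singleton.1 hk]; exact mem _ hm hmx) (fun l _ _ => pos l)
        rw [Finset.sum_pair hlm] at this
        linarith
    have key : (‖u - w x‖ + ‖w x - v‖ + s) * (‖u - w x‖⁻¹ * ‖w x - v‖⁻¹) ≤
        (‖u - w x‖⁻¹ + ‖w x - v‖⁻¹) * ((‖u - v‖ + s) * ‖u - v‖⁻¹) := by
      have e : (‖u - w x‖ + ‖w x - v‖ + s) * (‖u - w x‖⁻¹ * ‖w x - v‖⁻¹) =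
          (‖u - w x‖⁻¹ + ‖w x - v‖⁻¹) * (1 + s / (‖u - w x‖ + ‖w x - v‖)) := by
        field_simp; ring
      have e' : (‖u - v‖ + s) * ‖u - v‖⁻¹ = 1 + s / ‖u - v‖ := by field_simp
      rw [e, e']
      gcongr
    calc chainLen w b a t * chainInv w b a t
        = (‖u - w x‖ + ‖w x - v‖ + s) * (‖u - w x‖⁻¹ * ‖w x - v‖⁻¹) * q := by rw [e1, e2]; ring
      _ ≤ (‖u - w x‖⁻¹ + ‖w x - v‖⁻¹) * ((‖u - v‖ + s) * ‖u - v‖⁻¹) * q := by gcongr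
      _ = (‖u - w x‖⁻¹ + ‖w x - v‖⁻¹)
          * (chainLen w b a (t.erase x) * chainInv w b a (t.erase x)) := by rw [e3, e4]; ring
      _ ≤ _ := mul_le_mul hUx IH
          (mul_nonneg (chainLen_nonneg _ _ _ _) (chainInv_nonneg _ _ _ _))
          ((by positivity : 0 ≤ ‖u - w x‖⁻¹ + ‖w x - v‖⁻¹).trans hUx)

/-- The broken line through consecutive labels. -/
lemma chainInv_range' (z : ℕ → ℂ) (b : ℂ) (m n : ℕ) :
    chainInv z b (z m) (List.range' (m + 1) n) =
      (∏ k ∈ Finset.Ico (m + 1) (m + 1 + n), ‖z k - z (k - 1)‖⁻¹) * ‖z (m + n) - b‖⁻¹ := by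
  induction n generalizing m with
  | zero => simp [chainInv]
  | succ n ih =>
    rw [List.range'_succ, chainInv, ih (m + 1), Finset.prod_eq_prod_Ico_succ_bot
      (by omega : m + 1 < m + 1 + (n + 1))]
    rw [show m + 1 + 1 + n = m + 1 + (n + 1) by ring, show m + 1 + n = m + (n + 1) by ring,
      norm_sub_rev (z m)]
    simp only [Nat.add_sub_cancel]
    ring

end

noncomputable section

/-! ### Labels and permutations -/

lemma LabelPerm.act_mem_iff {L : ℕ} (σ : LabelPerm L) (k : ℕ) :
    σ.act k ∈ Finset.Icc 4 L ↔ k ∈ Finset.Icc 4 L :=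
  Equiv.Perm.ofSubtype_apply_mem_iff_mem σ k

lemma LabelPerm.act_of_notMem {L : ℕ} (σ : LabelPerm L) {k : ℕ} (hk : k ∉ Finset.Icc 4 L) :
    σ.act k = k :=
  Equiv.Perm.ofSubtype_apply_of_not_mem σ hk

lemma LabelPerm.act_symm_mem_iff {L : ℕ} (σ : LabelPerm L) (k : ℕ) :
    σ.act.symm k ∈ Finset.Icc 4 L ↔ k ∈ Finset.Icc 4 L := by
  rw [← σ.act_mem_iff, Equiv.apply_symm_apply]

lemma LabelPerm.map_Icc {L : ℕ} (σ : LabelPerm L) :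
    (Finset.Icc 4 L).map σ.act.toEmbedding = Finset.Icc 4 L := by
  ext k
  simp only [Finset.mem_map, Equiv.coe_toEmbedding]
  constructor
  · rintro ⟨j, hj, rfl⟩; exact (σ.act_mem_iff j).2 hj
  · intro hk; exact ⟨σ.act.symm k, (σ.act_symm_mem_iff k).2 hk, σ.act.apply_symm_apply k⟩

@[to_additive]
lemma LabelPerm.prod_act {L : ℕ} {M : Type*} [CommMonoid M] (σ : LabelPerm L) (f : ℕ → M) :
    ∏ k ∈ Finset.Icc 4 L, f (σ.act k) = ∏ k ∈ Finset.Icc 4 L, f k := by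
  conv_rhs => rw [← σ.map_Icc, Finset.prod_map]
  rfl

/-- A product over unordered pairs may be written with respect to any ranking. -/
@[to_additive]
lemma prod_pairs_rank {M : Type*} [CommMonoid M] (S : Finset ℕ) (ρ : ℕ → ℕ) (hρ : Set.InjOn ρ S)
    (g : ℕ → ℕ → M) (hg : ∀ k l, g k l = g l k) :
    ∏ k ∈ S, ∏ l ∈ S with k < l, g k l = ∏ k ∈ S, ∏ l ∈ S with ρ k < ρ l, g k l := by
  have split : ∀ P Q : ℕ → ℕ → Prop, (∀ k ∈ S, ∀ l ∈ S, k ≠ l → (¬ Q k l ↔ Q l k)) →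
      (∀ k l, P k l → k ≠ l) → ∀ [∀ k, DecidablePred (P k)] [∀ k, DecidablePred (Q k)],
      ∏ k ∈ S, ∏ l ∈ S with P k l, g k l =
      (∏ k ∈ S, ∏ l ∈ S, if P k l ∧ Q k l then g k l else 1)
        * ∏ k ∈ S, ∏ l ∈ S, if P k l ∧ Q l k then g k l else 1 := by
    intro P Q hQ hP _ _
    rw [← Finset.prod_mul_distrib]
    refine Finset.prod_congr rfl fun k hk => ?_
    rw [← Finset.prod_mul_distrib, Finset.prod_filter]
    refine Finset.prod_congr rfl fun l hl => ?_
    by_cases h : P k l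
    · have := hQ k hk l hl (hP k l h)
      by_cases h' : Q k l
      · have h'' : ¬ Q l k := fun c => this.2 c h'
        simp [h, h', h'']
      · simp [h, h', this.1 h']
    · simp [h]
  rw [split (fun k l => k < l) (fun k l => ρ k < ρ l), split (fun k l => ρ k < ρ l) (fun k l => k < l)]
  · congr 1
    · simp only [and_comm]
    · rw [Finset.prod_comm]
      refine Finset.prod_congr rfl fun k _ => Finset.prod_congr rfl fun l _ => ?_
      simp only [and_comm, hg k l]
  · intro k _ l _ h; omega
  · intro k l h; rintro rfl; exact lt_irrefl _ h
  · intro k hk l hl h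
    have : ρ k ≠ ρ l := fun e => h (hρ hk hl e)
    omega
  · intro k l h; omega

/-- The rank of a label in the order of integration for the component `a`. -/
def labelRank {L : ℕ} (a : CompIdx L) (l : ℕ) : ℕ :=
  if (a.1 : ℕ) ≤ a.2.act.symm l then a.2.act.symm l - a.1 else L - a.2.act.symm l

lemma labelRank_act {L : ℕ} (a : CompIdx L) (k : ℕ) :
    labelRank a (a.2.act k) = if (a.1 : ℕ) ≤ k then k - a.1 else L - k := by
  simp [labelRank]

lemma labelRank_injOn {L : ℕ} (a : CompIdx L) :
    Set.InjOn (labelRank a) (Finset.Icc 4 L : Finset ℕ) := by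
  intro j hj k hk h
  have hj' := Finset.mem_Icc.1 ((a.2.act_symm_mem_iff j).2 hj)
  have hk' := Finset.mem_Icc.1 ((a.2.act_symm_mem_iff k).2 hk)
  have hi := Finset.mem_Icc.1 a.1.2
  unfold labelRank at h
  apply a.2.act.symm.injective
  split_ifs at h <;> omega

/-! ### The variables -/

lemma mand_comm {L : ℕ} (s : Mandelstam L) (i j : ℕ) : mand s i j = mand s j i := by
  unfold mand
  by_cases h : i ∈ Finset.Icc 1 L ∧ j ∈ Finset.Icc 1 L
  · rw [dif_pos h, dif_pos h.symm, Sym2.eq_swap]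
  · rw [dif_neg h, dif_neg fun h' => h h'.symm]

lemma norm_mand_le {L : ℕ} (s : Mandelstam L) (i j : ℕ) : ‖mand s i j‖ ≤ ‖s‖ := by
  unfold mand
  split_ifs
  · exact norm_le_pi_norm s _
  · simp

open Classical in
/-- The variables `s`, with all `s_{ji}` replaced by `0`. -/
def killLabel {L : ℕ} (j : ℕ) (s : Mandelstam L) : Mandelstam L := fun e =>
  if ∃ i ∈ e, (i : ℕ) = j then 0 else s e

lemma mand_killLabel {L : ℕ} (j : ℕ) (s : Mandelstam L) (a b : ℕ) :
    mand (killLabel j s) a b = if a = j ∨ b = j then 0 else mand s a b := by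
  unfold mand killLabel
  by_cases h : a ∈ Finset.Icc 1 L ∧ b ∈ Finset.Icc 1 L
  · simp only [dif_pos h, Sym2.mem_iff, exists_eq_or_imp, exists_eq_left]
  · rw [dif_neg h, dif_neg h, ite_self]

lemma norm_killLabel_le {L : ℕ} (j : ℕ) (s : Mandelstam L) : ‖killLabel j s‖ ≤ ‖s‖ := by
  refine (pi_norm_le_iff_of_nonneg (norm_nonneg _)).2 fun e => ?_
  unfold killLabel
  split_ifs
  · simp
  · exact norm_le_pi_norm s e

lemma norm_absPow {a : ℂ} (ha : a ≠ 0) (t : ℂ) : ‖absPow a t‖ = ‖a‖ ^ (2 * t.re) := by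
  unfold absPow
  rw [Complex.norm_cpow_eq_rpow_re_of_pos (norm_pos_iff.2 ha)]
  simp

@[simp] lemma absPow_zero_right (a : ℂ) : absPow a 0 = 1 := by simp [absPow]

lemma absPow_mul (a b t : ℂ) : absPow (a * b) t = absPow a t * absPow b t := by
  unfold absPow
  rw [norm_mul, Complex.ofReal_mul, Complex.mul_cpow_ofReal_nonneg (norm_nonneg _) (norm_nonneg _)]

lemma absPow_add {a : ℂ} (ha : a ≠ 0) (t u : ℂ) : absPow a (t + u) = absPow a t * absPow a u := by
  unfold absPow
  rw [mul_add, Complex.cpow_add _ _ (by simpa using ha)]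

lemma absPow_neg (a t : ℂ) : absPow (-a) t = absPow a t := by simp [absPow]

lemma absPow_sub_comm (a b t : ℂ) : absPow (a - b) t = absPow (b - a) t := by
  rw [← absPow_neg, neg_sub]

/-! ### The factors of the integrand -/

/-- The Koba–Nielsen factor. -/
def pairProd (L : ℕ) (s : Mandelstam L) (w : ℕ → ℂ) : ℂ :=
  ∏ k ∈ Finset.Icc 1 L, ∏ m ∈ Finset.Ioc k L, absPow (w k - w m) (mand s k m)

/-- The holomorphic factor. -/
def bracketProd (L : ℕ) (s : Mandelstam L) (a : CompIdx L) (w : ℕ → ℂ) : ℂ :=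
  (∏ k ∈ Finset.Icc (a.1 : ℕ) L, (mand s 1 (a.2.act k) / w (a.2.act k)
      + ∑ j ∈ Finset.Ioc k L,
        mand s (a.2.act k) (a.2.act j) / (w (a.2.act k) - w (a.2.act j))))
    * ∏ m ∈ Finset.Ico 4 (a.1 : ℕ), ∑ n ∈ (Finset.Ico 2 m).erase 3,
        mand s (a.2.act n) (a.2.act m) / (w (a.2.act n) - w (a.2.act m))

/-- The antiholomorphic factor. -/
def antiProd (L : ℕ) (w : ℕ → ℂ) : ℂ :=
  1 / cbar (w L) * ∏ k ∈ Finset.Icc 4 L, 1 / (cbar (w k) - cbar (w (k - 1)))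

/-- The positions after rescaling by `z_3`: the label `2` sits at `p = 1 / z_3`. -/
def scaledPos {L : ℕ} (p : ℂ) (x : Finset.Icc 4 L → ℂ) (k : ℕ) : ℂ :=
  if h : k ∈ Finset.Icc 4 L then x ⟨k, h⟩
  else if k = 2 then p else if k = 3 then 1 else 0

lemma fhatIntegrand_eq (L : ℕ) (s : Mandelstam L) (z₃ : ℂ) (a : CompIdx L)
    (x : Finset.Icc 4 L → ℂ) :
    fhatIntegrand L s z₃ a x = cbar z₃ * (pairProd L s (position z₃ x)
      * bracketProd L s a (position z₃ x) * antiProd L (position z₃ x)) := by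
  unfold fhatIntegrand pairProd bracketProd antiProd
  ring

/-- Generic configurations: `w_1 = 0`, `w_3 = 1`, `w_2 = p`, and the other points are distinct
from each other and from these. -/
structure Generic (L : ℕ) (p : ℂ) (w : ℕ → ℂ) : Prop where
  one : w 1 = 0
  two : w 2 = p
  three : w 3 = 1
  ne_zero : ∀ k ∈ Finset.Icc 4 L, w k ≠ 0
  ne_one : ∀ k ∈ Finset.Icc 4 L, w k ≠ 1
  ne_p : ∀ k ∈ Finset.Icc 4 L, w k ≠ p
  ne : ∀ k ∈ Finset.Icc 4 L, ∀ l ∈ Finset.Icc 4 L, k ≠ l → w k ≠ w l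

lemma ae_ne_apply {ι : Type*} [Fintype ι] {k l : ι} (h : k ≠ l) :
    ∀ᵐ x : ι → ℂ, x k ≠ x l := by
  classical
  let S : Submodule ℝ (ι → ℂ) :=
    LinearMap.ker ((LinearMap.proj k : (ι → ℂ) →ₗ[ℝ] ℂ) - (LinearMap.proj l : (ι → ℂ) →ₗ[ℝ] ℂ))
  have hS : S ≠ ⊤ := by
    intro hS
    have : (Pi.single k 1 : ι → ℂ) ∈ S := hS ▸ Submodule.mem_top
    simp [S, LinearMap.mem_ker, h.symm] at this
  have := Measure.addHaar_submodule volume S hS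
  rw [ae_iff]
  refine measure_mono_null (fun x hx => ?_) this
  simp only [ne_eq, not_not, Set.mem_ofPred_eq] at hx
  simp [S, LinearMap.mem_ker, hx]

lemma ae_generic (L : ℕ) (p : ℂ) : ∀ᵐ x : Finset.Icc 4 L → ℂ, Generic L p (scaledPos p x) := by
  have h : ∀ᵐ x : Finset.Icc 4 L → ℂ, ∀ k l, k ≠ l → x k ≠ x l := by
    rw [ae_all_iff]; intro k; rw [ae_all_iff]; intro l
    by_cases hkl : k = l
    · simp [hkl]
    · filter_upwards [ae_ne_apply hkl] with x hx _ using hx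
  filter_upwards [ae_apply_ne (ι := Finset.Icc 4 L) 0, ae_apply_ne (ι := Finset.Icc 4 L) 1,
    ae_apply_ne (ι := Finset.Icc 4 L) p, h] with x h0 h1 hp hx
  refine ⟨by simp [scaledPos], by simp [scaledPos], by simp [scaledPos], ?_, ?_, ?_, ?_⟩
  · intro k hk; rw [scaledPos, dif_pos hk]; exact h0 _
  · intro k hk; rw [scaledPos, dif_pos hk]; exact h1 _
  · intro k hk; rw [scaledPos, dif_pos hk]; exact hp _
  · intro k hk l hl hkl
    rw [scaledPos, scaledPos, dif_pos hk, dif_pos hl]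
    exact hx _ _ fun e => hkl (congrArg Subtype.val e)

lemma domFun_eq {L : ℕ} (ρ : ℕ → ℕ) (δ η κ : ℝ) (p q : ℂ) (x : Finset.Icc 4 L → ℂ) :
    domFun (fun j : Finset.Icc 4 L => ρ j) δ η κ p x =
    ∏ j ∈ Finset.Icc 4 L, ((∑ l ∈ Finset.Icc 4 L with ρ j < ρ l,
        ‖scaledPos q x j - scaledPos q x l‖⁻¹ + ‖scaledPos q x j‖⁻¹ + ‖scaledPos q x j - p‖⁻¹)
    * (∑ l ∈ Finset.Icc 4 L with ρ j < ρ l,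
        ‖scaledPos q x j - scaledPos q x l‖⁻¹ + ‖scaledPos q x j‖⁻¹ + ‖scaledPos q x j - 1‖⁻¹)
    * ((∏ l ∈ Finset.Icc 4 L with ρ j < ρ l, (min ‖scaledPos q x j - scaledPos q x l‖ 1) ^ δ)
        * (min ‖scaledPos q x j‖ 1) ^ δ)
    * sing₂ η p (scaledPos q x j) * (1 + ‖scaledPos q x j‖) ^ (-κ)) := by
  have ex : ∀ j : Finset.Icc 4 L, scaledPos q x (j : ℕ) = x j := fun j => by
    simp [scaledPos, -Finset.mem_Icc]
  unfold domFun
  simp only [Finset.sum_filter, Finset.prod_filter]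
  rw [← Finset.prod_coe_sort (Finset.Icc 4 L)]
  refine Finset.prod_congr rfl fun j _ => ?_
  rw [← Finset.sum_coe_sort (Finset.Icc 4 L), ← Finset.prod_coe_sort (Finset.Icc 4 L)]
  simp only [ex]

end

noncomputable section

/-- The size of a configuration. -/
def radius (L : ℕ) (w : ℕ → ℂ) : ℝ := 1 + ∑ k ∈ Finset.Icc 4 L, ‖w k‖

lemma one_le_radius (L : ℕ) (w : ℕ → ℂ) : 1 ≤ radius L w :=
  le_add_of_nonneg_right (Finset.sum_nonneg fun _ _ => norm_nonneg _)

lemma radius_pos (L : ℕ) (w : ℕ → ℂ) : 0 < radius L w := zero_lt_one.trans_le (one_le_radius L w)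

lemma one_add_norm_le_radius {L : ℕ} (w : ℕ → ℂ) {k : ℕ} (hk : k ∈ Finset.Icc 4 L) :
    1 + ‖w k‖ ≤ radius L w :=
  add_le_add le_rfl (Finset.single_le_sum (f := fun k => ‖w k‖) (fun _ _ => norm_nonneg _) hk)

lemma norm_sub_le_radius {L : ℕ} (w : ℕ → ℂ) {k l : ℕ} (hk : k ∈ Finset.Icc 4 L)
    (hl : l ∈ Finset.Icc 4 L) (hkl : k ≠ l) : ‖w k - w l‖ ≤ radius L w := by
  have := Finset.sum_le_sum_of_subset_of_nonneg (f := fun l => ‖w l‖)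
    (s := {k, l}) (t := Finset.Icc 4 L)
    (by intro j hj; rcases Finset.mem_insert.1 hj with rfl | hj
        · exact hk
        · rw [Finset.mem_singleton.1 hj]; exact hl) (fun l _ _ => norm_nonneg _)
  rw [Finset.sum_pair hkl] at this
  have := norm_sub_le (w k) (w l)
  unfold radius; linarith

/-! ### Bounds for the factors -/

lemma norm_antiProd_le {L : ℕ} (hL : 4 ≤ L) {p : ℂ} {w : ℕ → ℂ} (hw : Generic L p w) (ρ : ℕ → ℕ)
    (hρ : Set.InjOn ρ (Finset.Icc 4 L : Finset ℕ)) :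
    ‖antiProd L w‖ ≤ L / radius L w * ∏ k ∈ Finset.Icc 4 L,
      (∑ l ∈ Finset.Icc 4 L with ρ k < ρ l, ‖w k - w l‖⁻¹ + ‖w k‖⁻¹ + ‖w k - 1‖⁻¹) := by
  set t := List.range' 4 (L - 3) with ht
  have htm : ∀ k, k ∈ t ↔ k ∈ Finset.Icc 4 L := fun k => by
    rw [ht, List.mem_range'_1, Finset.mem_Icc]; omega
  have htn : t.Nodup := List.nodup_range'
  have e1 : ‖antiProd L w‖ = chainInv w 0 1 t := by
    have := chainInv_range' w 0 3 (L - 3)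
    rw [hw.three, show 3 + 1 + (L - 3) = L + 1 by omega, show 3 + (L - 3) = L by omega,
      sub_zero] at this
    rw [ht, this]
    unfold antiProd cbar
    rw [norm_mul, norm_prod, mul_comm]
    congr 1
    · refine Finset.prod_congr (by ext; simp) fun k _ => ?_
      rw [norm_div, norm_one, ← map_sub, RCLike.norm_conj, one_div]
    · rw [norm_div, norm_one, RCLike.norm_conj, one_div]
  have hd : ((1 : ℂ) :: (t.map w ++ [0])).Nodup := by
    have h1 : (t.map w).Nodup := by
      refine List.Nodup.map_on (fun k hk l hl h => ?_) htn
      by_contra hkl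
      exact hw.ne k ((htm k).1 hk) l ((htm l).1 hl) hkl h
    rw [List.nodup_cons, List.nodup_append]
    refine ⟨?_, h1, by simp, ?_⟩
    · simp only [List.mem_append, List.mem_map, List.mem_singleton, one_ne_zero, or_false]
      rintro ⟨k, hk, h⟩
      exact hw.ne_one k ((htm k).1 hk) h
    · rintro u hu v hv rfl
      simp only [List.mem_map, List.mem_singleton] at hu hv
      obtain ⟨k, hk, h⟩ := hu
      exact hw.ne_zero k ((htm k).1 hk) (h.trans hv)
  have main := chainLen_mul_chainInv_le w 1 0 ρ (Finset.Icc 4 L) hρ _ t rfl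
    (fun k hk => (htm k).1 hk) hd
  simp only [sub_zero] at main
  have e2 : (t.map fun k => ∑ l ∈ Finset.Icc 4 L with ρ k < ρ l, ‖w k - w l‖⁻¹ + ‖w k‖⁻¹
      + ‖w k - 1‖⁻¹).prod = ∏ k ∈ Finset.Icc 4 L, (∑ l ∈ Finset.Icc 4 L with ρ k < ρ l,
      ‖w k - w l‖⁻¹ + ‖w k‖⁻¹ + ‖w k - 1‖⁻¹) := by
    rw [← List.prod_toFinset _ htn]
    congr 1
    ext k; rw [List.mem_toFinset, htm]
  rw [e2] at main
  have hR : radius L w ≤ L * chainLen w 0 1 t := by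
    have h1 : 1 ≤ chainLen w 0 1 t := by
      simpa using norm_sub_le_chainLen w 0 1 t
    have h2 : ∑ k ∈ Finset.Icc 4 L, ‖w k‖ ≤ ∑ k ∈ Finset.Icc 4 L, chainLen w 0 1 t := by
      refine Finset.sum_le_sum fun k hk => ?_
      simpa using norm_apply_sub_le_chainLen w 0 1 t ((htm k).2 hk)
    rw [Finset.sum_const, Nat.card_Icc, nsmul_eq_mul] at h2
    have h3 : ((L + 1 - 4 : ℕ) : ℝ) + 1 ≤ L := by
      rw [← Nat.cast_succ, Nat.cast_le]; omega
    unfold radius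
    nlinarith
  rw [e1, div_mul_eq_mul_div, le_div_iff₀ (radius_pos L w)]
  calc chainInv w 0 1 t * radius L w ≤ chainInv w 0 1 t * (L * chainLen w 0 1 t) :=
        mul_le_mul_of_nonneg_left hR (chainInv_nonneg _ _ _ _)
    _ = L * (chainLen w 0 1 t * chainInv w 0 1 t) := by ring
    _ ≤ _ := by gcongr

/-- The factor by which `|w - p|⁻¹` is small when `p` is far away. -/
lemma inv_norm_sub_le {p x : ℂ} {R : ℝ} (hp : p ≠ 0) (hx : x ≠ 0) (hxp : x ≠ p) (hR : ‖x‖ ≤ R) :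
    ‖x - p‖⁻¹ ≤ Real.sqrt (2 / ‖p‖) * Real.sqrt R * (‖x‖⁻¹ + ‖x - p‖⁻¹) := by
  have h1 : 0 < ‖p‖ := norm_pos_iff.2 hp
  have h2 : 0 < ‖x‖ := norm_pos_iff.2 hx
  have h3 : 0 < ‖x - p‖ := norm_pos_iff.2 (sub_ne_zero.2 hxp)
  have tri : ‖p‖ ≤ ‖x‖ + ‖x - p‖ := by
    calc ‖p‖ = ‖x - (x - p)‖ := by ring_nf
      _ ≤ _ := norm_sub_le _ _
  rw [← Real.sqrt_mul (by positivity)]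
  have mono : Real.sqrt (2 / ‖p‖ * ‖x‖) ≤ Real.sqrt (2 / ‖p‖ * R) :=
    Real.sqrt_le_sqrt (by gcongr)
  refine le_trans ?_ (mul_le_mul_of_nonneg_right mono (by positivity))
  rcases le_total ‖x‖ ‖x - p‖ with h | h
  · have : ‖x - p‖⁻¹ * ‖x‖ ≤ Real.sqrt (2 / ‖p‖ * ‖x‖) := by
      refine Real.le_sqrt_of_sq_le ?_
      have e : (‖x - p‖⁻¹ * ‖x‖) ^ 2 = (‖x‖ / ‖x - p‖) * (1 / ‖x - p‖) * ‖x‖ := by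
        field_simp
      rw [e]
      have i1 : ‖x‖ / ‖x - p‖ ≤ 1 := (div_le_one h3).2 h
      have i2 : 1 / ‖x - p‖ ≤ 2 / ‖p‖ := by
        rw [div_le_div_iff₀ h3 h1]; linarith
      calc _ ≤ 1 * (2 / ‖p‖) * ‖x‖ := by gcongr
        _ = _ := by ring
    calc ‖x - p‖⁻¹ = (‖x - p‖⁻¹ * ‖x‖) * ‖x‖⁻¹ := by field_simp
      _ ≤ Real.sqrt (2 / ‖p‖ * ‖x‖) * ‖x‖⁻¹ := by gcongr
      _ ≤ _ := by gcongr; exact le_add_of_nonneg_right (by positivity)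
  · have : 1 ≤ Real.sqrt (2 / ‖p‖ * ‖x‖) := by
      refine Real.le_sqrt_of_sq_le ?_
      rw [one_pow, div_mul_eq_mul_div, le_div_iff₀ h1]; linarith
    calc ‖x - p‖⁻¹ = 1 * ‖x - p‖⁻¹ := by ring
      _ ≤ Real.sqrt (2 / ‖p‖ * ‖x‖) * ‖x - p‖⁻¹ := by gcongr
      _ ≤ _ := by gcongr; exact le_add_of_nonneg_left (by positivity)

section bracket

variable {L : ℕ} {s : Mandelstam L} {a : CompIdx L} {p : ℂ} {w : ℕ → ℂ}

lemma norm_mand_div_le (hs : ‖s‖ ≤ 1) (i j : ℕ) (u : ℂ) : ‖mand s i j / u‖ ≤ ‖u‖⁻¹ := by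
  rw [norm_div, div_eq_mul_inv]
  exact mul_le_of_le_one_left (by positivity) ((norm_mand_le s i j).trans hs)

lemma norm_bracket_fst_le (hs : ‖s‖ ≤ 1) {k : ℕ} (hk : k ∈ Finset.Icc (a.1 : ℕ) L) :
    ‖mand s 1 (a.2.act k) / w (a.2.act k) + ∑ j ∈ Finset.Ioc k L,
        mand s (a.2.act k) (a.2.act j) / (w (a.2.act k) - w (a.2.act j))‖ ≤
    ∑ l ∈ Finset.Icc 4 L with labelRank a (a.2.act k) < labelRank a l, ‖w (a.2.act k) - w l‖⁻¹
      + ‖w (a.2.act k)‖⁻¹ := by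
  have hi := Finset.mem_Icc.1 a.1.2
  have hk' := Finset.mem_Icc.1 hk
  refine (norm_add_le _ _).trans ?_
  rw [add_comm]
  refine add_le_add ?_ (norm_mand_div_le hs _ _ _)
  calc _ ≤ ∑ j ∈ Finset.Ioc k L, ‖w (a.2.act k) - w (a.2.act j)‖⁻¹ :=
        norm_sum_le_of_le _ fun j _ => norm_mand_div_le hs _ _ _
    _ = ∑ l ∈ (Finset.Ioc k L).map a.2.act.toEmbedding, ‖w (a.2.act k) - w l‖⁻¹ := by
        rw [Finset.sum_map]; rfl
    _ ≤ _ := by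
        refine Finset.sum_le_sum_of_subset_of_nonneg ?_ fun _ _ _ => by positivity
        intro l hl
        obtain ⟨j, hj, rfl⟩ := Finset.mem_map.1 hl
        have hj' := Finset.mem_Ioc.1 hj
        rw [Equiv.coe_toEmbedding, Finset.mem_filter, LabelPerm.act_mem_iff, labelRank_act,
          labelRank_act, if_pos hk'.1, if_pos (by omega), Finset.mem_Icc]
        omega

lemma norm_bracket_snd_le (hs : ‖s‖ ≤ 1) (hw : w 2 = p) {m : ℕ}
    (hm : m ∈ Finset.Ico 4 (a.1 : ℕ)) :
    ‖∑ n ∈ (Finset.Ico 2 m).erase 3,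
        mand s (a.2.act n) (a.2.act m) / (w (a.2.act n) - w (a.2.act m))‖ ≤
    ∑ l ∈ Finset.Icc 4 L with labelRank a (a.2.act m) < labelRank a l, ‖w (a.2.act m) - w l‖⁻¹
      + ‖w (a.2.act m) - p‖⁻¹ := by
  have hi := Finset.mem_Icc.1 a.1.2
  have hm' := Finset.mem_Ico.1 hm
  have h2 : a.2.act 2 = 2 := a.2.act_of_notMem (by simp)
  have e : (Finset.Ico 2 m).erase 3 = insert 2 (Finset.Ico 4 m) := by
    ext n; simp only [Finset.mem_erase, Finset.mem_Ico, Finset.mem_insert]; omega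
  refine (norm_sum_le_of_le _ fun n _ => norm_mand_div_le hs _ _ _).trans ?_
  rw [e, Finset.sum_insert (by simp), h2, hw, add_comm, norm_sub_rev p]
  refine add_le_add ?_ le_rfl
  calc _ = ∑ n ∈ Finset.Ico 4 m, ‖w (a.2.act m) - w (a.2.act n)‖⁻¹ :=
        Finset.sum_congr rfl fun n _ => by rw [norm_sub_rev]
    _ = ∑ l ∈ (Finset.Ico 4 m).map a.2.act.toEmbedding, ‖w (a.2.act m) - w l‖⁻¹ := by
        rw [Finset.sum_map]; rfl
    _ ≤ _ := by
        refine Finset.sum_le_sum_of_subset_of_nonneg ?_ fun _ _ _ => by positivity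
        intro l hl
        obtain ⟨n, hn, rfl⟩ := Finset.mem_map.1 hl
        have hn' := Finset.mem_Ico.1 hn
        rw [Equiv.coe_toEmbedding, Finset.mem_filter, LabelPerm.act_mem_iff, labelRank_act,
          labelRank_act, if_neg (by omega), if_neg (by omega), Finset.mem_Icc]
        omega

lemma prod_Icc_mul_prod_Ico {M : Type*} [CommMonoid M] (a : CompIdx L) (f : ℕ → M) :
    (∏ k ∈ Finset.Icc (a.1 : ℕ) L, f (a.2.act k)) * ∏ m ∈ Finset.Ico 4 (a.1 : ℕ), f (a.2.act m)
      = ∏ k ∈ Finset.Icc 4 L, f k := by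
  have hi := Finset.mem_Icc.1 a.1.2
  rw [← a.2.prod_act f, mul_comm, ← Finset.prod_union]
  · refine Finset.prod_congr ?_ fun _ _ => rfl
    ext k; simp only [Finset.mem_union, Finset.mem_Ico, Finset.mem_Icc]; omega
  · rw [Finset.disjoint_left]; intro k
    simp only [Finset.mem_Ico, Finset.mem_Icc]; omega

lemma norm_bracketProd_le (hs : ‖s‖ ≤ 1) (hw : w 2 = p) :
    ‖bracketProd L s a w‖ ≤ ∏ k ∈ Finset.Icc 4 L,
      (∑ l ∈ Finset.Icc 4 L with labelRank a k < labelRank a l, ‖w k - w l‖⁻¹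
        + ‖w k‖⁻¹ + ‖w k - p‖⁻¹) := by
  unfold bracketProd
  rw [norm_mul, norm_prod, norm_prod, ← prod_Icc_mul_prod_Ico a]
  refine mul_le_mul (Finset.prod_le_prod (fun _ _ => norm_nonneg _) fun k hk => ?_)
    (Finset.prod_le_prod (fun _ _ => norm_nonneg _) fun m hm => ?_)
    (Finset.prod_nonneg fun _ _ => norm_nonneg _)
    (Finset.prod_nonneg fun _ _ => by positivity)
  · exact (norm_bracket_fst_le hs hk).trans (le_add_of_nonneg_right (by positivity))
  · refine (norm_bracket_snd_le hs hw hm).trans ?_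
    rw [add_assoc]
    gcongr
    exact le_add_of_nonneg_left (by positivity)

lemma norm_bracketProd_le_of_ne (hs : ‖s‖ ≤ 1) (hp : p ≠ 0) (hw : Generic L p w)
    (ha : (a.1 : ℕ) ≠ 4) :
    ‖bracketProd L s a w‖ ≤ Real.sqrt (2 / ‖p‖) * Real.sqrt (radius L w) * ∏ k ∈ Finset.Icc 4 L,
      (∑ l ∈ Finset.Icc 4 L with labelRank a k < labelRank a l, ‖w k - w l‖⁻¹
        + ‖w k‖⁻¹ + ‖w k - p‖⁻¹) := by
  have hi := Finset.mem_Icc.1 a.1.2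
  have h4 : 4 < (a.1 : ℕ) := by omega
  have h4L : (4 : ℕ) ∈ Finset.Icc 4 L := Finset.mem_Icc.2 ⟨le_rfl, by omega⟩
  have hx := (a.2.act_mem_iff 4).2 h4L
  have h2 : a.2.act 2 = 2 := a.2.act_of_notMem (by simp)
  unfold bracketProd
  rw [norm_mul, norm_prod, norm_prod, ← prod_Icc_mul_prod_Ico a]
  rw [Finset.prod_eq_prod_Ico_succ_bot h4, Finset.prod_eq_prod_Ico_succ_bot h4]
  set c := Real.sqrt (2 / ‖p‖) * Real.sqrt (radius L w)
  have hc : 0 ≤ c := by positivity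
  have first : ‖∑ n ∈ (Finset.Ico 2 4).erase 3,
      mand s (a.2.act n) (a.2.act 4) / (w (a.2.act n) - w (a.2.act 4))‖ ≤
      c * (∑ l ∈ Finset.Icc 4 L with labelRank a (a.2.act 4) < labelRank a l,
        ‖w (a.2.act 4) - w l‖⁻¹ + ‖w (a.2.act 4)‖⁻¹ + ‖w (a.2.act 4) - p‖⁻¹) := by
    rw [show (Finset.Ico 2 4).erase 3 = {2} by decide, Finset.sum_singleton, h2, hw.two]
    refine (norm_mand_div_le hs _ _ _).trans ?_
    rw [norm_sub_rev]
    refine (inv_norm_sub_le hp (hw.ne_zero _ hx) (hw.ne_p _ hx)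
      ((le_add_of_nonneg_left zero_le_one).trans (one_add_norm_le_radius w hx))).trans ?_
    gcongr
    exact le_add_of_nonneg_left (by positivity)
  rw [mul_comm c, mul_assoc]
  refine mul_le_mul (Finset.prod_le_prod (fun _ _ => norm_nonneg _) fun k hk => ?_) ?_
    (by positivity) (Finset.prod_nonneg fun _ _ => by positivity)
  · exact (norm_bracket_fst_le hs hk).trans (le_add_of_nonneg_right (by positivity))
  · rw [mul_right_comm, mul_comm _ c]
    refine mul_le_mul first (Finset.prod_le_prod (fun _ _ => norm_nonneg _) fun m hm => ?_)
      (Finset.prod_nonneg fun _ _ => norm_nonneg _) (by positivity)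
    refine (norm_bracket_snd_le hs hw.two
      (Finset.mem_Ico.2 ⟨by have := Finset.mem_Ico.1 hm; omega, (Finset.mem_Ico.1 hm).2⟩)).trans ?_
    rw [add_assoc]
    gcongr
    exact le_add_of_nonneg_left (by positivity)

end bracket

end

noncomputable section

lemma rpow_le_sing {r R σ ε : ℝ} (hr : 0 < r) (hrR : r ≤ R) (hR : 1 ≤ R) (hσ : |σ| ≤ ε) :
    r ^ (2 * σ) ≤ R ^ (2 * ε) * sing (2 * ε) r := by
  have h := abs_le.1 hσ
  have hε : 0 ≤ ε := (abs_nonneg _).trans hσ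
  rcases le_total r 1 with h1 | h1
  · have : r ^ (2 * σ) ≤ sing (2 * ε) r := by
      unfold sing; rw [min_eq_left h1]
      exact Real.rpow_le_rpow_of_exponent_ge hr h1 (by linarith)
    exact this.trans (le_mul_of_one_le_left (sing_nonneg hr.le)
      (Real.one_le_rpow hR (by linarith)))
  · have : sing (2 * ε) r = 1 := by unfold sing; rw [min_eq_right h1, Real.one_rpow]
    rw [this, mul_one]
    calc r ^ (2 * σ) ≤ r ^ (2 * ε) := Real.rpow_le_rpow_of_exponent_le h1 (by linarith)
      _ ≤ _ := Real.rpow_le_rpow hr.le hrR (by linarith)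

lemma rpow_le_min {r R σ ε δ : ℝ} (hr : 0 < r) (hrR : r ≤ R) (hR : 1 ≤ R) (hσ : |σ| ≤ ε)
    (hδ : δ ≤ 2 * σ) : r ^ (2 * σ) ≤ R ^ (2 * ε) * (min r 1) ^ δ := by
  have h := abs_le.1 hσ
  have hε : 0 ≤ ε := (abs_nonneg _).trans hσ
  rcases le_total r 1 with h1 | h1
  · rw [min_eq_left h1]
    exact (Real.rpow_le_rpow_of_exponent_ge hr h1 hδ).trans
      (le_mul_of_one_le_left (by positivity) (Real.one_le_rpow hR (by linarith)))
  · rw [min_eq_right h1, Real.one_rpow, mul_one]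
    calc r ^ (2 * σ) ≤ r ^ (2 * ε) := Real.rpow_le_rpow_of_exponent_le h1 (by linarith)
      _ ≤ _ := Real.rpow_le_rpow hr.le hrR (by linarith)

/-- Pairs of labels, sorted by how many of them belong to `{1, 2, 3}`. -/
@[to_additive]
lemma prod_pairs_split {M : Type*} [CommMonoid M] {L : ℕ} (hL : 4 ≤ L) (F : ℕ → ℕ → M) :
    ∏ k ∈ Finset.Icc 1 L, ∏ m ∈ Finset.Ioc k L, F k m =
      F 1 2 * F 1 3 * F 2 3 * (∏ m ∈ Finset.Icc 4 L, F 1 m) * (∏ m ∈ Finset.Icc 4 L, F 2 m)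
        * (∏ m ∈ Finset.Icc 4 L, F 3 m)
        * ∏ k ∈ Finset.Icc 4 L, ∏ l ∈ Finset.Icc 4 L with k < l, F k l := by
  have e0 : Finset.Icc 1 L = insert 1 (insert 2 (insert 3 (Finset.Icc 4 L))) := by
    ext k; simp only [Finset.mem_insert, Finset.mem_Icc]; omega
  have e1 : Finset.Ioc 1 L = insert 2 (insert 3 (Finset.Icc 4 L)) := by
    ext k; simp only [Finset.mem_insert, Finset.mem_Icc, Finset.mem_Ioc]; omega
  have e2 : Finset.Ioc 2 L = insert 3 (Finset.Icc 4 L) := by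
    ext k; simp only [Finset.mem_insert, Finset.mem_Icc, Finset.mem_Ioc]; omega
  have e3 : Finset.Ioc 3 L = Finset.Icc 4 L := by
    ext k; simp only [Finset.mem_Icc, Finset.mem_Ioc]; omega
  have e4 : ∏ k ∈ Finset.Icc 4 L, ∏ m ∈ Finset.Ioc k L, F k m =
      ∏ k ∈ Finset.Icc 4 L, ∏ l ∈ Finset.Icc 4 L with k < l, F k l := by
    refine Finset.prod_congr rfl fun k hk => Finset.prod_congr ?_ fun _ _ => rfl
    have := Finset.mem_Icc.1 hk
    ext l; simp only [Finset.mem_filter, Finset.mem_Icc, Finset.mem_Ioc]; omega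
  rw [e0, Finset.prod_insert (by simp), Finset.prod_insert (by simp), Finset.prod_insert (by simp),
    e1, e2, e3, Finset.prod_insert (by simp), Finset.prod_insert (by simp),
    Finset.prod_insert (by simp), e4]
  simp only [mul_assoc, mul_left_comm, mul_comm]

section bounds

variable {L : ℕ} {s : Mandelstam L} {a : CompIdx L} {p : ℂ} {w : ℕ → ℂ} {ε δ : ℝ}

/-- A quantitative form of the conditions on the variables in `convRegion`. -/
structure Admissible (L : ℕ) (ε δ : ℝ) (s : Mandelstam L) : Prop where
  four_le : 4 ≤ L
  pos : 0 < ε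
  small : 24 * (L : ℝ) ^ 2 * ε ≤ 1
  norm_le : ‖s‖ ≤ ε
  le_re : ∀ i ∈ insert 1 (Finset.Icc 4 L), ∀ j ∈ insert 1 (Finset.Icc 4 L), i ≠ j →
    δ ≤ 2 * (mand s i j).re

lemma Admissible.le_one (h : Admissible L ε δ s) : ε ≤ 1 := by
  have h1 := h.small
  have h2 : (4 : ℝ) ≤ L := by exact_mod_cast h.four_le
  nlinarith [h.pos, mul_le_mul h2 h2 (by norm_num) (by linarith)]

lemma Admissible.abs_re_le (h : Admissible L ε δ s) (i j : ℕ) : |(mand s i j).re| ≤ ε :=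
  (Complex.abs_re_le_norm _).trans ((norm_mand_le s i j).trans h.norm_le)

lemma norm_pairProd_le (h : Admissible L ε δ s) (hw : Generic L p w) (ρ : ℕ → ℕ)
    (hρ : Set.InjOn ρ (Finset.Icc 4 L : Finset ℕ)) :
    ‖pairProd L (killLabel 2 s) w‖ ≤ ((radius L w) ^ (2 * ε)) ^ (2 * L ^ 2) *
      ∏ k ∈ Finset.Icc 4 L, ((∏ l ∈ Finset.Icc 4 L with ρ k < ρ l, (min ‖w k - w l‖ 1) ^ δ)
        * (min ‖w k‖ 1) ^ δ * sing (2 * ε) ‖w k - 1‖) := by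
  set R := radius L w
  set B := R ^ (2 * ε) with hB
  have hR : 1 ≤ R := one_le_radius L w
  have hB1 : 1 ≤ B := Real.one_le_rpow hR (by linarith [h.pos])
  unfold pairProd
  simp only [norm_prod]
  rw [prod_pairs_split h.four_le, prod_pairs_rank (Finset.Icc 4 L) ρ hρ _
    (fun k l => by rw [absPow_sub_comm, mand_comm])]
  have e12 : ‖absPow (w 1 - w 2) (mand (killLabel 2 s) 1 2)‖ = 1 := by simp [mand_killLabel]
  have e23 : ‖absPow (w 2 - w 3) (mand (killLabel 2 s) 2 3)‖ = 1 := by simp [mand_killLabel]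
  have e13 : ‖absPow (w 1 - w 3) (mand (killLabel 2 s) 1 3)‖ = 1 := by
    rw [hw.one, hw.three, norm_absPow (by simp)]; simp
  have e2 : ∏ m ∈ Finset.Icc 4 L, ‖absPow (w 2 - w m) (mand (killLabel 2 s) 2 m)‖ = 1 :=
    Finset.prod_eq_one fun m _ => by simp [mand_killLabel]
  rw [e12, e13, e23, e2, one_mul, one_mul, one_mul, mul_one, ← Finset.prod_mul_distrib,
    ← Finset.prod_mul_distrib]
  have hcard : (B ^ (2 * L)) ^ (Finset.Icc 4 L).card ≤ B ^ (2 * L ^ 2) := by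
    rw [← pow_mul]
    refine pow_le_pow_right₀ hB1 ?_
    rw [Nat.card_Icc, mul_assoc, sq]
    gcongr; omega
  have hkill : ∀ {i j : ℕ}, i ≠ 2 → j ≠ 2 → mand (killLabel 2 s) i j = mand s i j := by
    intro i j hi hj; rw [mand_killLabel, if_neg (by tauto)]
  calc _ ≤ ∏ k ∈ Finset.Icc 4 L, (B ^ (2 * L) *
        ((∏ l ∈ Finset.Icc 4 L with ρ k < ρ l, (min ‖w k - w l‖ 1) ^ δ)
        * (min ‖w k‖ 1) ^ δ * sing (2 * ε) ‖w k - 1‖)) := by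
        refine Finset.prod_le_prod (fun _ _ => by positivity) fun k hk => ?_
        have hk4 := Finset.mem_Icc.1 hk
        have k0 : 0 < ‖w k‖ := norm_pos_iff.2 (hw.ne_zero k hk)
        have k1 : 0 < ‖w k - 1‖ := norm_pos_iff.2 (sub_ne_zero.2 (hw.ne_one k hk))
        have f1 : ‖absPow (w 1 - w k) (mand (killLabel 2 s) 1 k)‖ ≤ B * (min ‖w k‖ 1) ^ δ := by
          rw [absPow_sub_comm, hw.one, sub_zero, hkill (by omega) (by omega),
            norm_absPow (hw.ne_zero k hk)]
          exact rpow_le_min k0 (by linarith [one_add_norm_le_radius w hk]) hR (h.abs_re_le _ _)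
            (h.le_re _ (by simp) _ (Finset.mem_insert_of_mem hk) (by omega))
        have f3 : ‖absPow (w 3 - w k) (mand (killLabel 2 s) 3 k)‖ ≤
            B * sing (2 * ε) ‖w k - 1‖ := by
          rw [absPow_sub_comm, hw.three, hkill (by omega) (by omega),
            norm_absPow (sub_ne_zero.2 (hw.ne_one k hk))]
          refine rpow_le_sing k1 ?_ hR (h.abs_re_le _ _)
          have := norm_sub_le (w k) 1
          rw [norm_one] at this
          linarith [one_add_norm_le_radius w hk]
        have fl : ∏ l ∈ Finset.Icc 4 L with ρ k < ρ l,
            ‖absPow (w k - w l) (mand (killLabel 2 s) k l)‖ ≤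
            B ^ L * ∏ l ∈ Finset.Icc 4 L with ρ k < ρ l, (min ‖w k - w l‖ 1) ^ δ := by
          calc _ ≤ ∏ l ∈ Finset.Icc 4 L with ρ k < ρ l, (B * (min ‖w k - w l‖ 1) ^ δ) := by
                refine Finset.prod_le_prod (fun _ _ => norm_nonneg _) fun l hl => ?_
                obtain ⟨hl, hlt⟩ := Finset.mem_filter.1 hl
                have hl4 := Finset.mem_Icc.1 hl
                have hkl : k ≠ l := by rintro rfl; exact lt_irrefl _ hlt
                have kl := sub_ne_zero.2 (hw.ne k hk l hl hkl)
                rw [hkill (by omega) (by omega), norm_absPow kl]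
                exact rpow_le_min (norm_pos_iff.2 kl) (norm_sub_le_radius w hk hl hkl) hR
                  (h.abs_re_le _ _) (h.le_re _ (Finset.mem_insert_of_mem hk) _
                  (Finset.mem_insert_of_mem hl) hkl)
            _ ≤ _ := by
                rw [Finset.prod_mul_distrib, Finset.prod_const]
                refine mul_le_mul_of_nonneg_right ?_ (Finset.prod_nonneg fun _ _ => by positivity)
                refine pow_le_pow_right₀ hB1 ((Finset.card_filter_le _ _).trans ?_)
                rw [Nat.card_Icc]; omega
        have hs0 : 0 ≤ sing (2 * ε) ‖w k - 1‖ := sing_nonneg k1.le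
        have hpow : B * B * B ^ L ≤ B ^ (2 * L) := by
          rw [← pow_two, ← pow_add]
          exact pow_le_pow_right₀ hB1 (by have := h.four_le; omega)
        have hq : 0 ≤ (∏ l ∈ Finset.Icc 4 L with ρ k < ρ l, (min ‖w k - w l‖ 1) ^ δ)
          * (min ‖w k‖ 1) ^ δ * sing (2 * ε) ‖w k - 1‖ := by positivity
        calc _ ≤ (B * (min ‖w k‖ 1) ^ δ) * (B * sing (2 * ε) ‖w k - 1‖) *
              (B ^ L * ∏ l ∈ Finset.Icc 4 L with ρ k < ρ l, (min ‖w k - w l‖ 1) ^ δ) := by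
              gcongr
          _ = B * B * B ^ L * ((∏ l ∈ Finset.Icc 4 L with ρ k < ρ l, (min ‖w k - w l‖ 1) ^ δ)
              * (min ‖w k‖ 1) ^ δ * sing (2 * ε) ‖w k - 1‖) := by ring
          _ ≤ _ := by gcongr
    _ ≤ _ := by
        rw [Finset.prod_mul_distrib, Finset.prod_const]
        refine mul_le_mul_of_nonneg_right hcard (Finset.prod_nonneg fun k _ => ?_)
        have := sing_nonneg (η := 2 * ε) (norm_nonneg (w k - 1))
        positivity

lemma prod_bound_aux (T : Finset ℕ) {A U m t u v D : ℕ → ℝ} {X Y B₁ B₂ c K : ℝ}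
    (hA : ∀ k, 0 ≤ A k) (hU : ∀ k, 0 ≤ U k) (hm : ∀ k, 0 ≤ m k) (ht : ∀ k, 0 ≤ t k)
    (hu : ∀ k, 0 ≤ u k) (hY : 0 ≤ Y) (hB₂ : 0 ≤ B₂) (hX : 0 ≤ X)
    (hK : 0 ≤ K * ∏ k ∈ T, D k)
    (h1 : X ≤ B₁ * ∏ k ∈ T, (m k * t k)) (h2 : Y ≤ c * ∏ k ∈ T, U k)
    (hv : ∀ k ∈ T, t k * u k ≤ v k) (hB : B₁ * B₂ * c ≤ K * ∏ k ∈ T, D k) :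
    X * Y * (∏ k ∈ T, A k) * (B₂ * ∏ k ∈ T, u k) ≤ K * ∏ k ∈ T, (A k * U k * m k * v k * D k) := by
  have P : ∀ f : ℕ → ℝ, (∀ k, 0 ≤ f k) → 0 ≤ ∏ k ∈ T, f k := fun f hf =>
    Finset.prod_nonneg fun k _ => hf k
  have a0 := P A hA
  have u0 := P u hu
  calc _ ≤ (B₁ * ∏ k ∈ T, (m k * t k)) * (c * ∏ k ∈ T, U k) * (∏ k ∈ T, A k)
        * (B₂ * ∏ k ∈ T, u k) := by
        have := hX.trans h1
        gcongr
    _ = (B₁ * B₂ * c) * ∏ k ∈ T, (A k * U k * m k * (t k * u k)) := by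
        simp only [Finset.prod_mul_distrib]; ring
    _ ≤ (K * ∏ k ∈ T, D k) * ∏ k ∈ T, (A k * U k * m k * v k) := by
        refine mul_le_mul hB (Finset.prod_le_prod (fun k _ => ?_) fun k hk => ?_) (P _ fun k => ?_) hK
        · have := hA k; have := hU k; have := hm k; have := ht k; have := hu k
          positivity
        · exact mul_le_mul_of_nonneg_left (hv k hk) (mul_nonneg (mul_nonneg (hA k) (hU k)) (hm k))
        · have := hA k; have := hU k; have := hm k; have := ht k; have := hu k
          positivity
    _ = _ := by simp only [Finset.prod_mul_distrib]; ring

/-- The combined bound for everything but the bracket and the variables `s_{2m}`. -/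
lemma base_bound (h : Admissible L ε δ s) {x : Finset.Icc 4 L → ℂ} {q : ℂ}
    (hw : Generic L p (scaledPos q x)) (ρ : ℕ → ℕ)
    (hρ : Set.InjOn ρ (Finset.Icc 4 L : Finset ℕ)) :
    ‖pairProd L (killLabel 2 s) (scaledPos q x)‖ * ‖antiProd L (scaledPos q x)‖
      * (∏ k ∈ Finset.Icc 4 L, (∑ l ∈ Finset.Icc 4 L with ρ k < ρ l,
          ‖scaledPos q x k - scaledPos q x l‖⁻¹ + ‖scaledPos q x k‖⁻¹ + ‖scaledPos q x k - p‖⁻¹))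
      * (((radius L (scaledPos q x)) ^ (2 * ε)) ^ L
        * ∏ k ∈ Finset.Icc 4 L, sing (2 * ε) ‖scaledPos q x k - p‖)
    ≤ L * (Real.sqrt (radius L (scaledPos q x)))⁻¹
      * domFun (fun j : Finset.Icc 4 L => ρ j) δ (4 * ε) (1 / (4 * L)) p x := by
  rw [domFun_eq ρ _ _ _ _ q]
  set w := scaledPos q x
  set R := radius L w
  set B := R ^ (2 * ε) with hB
  have hR : 1 ≤ R := one_le_radius L w
  have hR0 : 0 < R := by linarith
  have hB1 : 1 ≤ B := Real.one_le_rpow hR (by linarith [h.pos])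
  have hL : (4 : ℝ) ≤ L := by exact_mod_cast h.four_le
  have h1 := norm_pairProd_le h hw ρ hρ
  have h2 := norm_antiProd_le h.four_le hw ρ hρ
  have hpow : B ^ (2 * L ^ 2) * B ^ L / R ≤ (Real.sqrt R)⁻¹ * R ^ (-(1 / 4) : ℝ) := by
    rw [← pow_add, hB, ← Real.rpow_natCast, ← Real.rpow_mul hR0.le, div_eq_mul_inv,
      ← Real.rpow_neg_one R, ← Real.rpow_add hR0, Real.sqrt_eq_rpow, ← Real.rpow_neg hR0.le,
      ← Real.rpow_add hR0]
    refine Real.rpow_le_rpow_of_exponent_le hR ?_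
    push_cast
    have := h.small
    nlinarith [h.pos, mul_nonneg h.pos.le (by nlinarith : 0 ≤ (L : ℝ) ^ 2 - L)]
  have hdec : R ^ (-(1 / 4) : ℝ) ≤ ∏ k ∈ Finset.Icc 4 L, (1 + ‖w k‖) ^ (-(1 / (4 * L)) : ℝ) := by
    have step : ∀ k ∈ Finset.Icc 4 L, R ^ (-(1 / (4 * L)) : ℝ) ≤
        (1 + ‖w k‖) ^ (-(1 / (4 * L)) : ℝ) := fun k hk =>
      Real.rpow_le_rpow_of_nonpos (by positivity) (one_add_norm_le_radius w hk)
        (by rw [neg_nonpos]; positivity)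
    refine le_trans ?_ (Finset.prod_le_prod (fun _ _ => by positivity) step)
    rw [Finset.prod_const, ← Real.rpow_natCast, ← Real.rpow_mul hR0.le]
    refine Real.rpow_le_rpow_of_exponent_le hR ?_
    rw [Nat.card_Icc]
    have : ((L + 1 - 4 : ℕ) : ℝ) ≤ L := by exact_mod_cast (by omega : L + 1 - 4 ≤ L)
    have h4 : (1 / (4 * (L : ℝ))) * L = 1 / 4 := by field_simp
    nlinarith [mul_le_mul_of_nonneg_left this (by positivity : (0 : ℝ) ≤ 1 / (4 * (L : ℝ)))]
  have hss : ∀ k ∈ Finset.Icc 4 L, sing (2 * ε) ‖w k - 1‖ * sing (2 * ε) ‖w k - p‖ ≤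
      sing₂ (4 * ε) p (w k) := by
    intro k hk
    have r1 : 0 < ‖w k - 1‖ := norm_pos_iff.2 (sub_ne_zero.2 (hw.ne_one k hk))
    have r2 : 0 < ‖w k - p‖ := norm_pos_iff.2 (sub_ne_zero.2 (hw.ne_p k hk))
    unfold sing₂
    rw [show 4 * ε = 2 * ε + 2 * ε by ring, ← sing_mul r1, ← sing_mul r2]
    nlinarith [sq_nonneg (sing (2 * ε) ‖w k - 1‖ - sing (2 * ε) ‖w k - p‖),
      mul_nonneg (sing_nonneg (η := 2 * ε) r1.le) (sing_nonneg (η := 2 * ε) r2.le)]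
  have hD0 : 0 ≤ ∏ k ∈ Finset.Icc 4 L, (1 + ‖w k‖) ^ (-(1 / (4 * L)) : ℝ) :=
    Finset.prod_nonneg fun _ _ => by positivity
  refine prod_bound_aux (Finset.Icc 4 L) (m := fun k => _) (t := fun k => sing (2 * ε) ‖w k - 1‖)
    (K := L * (Real.sqrt R)⁻¹) (c := L / R) (B₂ := B ^ L)
    (fun k => ?_) (fun k => ?_) (fun k => ?_) (fun k => sing_nonneg (norm_nonneg _))
    (fun k => sing_nonneg (norm_nonneg _)) (norm_nonneg _) (by positivity) (norm_nonneg _)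
    (by positivity) h1 h2 hss ?_
  · positivity
  · positivity
  · positivity
  · calc _ = L * (B ^ (2 * L ^ 2) * B ^ L / R) := by ring
      _ ≤ L * ((Real.sqrt R)⁻¹ * R ^ (-(1 / 4) : ℝ)) := by gcongr
      _ ≤ L * ((Real.sqrt R)⁻¹ * ∏ k ∈ Finset.Icc 4 L, (1 + ‖w k‖) ^ (-(1 / (4 * L)) : ℝ)) := by
          gcongr
      _ = _ := by ring

end bounds

end

noncomputable section

/-- The loss caused by the variables `s_{2m}` when `z_3` is small or large. -/
def scaleConst (ε : ℝ) (z : ℂ) : ℝ := ((1 + ‖z‖) * (1 + ‖z‖⁻¹)) ^ (2 * ε)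

lemma one_le_scaleConst {ε : ℝ} (hε : 0 ≤ ε) (z : ℂ) : 1 ≤ scaleConst ε z := by
  refine Real.one_le_rpow ?_ (by linarith)
  have : 0 ≤ ‖z‖⁻¹ := by positivity
  nlinarith [norm_nonneg z]

lemma norm_absPow_one_sub_le {ε R : ℝ} {z u t : ℂ} (hz : z ≠ 0) (hu : u ≠ z⁻¹) (hR : 1 ≤ R)
    (huR : ‖u‖ ≤ R) (ht : |t.re| ≤ ε) :
    ‖absPow (1 - z * u) t‖ ≤ scaleConst ε z * (R ^ (2 * ε) * sing (2 * ε) ‖u - z⁻¹‖) := by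
  have hε : 0 ≤ ε := (abs_nonneg _).trans ht
  have h := abs_le.1 ht
  have z0 : 0 < ‖z‖ := norm_pos_iff.2 hz
  have r0 : 0 < ‖u - z⁻¹‖ := norm_pos_iff.2 (sub_ne_zero.2 hu)
  have e : 1 - z * u = -(z * (u - z⁻¹)) := by field_simp; ring
  have hne : 1 - z * u ≠ 0 := by
    rw [e]; exact neg_ne_zero.2 (mul_ne_zero hz (sub_ne_zero.2 hu))
  rw [norm_absPow hne]
  have s1 := one_le_sing (η := 2 * ε) r0 (by linarith)
  have hR1 : 1 ≤ R ^ (2 * ε) := Real.one_le_rpow hR (by linarith)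
  have hi : 0 ≤ ‖z‖⁻¹ := by positivity
  rcases le_total 0 t.re with hσ | hσ
  · have b1 : ‖1 - z * u‖ ≤ (1 + ‖z‖) * (1 + ‖z‖⁻¹) * R := by
      have := norm_sub_le 1 (z * u)
      rw [norm_one, norm_mul] at this
      have h2 : ‖z‖ * ‖u‖ ≤ ‖z‖ * R := by gcongr
      nlinarith [mul_nonneg hi (zero_le_one.trans hR), mul_nonneg (mul_nonneg z0.le hi)
        (zero_le_one.trans hR)]
    have b2 : 1 ≤ (1 + ‖z‖) * (1 + ‖z‖⁻¹) * R := by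
      nlinarith [mul_nonneg hi z0.le]
    calc ‖1 - z * u‖ ^ (2 * t.re) ≤ ((1 + ‖z‖) * (1 + ‖z‖⁻¹) * R) ^ (2 * t.re) :=
          Real.rpow_le_rpow (norm_nonneg _) b1 (by linarith)
      _ ≤ ((1 + ‖z‖) * (1 + ‖z‖⁻¹) * R) ^ (2 * ε) :=
          Real.rpow_le_rpow_of_exponent_le b2 (by linarith)
      _ = scaleConst ε z * R ^ (2 * ε) := Real.mul_rpow (by positivity) (by linarith)
      _ ≤ _ := by
          have := (zero_le_one.trans (one_le_scaleConst hε z))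
          gcongr
          exact le_mul_of_one_le_right (by linarith) s1
  · rw [e, norm_neg, norm_mul, Real.mul_rpow z0.le r0.le]
    have b1 : ‖z‖ ^ (2 * t.re) ≤ scaleConst ε z := by
      have : ‖z‖ ^ (2 * t.re) = (‖z‖⁻¹) ^ (-(2 * t.re)) := by
        rw [Real.inv_rpow z0.le, Real.rpow_neg z0.le, inv_inv]
      rw [this]
      calc (‖z‖⁻¹) ^ (-(2 * t.re)) ≤ ((1 + ‖z‖) * (1 + ‖z‖⁻¹)) ^ (-(2 * t.re)) :=
            Real.rpow_le_rpow hi (by nlinarith) (by linarith)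
        _ ≤ _ := Real.rpow_le_rpow_of_exponent_le (by nlinarith) (by linarith)
    have b2 : ‖u - z⁻¹‖ ^ (2 * t.re) ≤ sing (2 * ε) ‖u - z⁻¹‖ := by
      calc ‖u - z⁻¹‖ ^ (2 * t.re) ≤ (min ‖u - z⁻¹‖ 1) ^ (2 * t.re) :=
            Real.rpow_le_rpow_of_nonpos (by positivity) (min_le_left _ _) (by linarith)
        _ ≤ _ := Real.rpow_le_rpow_of_exponent_ge (by positivity) (min_le_right _ _) (by linarith)
    refine mul_le_mul b1 (b2.trans ?_) (by positivity)
      (zero_le_one.trans (one_le_scaleConst hε z))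
    exact le_mul_of_one_le_left (by linarith) hR1

lemma norm_absPow_one_sub_sub_one_le {ζ t : ℂ} (ht : ‖t‖ ≤ 1 / 2) :
    ‖absPow (1 - ζ) t - 1‖ ≤ 4 * Real.sqrt ‖ζ‖ * (1 + ‖absPow (1 - ζ) t‖) := by
  have hy := norm_nonneg (absPow (1 - ζ) t)
  rcases le_total ‖ζ‖ (1 / 2) with h | h
  · set τ := ‖1 - ζ‖ with hτ
    have h1 : |τ - 1| ≤ ‖ζ‖ := by
      have := abs_norm_sub_norm_le (1 - ζ) 1
      rw [norm_one, sub_sub_cancel_left, norm_neg] at this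
      exact this
    have h2 := abs_le.1 h1
    have hτ2 : 1 / 2 ≤ τ := by linarith
    have hτ0 : 0 < τ := by linarith
    have hlog : |Real.log τ| ≤ 2 * ‖ζ‖ := by
      rw [abs_le]
      constructor
      · have := Real.one_sub_inv_le_log_of_pos hτ0
        have h3 : τ⁻¹ - 1 ≤ 2 * ‖ζ‖ := by
          rw [inv_eq_one_div, div_sub_one hτ0.ne', div_le_iff₀ hτ0]
          nlinarith [norm_nonneg ζ]
        linarith
      · have := Real.log_le_sub_one_of_pos hτ0
        linarith [norm_nonneg ζ]
    have e : absPow (1 - ζ) t = Complex.exp ((Real.log τ : ℂ) * (2 * t)) := by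
      unfold absPow
      rw [Complex.cpow_def_of_ne_zero (by exact_mod_cast hτ0.ne'), ← Complex.ofReal_log hτ0.le]
    have hX : ‖(Real.log τ : ℂ) * (2 * t)‖ ≤ 2 * ‖ζ‖ := by
      rw [norm_mul, norm_mul, Complex.norm_real, Real.norm_eq_abs, RCLike.norm_ofNat]
      nlinarith [abs_nonneg (Real.log τ), norm_nonneg ζ, norm_nonneg t]
    have hexp : ‖absPow (1 - ζ) t - 1‖ ≤ 4 * ‖ζ‖ := by
      rw [e]
      refine (Complex.norm_exp_sub_one_le (hX.trans (by linarith))).trans (by linarith)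
    have hsq : ‖ζ‖ ≤ Real.sqrt ‖ζ‖ := by
      refine Real.le_sqrt_of_sq_le ?_
      nlinarith [norm_nonneg ζ]
    nlinarith [Real.sqrt_nonneg ‖ζ‖, mul_nonneg (Real.sqrt_nonneg ‖ζ‖) hy]
  · have hsq : 1 / 2 ≤ Real.sqrt ‖ζ‖ := Real.le_sqrt_of_sq_le (by linarith)
    have := norm_sub_le (absPow (1 - ζ) t) 1
    rw [norm_one] at this
    nlinarith

lemma norm_prod_sub_one_le {ι : Type*} (S : Finset ι) (y : ι → ℂ) (B : ι → ℝ) (θ : ℝ)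
    (h1 : ∀ i ∈ S, ‖y i‖ ≤ B i) (h2 : ∀ i ∈ S, 1 ≤ B i)
    (h3 : ∀ i ∈ S, ‖y i - 1‖ ≤ θ * B i) :
    ‖∏ i ∈ S, y i - 1‖ ≤ S.card * θ * ∏ i ∈ S, B i := by
  classical
  induction S using Finset.induction_on with
  | empty => simp
  | insert i S hi ih =>
    have ih' := ih (fun j hj => h1 j (Finset.mem_insert_of_mem hj))
      (fun j hj => h2 j (Finset.mem_insert_of_mem hj))
      (fun j hj => h3 j (Finset.mem_insert_of_mem hj))
    have hi1 := h1 i (Finset.mem_insert_self i S)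
    have hi2 := h2 i (Finset.mem_insert_self i S)
    have hi3 := h3 i (Finset.mem_insert_self i S)
    have hP : 1 ≤ ∏ i ∈ S, B i := by
      calc (1 : ℝ) = ∏ i ∈ S, (1 : ℝ) := by simp
        _ ≤ _ := Finset.prod_le_prod (fun _ _ => zero_le_one)
          fun j hj => h2 j (Finset.mem_insert_of_mem hj)
    rw [Finset.prod_insert hi, Finset.prod_insert hi, Finset.card_insert_of_notMem hi]
    have e : y i * ∏ j ∈ S, y j - 1 = y i * (∏ j ∈ S, y j - 1) + (y i - 1) := by ring
    rw [e]
    refine (norm_add_le _ _).trans ?_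
    rw [norm_mul]
    have a1 : ‖y i‖ * ‖∏ j ∈ S, y j - 1‖ ≤ B i * (S.card * θ * ∏ i ∈ S, B i) := by gcongr
    have a2 : θ * B i ≤ θ * B i * ∏ i ∈ S, B i :=
      le_mul_of_one_le_right ((norm_nonneg _).trans hi3) hP
    push_cast
    linarith

/-! ### The rescaled integrand -/

/-- The factors with `s_{2m}` in the rescaled integrand. -/
def twoProd (L : ℕ) (s : Mandelstam L) (z : ℂ) (w : ℕ → ℂ) : ℂ :=
  ∏ m ∈ Finset.Icc 3 L, absPow (1 - z * w m) (mand s 2 m)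

/-- The part of the rescaled integrand that survives in the limit `z_3 → 0`. -/
def coreIntegrand (L : ℕ) (s : Mandelstam L) (a : CompIdx L) (w : ℕ → ℂ) : ℂ :=
  pairProd L (killLabel 2 s) w * bracketProd L s a w * antiProd L w

section bounds

variable {L : ℕ} {s : Mandelstam L} {a : CompIdx L} {z : ℂ} {ε δ : ℝ} {x : Finset.Icc 4 L → ℂ}

lemma prod_twoFactor_le (h : Admissible L ε δ s) (w : ℕ → ℂ) (hw3 : w 3 = 1) :
    ∏ m ∈ Finset.Icc 3 L, (scaleConst ε z * ((radius L w) ^ (2 * ε) * sing (2 * ε) ‖w m - z⁻¹‖)) ≤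
      scaleConst ε z ^ L * sing (2 * ε) ‖z⁻¹ - 1‖ * (((radius L w) ^ (2 * ε)) ^ L
        * ∏ k ∈ Finset.Icc 4 L, sing (2 * ε) ‖w k - z⁻¹‖) := by
  have hL := h.four_le
  have c1 := one_le_scaleConst h.pos.le z
  have B1 : 1 ≤ (radius L w) ^ (2 * ε) :=
    Real.one_le_rpow (one_le_radius L w) (by linarith [h.pos])
  have e : Finset.Icc 3 L = insert 3 (Finset.Icc 4 L) := by
    ext k; simp only [Finset.mem_insert, Finset.mem_Icc]; omega
  have hs := sing_nonneg (η := 2 * ε) (norm_nonneg (z⁻¹ - 1))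
  have hP : 0 ≤ ∏ k ∈ Finset.Icc 4 L, sing (2 * ε) ‖w k - z⁻¹‖ :=
    Finset.prod_nonneg fun k _ => sing_nonneg (norm_nonneg _)
  rw [Finset.prod_mul_distrib, Finset.prod_mul_distrib, Finset.prod_const, Finset.prod_const]
  have e3 : ∏ m ∈ Finset.Icc 3 L, sing (2 * ε) ‖w m - z⁻¹‖ = sing (2 * ε) ‖z⁻¹ - 1‖
      * ∏ k ∈ Finset.Icc 4 L, sing (2 * ε) ‖w k - z⁻¹‖ := by
    rw [e, Finset.prod_insert (by simp), hw3, norm_sub_rev]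
  rw [e3, Nat.card_Icc]
  have p1 : scaleConst ε z ^ (L + 1 - 3) ≤ scaleConst ε z ^ L := pow_le_pow_right₀ c1 (by omega)
  have p2 : ((radius L w) ^ (2 * ε)) ^ (L + 1 - 3) ≤ ((radius L w) ^ (2 * ε)) ^ L :=
    pow_le_pow_right₀ B1 (by omega)
  calc _ ≤ scaleConst ε z ^ L * (((radius L w) ^ (2 * ε)) ^ L * (sing (2 * ε) ‖z⁻¹ - 1‖
      * ∏ k ∈ Finset.Icc 4 L, sing (2 * ε) ‖w k - z⁻¹‖)) := by gcongr
    _ = _ := by ring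

lemma twoFactor_bounds (hz1 : z ≠ 1) {w : ℕ → ℂ}
    (hw : Generic L z⁻¹ w) {m : ℕ} (hm : m ∈ Finset.Icc 3 L) :
    w m ≠ z⁻¹ ∧ ‖w m‖ ≤ radius L w := by
  have hR := one_le_radius L w
  rcases eq_or_ne m 3 with rfl | h3
  · rw [hw.three, norm_one]
    exact ⟨fun e => hz1 (by rw [← inv_inv z, ← e, inv_one]), hR⟩
  · have hm4 : m ∈ Finset.Icc 4 L := by
      have := Finset.mem_Icc.1 hm; exact Finset.mem_Icc.2 ⟨by omega, this.2⟩
    exact ⟨hw.ne_p m hm4, by linarith [one_add_norm_le_radius w hm4]⟩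

lemma norm_twoProd_le (h : Admissible L ε δ s) (hz : z ≠ 0) (hz1 : z ≠ 1) {w : ℕ → ℂ}
    (hw : Generic L z⁻¹ w) :
    ‖twoProd L s z w‖ ≤ scaleConst ε z ^ L * sing (2 * ε) ‖z⁻¹ - 1‖ *
      (((radius L w) ^ (2 * ε)) ^ L * ∏ k ∈ Finset.Icc 4 L, sing (2 * ε) ‖w k - z⁻¹‖) := by
  refine le_trans ?_ (prod_twoFactor_le h w hw.three)
  unfold twoProd
  rw [norm_prod]
  refine Finset.prod_le_prod (fun _ _ => norm_nonneg _) fun m hm => ?_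
  obtain ⟨h1, h2⟩ := twoFactor_bounds hz1 hw hm
  exact norm_absPow_one_sub_le hz h1 (one_le_radius L w) h2 (h.abs_re_le _ _)

lemma norm_twoProd_sub_one_le (h : Admissible L ε δ s) (hz : z ≠ 0) (hz1 : z ≠ 1) {w : ℕ → ℂ}
    (hw : Generic L z⁻¹ w) :
    ‖twoProd L s z w - 1‖ ≤ L * (8 * (Real.sqrt ‖z‖ * Real.sqrt (radius L w))) *
      (scaleConst ε z ^ L * sing (2 * ε) ‖z⁻¹ - 1‖ *
      (((radius L w) ^ (2 * ε)) ^ L * ∏ k ∈ Finset.Icc 4 L, sing (2 * ε) ‖w k - z⁻¹‖)) := by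
  have hL : (16 : ℝ) ≤ (L : ℝ) ^ 2 := by
    have : (4 : ℝ) ≤ L := by exact_mod_cast h.four_le
    nlinarith
  have hε : ε ≤ 1 / 2 := by nlinarith [h.small, h.pos]
  have hR := one_le_radius L w
  have B1 : 1 ≤ (radius L w) ^ (2 * ε) := Real.one_le_rpow hR (by linarith [h.pos])
  have c1 := one_le_scaleConst h.pos.le z
  have b1 : ∀ m ∈ Finset.Icc 3 L, 1 ≤ scaleConst ε z * ((radius L w) ^ (2 * ε)
      * sing (2 * ε) ‖w m - z⁻¹‖) := by
    intro m hm
    have := one_le_sing (η := 2 * ε) (norm_pos_iff.2 (sub_ne_zero.2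
      (twoFactor_bounds hz1 hw hm).1)) (by linarith [h.pos])
    exact one_le_mul_of_one_le_of_one_le c1 (one_le_mul_of_one_le_of_one_le B1 this)
  have b2 : ∀ m ∈ Finset.Icc 3 L, ‖absPow (1 - z * w m) (mand s 2 m)‖ ≤
      scaleConst ε z * ((radius L w) ^ (2 * ε) * sing (2 * ε) ‖w m - z⁻¹‖) := by
    intro m hm
    obtain ⟨h1, h2⟩ := twoFactor_bounds hz1 hw hm
    exact norm_absPow_one_sub_le hz h1 hR h2 (h.abs_re_le _ _)
  have := norm_prod_sub_one_le (Finset.Icc 3 L) (fun m => absPow (1 - z * w m) (mand s 2 m))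
    (fun m => scaleConst ε z * ((radius L w) ^ (2 * ε) * sing (2 * ε) ‖w m - z⁻¹‖))
    (8 * (Real.sqrt ‖z‖ * Real.sqrt (radius L w))) b2 b1 (by
      intro m hm
      obtain ⟨h1, h2⟩ := twoFactor_bounds hz1 hw hm
      refine (norm_absPow_one_sub_sub_one_le
        (((norm_mand_le s 2 m).trans h.norm_le).trans hε)).trans ?_
      rw [norm_mul, Real.sqrt_mul (norm_nonneg _)]
      have i1 : Real.sqrt ‖w m‖ ≤ Real.sqrt (radius L w) := Real.sqrt_le_sqrt h2
      have i2 := b1 m hm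
      have i3 := b2 m hm
      calc _ ≤ 4 * (Real.sqrt ‖z‖ * Real.sqrt (radius L w)) *
            (2 * (scaleConst ε z * ((radius L w) ^ (2 * ε) * sing (2 * ε) ‖w m - z⁻¹‖))) := by
            gcongr
            linarith
        _ = _ := by ring)
  refine this.trans ?_
  refine mul_le_mul ?_ (prod_twoFactor_le h w hw.three)
    (Finset.prod_nonneg fun m hm => zero_le_one.trans (b1 m hm)) (by positivity)
  gcongr
  rw [Nat.card_Icc]; exact_mod_cast (by omega : L + 1 - 3 ≤ L)

/-- The function that dominates all integrands of the component `a`. -/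
def compDom (L : ℕ) (ε δ : ℝ) (a : CompIdx L) (p : ℂ) (x : Finset.Icc 4 L → ℂ) : ℝ :=
  domFun (fun j : Finset.Icc 4 L => labelRank a j) δ (4 * ε) (1 / (4 * L)) p x

lemma bracket_sum_nonneg (a : CompIdx L) (p : ℂ) (w : ℕ → ℂ) :
    0 ≤ ∏ k ∈ Finset.Icc 4 L, (∑ l ∈ Finset.Icc 4 L with labelRank a k < labelRank a l,
      ‖w k - w l‖⁻¹ + ‖w k‖⁻¹ + ‖w k - p‖⁻¹) :=
  Finset.prod_nonneg fun _ _ => by positivity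

lemma mul_bound_aux {P b N t A Q θ₁ θ₂ M : ℝ} (hP : 0 ≤ P) (hN : 0 ≤ N) (ht0 : 0 ≤ t)
    (hA : 0 ≤ A) (hθ₁ : 0 ≤ θ₁) (hθ₂ : 0 ≤ θ₂)
    (hb : b ≤ θ₁ * A) (ht : t ≤ θ₂ * Q) (h : P * N * A * Q ≤ M) :
    P * b * N * t ≤ θ₁ * θ₂ * M := by
  calc P * b * N * t ≤ P * (θ₁ * A) * N * (θ₂ * Q) := by gcongr
    _ = θ₁ * θ₂ * (P * N * A * Q) := by ring
    _ ≤ _ := by gcongr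

lemma compDom_nonneg (p : ℂ) : 0 ≤ compDom L ε δ a p x := domFun_nonneg _ _ _ _ _ _

lemma scaleFactor_nonneg (h : Admissible L ε δ s) :
    0 ≤ scaleConst ε z ^ L * sing (2 * ε) ‖z⁻¹ - 1‖ :=
  mul_nonneg (pow_nonneg (zero_le_one.trans (one_le_scaleConst h.pos.le z)) _)
    (sing_nonneg (norm_nonneg _))

lemma inv_sqrt_radius_le_one (w : ℕ → ℂ) : (Real.sqrt (radius L w))⁻¹ ≤ 1 :=
  inv_le_one_of_one_le₀ (Real.one_le_sqrt.2 (one_le_radius L w))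

lemma norm_core_mul_twoProd_le (h : Admissible L ε δ s) (hz : z ≠ 0) (hz1 : z ≠ 1)
    (hw : Generic L z⁻¹ (scaledPos z⁻¹ x)) :
    ‖coreIntegrand L s a (scaledPos z⁻¹ x) * twoProd L s z (scaledPos z⁻¹ x)‖ ≤
      scaleConst ε z ^ L * sing (2 * ε) ‖z⁻¹ - 1‖ * (L * compDom L ε δ a z⁻¹ x) := by
  have b := base_bound h hw (labelRank a) (labelRank_injOn a)
  have b1 := norm_bracketProd_le (a := a) (h.norm_le.trans h.le_one) hw.two
  rw [← one_mul (∏ k ∈ _, _)] at b1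
  unfold coreIntegrand
  rw [norm_mul, norm_mul, norm_mul]
  refine (mul_bound_aux (norm_nonneg _) (norm_nonneg _) (norm_nonneg _)
    (bracket_sum_nonneg a z⁻¹ _) zero_le_one (scaleFactor_nonneg h)
    b1 (norm_twoProd_le h hz hz1 hw) b).trans ?_
  rw [one_mul]
  refine mul_le_mul_of_nonneg_left ?_ (scaleFactor_nonneg h)
  exact mul_le_mul_of_nonneg_right (mul_le_of_le_one_right (by positivity)
    (inv_sqrt_radius_le_one _)) (compDom_nonneg _)

lemma norm_core_mul_twoProd_le_of_ne (h : Admissible L ε δ s) (hz : z ≠ 0) (hz1 : z ≠ 1)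
    (hw : Generic L z⁻¹ (scaledPos z⁻¹ x)) (ha : (a.1 : ℕ) ≠ 4) :
    ‖coreIntegrand L s a (scaledPos z⁻¹ x) * twoProd L s z (scaledPos z⁻¹ x)‖ ≤
      Real.sqrt (2 * ‖z‖) * (scaleConst ε z ^ L * sing (2 * ε) ‖z⁻¹ - 1‖)
        * (L * compDom L ε δ a z⁻¹ x) := by
  have b := base_bound h hw (labelRank a) (labelRank_injOn a)
  have b1 := norm_bracketProd_le_of_ne (a := a) (h.norm_le.trans h.le_one) (inv_ne_zero hz) hw ha
  unfold coreIntegrand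
  rw [norm_mul, norm_mul, norm_mul]
  refine (mul_bound_aux (norm_nonneg _) (norm_nonneg _) (norm_nonneg _)
    (bracket_sum_nonneg a z⁻¹ _) (by positivity) (scaleFactor_nonneg h)
    b1 (norm_twoProd_le h hz hz1 hw) b).trans (le_of_eq ?_)
  have hR := mul_inv_cancel₀ (Real.sqrt_pos.2 (radius_pos L (scaledPos z⁻¹ x))).ne'
  rw [norm_inv, div_inv_eq_mul]
  unfold compDom
  linear_combination (Real.sqrt (2 * ‖z‖) * (scaleConst ε z ^ L * sing (2 * ε) ‖z⁻¹ - 1‖)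
    * (L * domFun (fun j : Finset.Icc 4 L => labelRank a j) δ (4 * ε) (1 / (4 * L)) z⁻¹ x)) * hR

lemma norm_core_mul_twoProd_sub_le (h : Admissible L ε δ s) (hz : z ≠ 0) (hz1 : z ≠ 1)
    (hw : Generic L z⁻¹ (scaledPos z⁻¹ x)) :
    ‖coreIntegrand L s a (scaledPos z⁻¹ x) * twoProd L s z (scaledPos z⁻¹ x)
        - coreIntegrand L s a (scaledPos z⁻¹ x)‖ ≤
      L * 8 * Real.sqrt ‖z‖ * (scaleConst ε z ^ L * sing (2 * ε) ‖z⁻¹ - 1‖)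
        * (L * compDom L ε δ a z⁻¹ x) := by
  have b := base_bound h hw (labelRank a) (labelRank_injOn a)
  have b1 := norm_bracketProd_le (a := a) (h.norm_le.trans h.le_one) hw.two
  have b2 := norm_twoProd_sub_one_le h hz hz1 hw
  rw [← one_mul (∏ k ∈ _, _)] at b1
  rw [← mul_assoc] at b2
  rw [← mul_sub_one]
  unfold coreIntegrand
  rw [norm_mul, norm_mul, norm_mul]
  have K0 := scaleFactor_nonneg (z := z) h
  refine (mul_bound_aux (norm_nonneg _) (norm_nonneg _) (norm_nonneg _)
    (bracket_sum_nonneg a z⁻¹ _) zero_le_one (by positivity)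
    b1 b2 b).trans (le_of_eq ?_)
  have hR := mul_inv_cancel₀ (Real.sqrt_pos.2 (radius_pos L (scaledPos z⁻¹ x))).ne'
  unfold compDom
  linear_combination (L * 8 * Real.sqrt ‖z‖ * (scaleConst ε z ^ L * sing (2 * ε) ‖z⁻¹ - 1‖)
    * (L * domFun (fun j : Finset.Icc 4 L => labelRank a j) δ (4 * ε) (1 / (4 * L)) z⁻¹ x)) * hR

lemma norm_coreIntegrand_le (h : Admissible L ε δ s) {p : ℂ} (hw : Generic L p (scaledPos p x)) :
    ‖coreIntegrand L s a (scaledPos p x)‖ ≤ L * compDom L ε δ a p x := by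
  have b := base_bound h hw (labelRank a) (labelRank_injOn a)
  have b1 := norm_bracketProd_le (a := a) (h.norm_le.trans h.le_one) hw.two
  rw [← one_mul (∏ k ∈ _, _)] at b1
  have B1 : 1 ≤ (radius L (scaledPos p x)) ^ (2 * ε) :=
    Real.one_le_rpow (one_le_radius L _) (by linarith [h.pos])
  have Q1 : (1 : ℝ) ≤ 1 * (((radius L (scaledPos p x)) ^ (2 * ε)) ^ L
        * ∏ k ∈ Finset.Icc 4 L, sing (2 * ε) ‖scaledPos p x k - p‖) := by
    rw [one_mul]
    refine one_le_mul_of_one_le_of_one_le (one_le_pow₀ B1) ?_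
    calc (1 : ℝ) = ∏ k ∈ Finset.Icc 4 L, (1 : ℝ) := by simp
      _ ≤ _ := Finset.prod_le_prod (fun _ _ => zero_le_one) fun k hk =>
        one_le_sing (norm_pos_iff.2 (sub_ne_zero.2 (hw.ne_p k hk))) (by linarith [h.pos])
  unfold coreIntegrand
  rw [norm_mul, norm_mul, ← mul_one (_ * _ * _)]
  refine (mul_bound_aux (norm_nonneg _) (norm_nonneg _) zero_le_one
    (bracket_sum_nonneg a p _) zero_le_one zero_le_one b1 Q1 b).trans ?_
  rw [one_mul, one_mul]
  exact mul_le_mul_of_nonneg_right (mul_le_of_le_one_right (by positivity)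
    (inv_sqrt_radius_le_one _)) (compDom_nonneg _)

end bounds

end

noncomputable section

/-! ### Rescaling of the integrals -/

lemma measurePreserving_unit_smul {ι : Type*} [Fintype ι] {u : ℂ} (hu : ‖u‖ = 1) :
    MeasurePreserving (fun x : ι → ℂ => u • x) volume volume := by
  have h : MeasurePreserving (fun y : ℂ => u * y) volume volume :=
    (rotation ⟨u, mem_sphere_zero_iff_norm.2 hu⟩).measurePreserving
  exact volume_preserving_pi (fun _ : ι => h)

lemma finrank_pi_complex (ι : Type*) [Fintype ι] :
    Module.finrank ℝ (ι → ℂ) = 2 * Fintype.card ι := by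
  rw [Module.finrank_pi_fintype]
  simp [Complex.finrank_real_complex, mul_comm]

lemma exists_smul_eq_polar {z : ℂ} (hz : z ≠ 0) :
    ∃ u : ℂ, ‖u‖ = 1 ∧ z = ‖z‖ * u := by
  have : (‖z‖ : ℂ) ≠ 0 := by simpa using hz
  refine ⟨z / ‖z‖, ?_, by field_simp⟩
  rw [norm_div, Complex.norm_real, norm_norm, div_self (by simpa using hz)]

lemma integral_comp_complex_smul {ι : Type*} [Fintype ι] (f : (ι → ℂ) → ℂ) {z : ℂ} (hz : z ≠ 0) :
    ∫ x, f (z • x) = (((‖z‖ ^ 2) ^ Fintype.card ι : ℝ) : ℂ)⁻¹ * ∫ x, f x := by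
  obtain ⟨u, hu, e⟩ := exists_smul_eq_polar hz
  have hu0 : u ≠ 0 := fun h => by simp [h] at hu
  have e1 : ∀ x : ι → ℂ, z • x = u • ((‖z‖ : ℝ) • x) := fun x => by
    conv_lhs => rw [e]
    ext i
    simp only [Pi.smul_apply, smul_eq_mul, Complex.real_smul]; ring
  simp only [e1]
  rw [Measure.integral_comp_smul volume (fun x => f (u • x)),
    (measurePreserving_unit_smul hu).integral_comp (measurableEmbedding_const_smul₀ hu0) f,
    finrank_pi_complex, Complex.real_smul, abs_of_nonneg (by positivity), pow_mul]
  push_cast; rfl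

lemma integrable_comp_complex_smul {ι : Type*} [Fintype ι] {f : (ι → ℂ) → ℂ} {z : ℂ} (hz : z ≠ 0)
    (h : Integrable fun x => f (z • x)) : Integrable f := by
  obtain ⟨u, hu, e⟩ := exists_smul_eq_polar hz
  have hu0 : u ≠ 0 := fun h => by simp [h] at hu
  have e1 : ∀ x : ι → ℂ, z • x = u • ((‖z‖ : ℝ) • x) := fun x => by
    conv_lhs => rw [e]
    ext i
    simp only [Pi.smul_apply, smul_eq_mul, Complex.real_smul]; ring
  simp only [e1] at h
  have h2 := (integrable_comp_smul_iff volume (fun x => f (u • x))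
    (norm_ne_zero_iff.2 hz)).1 h
  exact ((measurePreserving_unit_smul hu).integrable_comp_emb
    (measurableEmbedding_const_smul₀ hu0)).1 h2

/-- The sum of the variables `s_{ij}` over all pairs of labels different from `2`. -/
def smax (L : ℕ) (s : Mandelstam L) : ℂ :=
  ∑ k ∈ Finset.Icc 1 L, ∑ m ∈ Finset.Ioc k L, mand (killLabel 2 s) k m

lemma position_smul {L : ℕ} {z : ℂ} (hz : z ≠ 0) (x : Finset.Icc 4 L → ℂ) (k : ℕ) :
    position z (z • x) k = z * scaledPos z⁻¹ x k := by
  unfold position scaledPos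
  split_ifs <;> simp [hz]

lemma bracketProd_mul {L : ℕ} (s : Mandelstam L) (a : CompIdx L) (z : ℂ) (w : ℕ → ℂ) :
    bracketProd L s a (fun k => z * w k) = z⁻¹ ^ (L - 3) * bracketProd L s a w := by
  unfold bracketProd
  have e1 : ∀ c u v : ℂ, c / (z * u - z * v) = z⁻¹ * (c / (u - v)) := fun c u v => by
    rw [← mul_sub, div_eq_mul_inv, mul_inv]; ring
  have e2 : ∀ c u : ℂ, c / (z * u) = z⁻¹ * (c / u) := fun c u => by
    rw [div_eq_mul_inv, mul_inv]; ring
  simp only [e1, e2, ← Finset.mul_sum, ← mul_add, Finset.prod_mul_distrib, Finset.prod_const]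
  have hi := Finset.mem_Icc.1 a.1.2
  have hc : (Finset.Icc (a.1 : ℕ) L).card + (Finset.Ico 4 (a.1 : ℕ)).card = L - 3 := by
    rw [Nat.card_Icc, Nat.card_Ico]; omega
  rw [← hc, pow_add]; ring

lemma antiProd_mul {L : ℕ} (z : ℂ) (w : ℕ → ℂ) :
    antiProd L (fun k => z * w k) = (cbar z)⁻¹ * (cbar z)⁻¹ ^ (L - 3) * antiProd L w := by
  unfold antiProd
  have e1 : ∀ u v : ℂ, 1 / (cbar (z * u) - cbar (z * v)) = (cbar z)⁻¹ * (1 / (cbar u - cbar v)) :=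
    fun u v => by
      simp only [cbar, map_mul]
      rw [← mul_sub, one_div, mul_inv, one_div]
  have e2 : 1 / cbar (z * w L) = (cbar z)⁻¹ * (1 / cbar (w L)) := by
    simp only [cbar, map_mul]; rw [one_div, mul_inv, one_div]
  simp only [e1, e2, Finset.prod_mul_distrib, Finset.prod_const, Nat.card_Icc]
  rw [show L + 1 - 4 = L - 3 by omega]; ring

lemma pairProd_mul {L : ℕ} (hL : 4 ≤ L) (s : Mandelstam L) {z : ℂ} (hz : z ≠ 0) {w : ℕ → ℂ}
    (h1 : w 1 = 0) (h2 : w 2 = z⁻¹) :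
    pairProd L s (fun k => z * w k) =
      absPow z (smax L s) * (pairProd L (killLabel 2 s) w * twoProd L s z w) := by
  have hsum : absPow z (smax L s) = ∏ k ∈ Finset.Icc 1 L, ∏ m ∈ Finset.Ioc k L,
      absPow z (mand (killLabel 2 s) k m) := by
    have h : ∀ (S : Finset ℕ) (f : ℕ → ℂ), absPow z (∑ k ∈ S, f k) = ∏ k ∈ S, absPow z (f k) := by
      intro S f
      classical
      induction S using Finset.induction_on with
      | empty => simp
      | insert i S hi ih => rw [Finset.sum_insert hi, Finset.prod_insert hi, absPow_add hz, ih]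
    unfold smax
    simp only [h]
  rw [hsum]
  unfold pairProd
  rw [prod_pairs_split hL, prod_pairs_split hL, prod_pairs_split hL]
  have key : ∀ k l, k ≠ 2 → l ≠ 2 → absPow (z * w k - z * w l) (mand s k l) =
      absPow z (mand (killLabel 2 s) k l) * absPow (w k - w l) (mand (killLabel 2 s) k l) := by
    intro k l hk hl
    rw [← mul_sub, absPow_mul, mand_killLabel, if_neg (by tauto)]
  have key2 : ∀ l, absPow (z * w 2 - z * w l) (mand s 2 l) = absPow (1 - z * w l) (mand s 2 l) := by
    intro l; rw [h2, mul_inv_cancel₀ hz]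
  have key3 : ∀ v l, absPow v (mand (killLabel 2 s) 2 l) = 1 := fun v l => by simp [mand_killLabel]
  have k12 : absPow (z * w 1 - z * w 2) (mand s 1 2) = 1 := by
    rw [h1, h2, mul_inv_cancel₀ hz, mul_zero, zero_sub, absPow_neg]; simp [absPow]
  have k12' : ∀ v, absPow v (mand (killLabel 2 s) 1 2) = 1 := fun v => by simp [mand_killLabel]
  have e3 : Finset.Icc 3 L = insert 3 (Finset.Icc 4 L) := by
    ext k; simp only [Finset.mem_insert, Finset.mem_Icc]; omega
  have ge : ∀ k ∈ Finset.Icc 4 L, k ≠ 2 := fun k hk => by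
    have := Finset.mem_Icc.1 hk; omega
  have p1 : ∀ j, j ≠ 2 → ∏ m ∈ Finset.Icc 4 L, absPow (z * w j - z * w m) (mand s j m) =
      (∏ m ∈ Finset.Icc 4 L, absPow z (mand (killLabel 2 s) j m))
        * ∏ m ∈ Finset.Icc 4 L, absPow (w j - w m) (mand (killLabel 2 s) j m) := by
    intro j hj
    rw [← Finset.prod_mul_distrib]
    exact Finset.prod_congr rfl fun m hm => key j m hj (ge m hm)
  have p2 : ∏ k ∈ Finset.Icc 4 L, ∏ l ∈ Finset.Icc 4 L with k < l,
      absPow (z * w k - z * w l) (mand s k l) =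
      (∏ k ∈ Finset.Icc 4 L, ∏ l ∈ Finset.Icc 4 L with k < l, absPow z (mand (killLabel 2 s) k l))
        * ∏ k ∈ Finset.Icc 4 L, ∏ l ∈ Finset.Icc 4 L with k < l,
          absPow (w k - w l) (mand (killLabel 2 s) k l) := by
    rw [← Finset.prod_mul_distrib]
    refine Finset.prod_congr rfl fun k hk => ?_
    rw [← Finset.prod_mul_distrib]
    exact Finset.prod_congr rfl fun m hm => key k m (ge k hk) (ge m (Finset.mem_filter.1 hm).1)
  rw [p1 1 (by norm_num), p1 3 (by norm_num), p2, key 1 3 (by norm_num) (by norm_num)]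
  unfold twoProd
  rw [e3, Finset.prod_insert (by simp)]
  simp only [key2, key3, k12, k12', Finset.prod_const_one]
  ring

lemma fhatIntegrand_smul {L : ℕ} (hL : 4 ≤ L) (s : Mandelstam L) {z : ℂ} (hz : z ≠ 0)
    (a : CompIdx L) (x : Finset.Icc 4 L → ℂ) :
    fhatIntegrand L s z a (z • x) =
      (((‖z‖ ^ 2) ^ (L - 3) : ℝ) : ℂ)⁻¹ * (absPow z (smax L s) *
        (coreIntegrand L s a (scaledPos z⁻¹ x) * twoProd L s z (scaledPos z⁻¹ x))) := by
  have hc : cbar z ≠ 0 := by simpa [cbar] using hz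
  have e : position z (z • x) = fun k => z * scaledPos z⁻¹ x k := funext (position_smul hz x)
  rw [fhatIntegrand_eq, e, pairProd_mul hL s hz (by simp [scaledPos]) (by simp [scaledPos]),
    bracketProd_mul, antiProd_mul]
  have hn : (((‖z‖ ^ 2) ^ (L - 3) : ℝ) : ℂ)⁻¹ = z⁻¹ ^ (L - 3) * (cbar z)⁻¹ ^ (L - 3) := by
    rw [← mul_pow, ← mul_inv, inv_pow, cbar, Complex.mul_conj, Complex.normSq_eq_norm_sq]
    push_cast; rfl
  rw [hn]
  unfold coreIntegrand
  calc _ = (cbar z * (cbar z)⁻¹) * (z⁻¹ ^ (L - 3) * (cbar z)⁻¹ ^ (L - 3) *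
      (absPow z (smax L s) * (pairProd L (killLabel 2 s) (scaledPos z⁻¹ x) *
        bracketProd L s a (scaledPos z⁻¹ x) * antiProd L (scaledPos z⁻¹ x) *
          twoProd L s z (scaledPos z⁻¹ x)))) := by ring
    _ = _ := by rw [mul_inv_cancel₀ hc, one_mul]

lemma card_Icc_four (L : ℕ) : Fintype.card (Finset.Icc 4 L) = L - 3 := by
  rw [Fintype.card_coe, Nat.card_Icc]; omega

lemma fhat_eq {L : ℕ} (hL : 4 ≤ L) (s : Mandelstam L) {z : ℂ} (hz : z ≠ 0) (a : CompIdx L) :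
    fhat L s z a = absPow z (smax L s) * ((-1 / (Real.pi : ℂ)) ^ (L - 3) *
      ∫ x : Finset.Icc 4 L → ℂ,
        coreIntegrand L s a (scaledPos z⁻¹ x) * twoProd L s z (scaledPos z⁻¹ x)) := by
  have h := integral_comp_complex_smul (fhatIntegrand L s z a) hz
  simp only [fhatIntegrand_smul hL s hz] at h
  rw [card_Icc_four, integral_const_mul, integral_const_mul] at h
  have hn : (((‖z‖ ^ 2) ^ (L - 3) : ℝ) : ℂ)⁻¹ ≠ 0 := by
    simp [hz]
  unfold fhat
  rw [← mul_left_cancel₀ hn h]; ring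

/-! ### Measurability -/

lemma measurable_scaledPos {L : ℕ} (p : ℂ) (k : ℕ) :
    Measurable fun x : Finset.Icc 4 L → ℂ => scaledPos p x k := by
  unfold scaledPos
  split_ifs <;> fun_prop

lemma measurable_absPow (t : ℂ) : Measurable fun a : ℂ => absPow a t := by
  unfold absPow
  fun_prop

lemma measurable_cbar : Measurable cbar := Complex.continuous_conj.measurable

lemma measurable_pairProd {L : ℕ} {X : Type*} [MeasurableSpace X] (s : Mandelstam L)
    {w : X → ℕ → ℂ} (hw : ∀ k, Measurable fun x => w x k) :
    Measurable fun x => pairProd L s (w x) := by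
  unfold pairProd
  exact Finset.measurable_fun_prod _ fun k _ => Finset.measurable_fun_prod _ fun m _ =>
    (measurable_absPow _).comp ((hw k).sub (hw m))

lemma measurable_twoProd {L : ℕ} {X : Type*} [MeasurableSpace X] (s : Mandelstam L) (z : ℂ)
    {w : X → ℕ → ℂ} (hw : ∀ k, Measurable fun x => w x k) :
    Measurable fun x => twoProd L s z (w x) := by
  unfold twoProd
  exact Finset.measurable_fun_prod _ fun m _ =>
    (measurable_absPow _).comp (measurable_const.sub ((hw m).const_mul z))

lemma measurable_bracketProd {L : ℕ} {X : Type*} [MeasurableSpace X] (s : Mandelstam L)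
    (a : CompIdx L) {w : X → ℕ → ℂ} (hw : ∀ k, Measurable fun x => w x k) :
    Measurable fun x => bracketProd L s a (w x) := by
  unfold bracketProd
  refine Measurable.mul ?_ ?_
  · exact Finset.measurable_fun_prod _ fun k _ => ((hw _).const_div _).add
      (Finset.measurable_fun_sum _ fun j _ => ((hw _).sub (hw _)).const_div _)
  · exact Finset.measurable_fun_prod _ fun k _ =>
      (Finset.measurable_fun_sum _ fun j _ => ((hw _).sub (hw _)).const_div _)

lemma measurable_antiProd {L : ℕ} {X : Type*} [MeasurableSpace X]
    {w : X → ℕ → ℂ} (hw : ∀ k, Measurable fun x => w x k) :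
    Measurable fun x => antiProd L (w x) := by
  have hc : ∀ k, Measurable fun x => cbar (w x k) := fun k => measurable_cbar.comp (hw k)
  unfold antiProd
  exact ((hc L).const_div 1).mul (Finset.measurable_fun_prod _ fun k _ =>
    ((hc k).sub (hc _)).const_div 1)

lemma measurable_coreIntegrand {L : ℕ} {X : Type*} [MeasurableSpace X] (s : Mandelstam L)
    (a : CompIdx L) {w : X → ℕ → ℂ} (hw : ∀ k, Measurable fun x => w x k) :
    Measurable fun x => coreIntegrand L s a (w x) :=
  ((measurable_pairProd _ hw).mul (measurable_bracketProd s a hw)).mul (measurable_antiProd hw)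

end

noncomputable section

/-! ### Convergence and the leading behaviour -/

lemma continuous_mand {L : ℕ} (i j : ℕ) : Continuous fun s : Mandelstam L => mand s i j := by
  unfold mand
  split_ifs
  · exact continuous_apply _
  · exact continuous_const

lemma continuous_killLabel {L : ℕ} (j : ℕ) : Continuous (killLabel j : Mandelstam L → _) := by
  refine continuous_pi fun e => ?_
  unfold killLabel
  split_ifs
  · exact continuous_const
  · exact continuous_apply _

/-- The smallness of `ε` under which all estimates below hold. -/
structure SmallFor (L : ℕ) (ε : ℝ) : Prop where
  four_le : 4 ≤ L
  pos : 0 < ε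
  small : 24 * (L : ℝ) ^ 2 * ε ≤ 1
  card_le : 4 ^ Fintype.card (Finset.Icc 4 L) * (4 * ε) ≤ 1 / 2

variable {L : ℕ} {ε δ : ℝ} {s : Mandelstam L} {a : CompIdx L}

lemma SmallFor.exists_admissible (h : SmallFor L ε) (hs : s ∈ convRegion L ε) :
    ∃ δ : ℝ, 0 < δ ∧ δ ≤ 1 ∧ ∀ᶠ t in 𝓝 s, Admissible L ε δ t := by
  obtain ⟨h1, h2⟩ := hs
  have e : ∀ᶠ δ in 𝓝[>] (0 : ℝ), ∀ i ∈ insert 1 (Finset.Icc 4 L),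
      ∀ j ∈ insert 1 (Finset.Icc 4 L), i ≠ j → δ < 2 * (mand s i j).re := by
    rw [Filter.eventually_all_finset]; intro i hi
    rw [Filter.eventually_all_finset]; intro j hj
    by_cases hij : i = j
    · simp [hij]
    · have := h2 i hi j hj hij
      filter_upwards [Ioo_mem_nhdsGT (show (0 : ℝ) < 2 * (mand s i j).re by linarith)] with δ hδ _
      exact hδ.2
  obtain ⟨δ, hδ, hδ0, hδ1⟩ := (e.and (Ioc_mem_nhdsGT (zero_lt_one (α := ℝ)))).exists
  refine ⟨δ, hδ0, hδ1, ?_⟩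
  have c : ∀ᶠ t in 𝓝 s, ∀ i ∈ insert 1 (Finset.Icc 4 L),
      ∀ j ∈ insert 1 (Finset.Icc 4 L), i ≠ j → δ < 2 * (mand t i j).re := by
    rw [Filter.eventually_all_finset]; intro i hi
    rw [Filter.eventually_all_finset]; intro j hj
    by_cases hij : i = j
    · simp [hij]
    · have hc : Continuous fun t : Mandelstam L => 2 * (mand t i j).re :=
        continuous_const.mul (Complex.continuous_re.comp (continuous_mand i j))
      filter_upwards [hc.continuousAt.eventually_const_lt (hδ i hi j hj hij)] with t ht _ using ht
  filter_upwards [c, Metric.isOpen_ball.mem_nhds h1] with t ht ht'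
  exact ⟨h.four_le, h.pos, h.small, (mem_ball_zero_iff.1 ht').le,
    fun i hi j hj hij => (ht i hi j hj hij).le⟩

lemma measurable_compDom (p : ℂ) : Measurable (compDom L ε δ a p) := measurable_domFun _ _ _ _ _

lemma SmallFor.exists_integral_compDom_le (h : SmallFor L ε) (hδ : 0 < δ) (hδ1 : δ ≤ 1)
    (a : CompIdx L) {d : ℝ} (hd : 0 < d) :
    ∃ M : ℝ, ∀ p : ℂ, d ≤ ‖p‖ → d ≤ ‖p - 1‖ →
      Integrable (compDom L ε δ a p) ∧ ∫ x, compDom L ε δ a p x ≤ M := by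
  have hL : (0 : ℝ) < L := by exact_mod_cast (by have := h.four_le; omega : 0 < L)
  obtain ⟨M, hM⟩ := exists_lintegral_domFun_le (ι := Finset.Icc 4 L)
    (ρ := fun j : Finset.Icc 4 L => labelRank a j)
    (fun i j hij => Subtype.ext (labelRank_injOn a i.2 j.2 hij)) hδ hδ1
    (κ := 1 / (4 * L)) (by positivity) hd (η := 4 * ε) (by linarith [h.pos]) h.card_le
  refine ⟨M, fun p hp hp1 => ?_⟩
  have hfin := hM p hp hp1
  have hnn : 0 ≤ᵐ[volume] compDom L ε δ a p := ae_of_all _ fun x => compDom_nonneg p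
  refine ⟨⟨(measurable_compDom p).aestronglyMeasurable, ?_⟩, ?_⟩
  · rw [hasFiniteIntegral_iff_ofReal hnn]
    exact hfin.trans_lt ENNReal.coe_lt_top
  · rw [integral_eq_lintegral_of_nonneg_ae hnn (measurable_compDom p).aestronglyMeasurable]
    exact ENNReal.toReal_le_of_le_ofReal M.2 (by rw [ENNReal.ofReal_coe_nnreal]; exact hfin)

lemma integrable_of_norm_le_compDom {f : (Finset.Icc 4 L → ℂ) → ℂ} {p : ℂ} {C : ℝ}
    (hf : Measurable f) (hd : Integrable (compDom L ε δ a p))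
    (h : ∀ x, Generic L p (scaledPos p x) → ‖f x‖ ≤ C * (L * compDom L ε δ a p x)) :
    Integrable f := by
  refine ((hd.const_mul (L : ℝ)).const_mul C).mono' hf.aestronglyMeasurable ?_
  filter_upwards [ae_generic L p] with x hx using h x hx

lemma norm_integral_le_compDom {f : (Finset.Icc 4 L → ℂ) → ℂ} {p : ℂ} {C M : ℝ} (hC : 0 ≤ C)
    (hd : Integrable (compDom L ε δ a p)) (hM : ∫ x, compDom L ε δ a p x ≤ M)
    (h : ∀ x, Generic L p (scaledPos p x) → ‖f x‖ ≤ C * (L * compDom L ε δ a p x)) :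
    ‖∫ x, f x‖ ≤ C * (L * M) := by
  refine (norm_integral_le_of_norm_le ((hd.const_mul (L : ℝ)).const_mul C)
    (by filter_upwards [ae_generic L p] with x hx using h x hx)).trans ?_
  rw [integral_const_mul, integral_const_mul]
  gcongr

theorem SmallFor.integrable_fhatIntegrand (h : SmallFor L ε) (hs : s ∈ convRegion L ε) {z : ℂ}
    (hz : z ≠ 0) (hz1 : z ≠ 1) (a : CompIdx L) : Integrable (fhatIntegrand L s z a) := by
  obtain ⟨δ, hδ, hδ1, hadm⟩ := h.exists_admissible hs
  have hs' := hadm.self_of_nhds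
  have hp1 : 0 < ‖z⁻¹ - 1‖ := norm_pos_iff.2 (sub_ne_zero.2 fun e => hz1 (by
    rw [← inv_inv z, e, inv_one]))
  have hp : 0 < ‖z⁻¹‖ := norm_pos_iff.2 (inv_ne_zero hz)
  obtain ⟨M, hM⟩ := h.exists_integral_compDom_le hδ hδ1 a (lt_min hp hp1)
  obtain ⟨hint, -⟩ := hM z⁻¹ (min_le_left _ _) (min_le_right _ _)
  refine integrable_comp_complex_smul hz ?_
  simp only [fhatIntegrand_smul h.four_le s hz]
  refine Integrable.const_mul (Integrable.const_mul (integrable_of_norm_le_compDom ?_ hint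
    fun x hx => norm_core_mul_twoProd_le hs' hz hz1 hx) _) _
  exact (measurable_coreIntegrand s a (measurable_scaledPos _)).mul
    (measurable_twoProd s z (measurable_scaledPos _))

lemma coreIntegrand_congr (ha : (a.1 : ℕ) = 4) {w w' : ℕ → ℂ} (hw : ∀ k, k ≠ 2 → w k = w' k)
    (hL : 4 ≤ L) : coreIntegrand L s a w = coreIntegrand L s a w' := by
  have ge : ∀ k ∈ Finset.Icc 4 L, a.2.act k ≠ 2 := fun k hk => by
    have := Finset.mem_Icc.1 ((a.2.act_mem_iff k).2 hk); omega
  have h1 : pairProd L (killLabel 2 s) w = pairProd L (killLabel 2 s) w' := by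
    unfold pairProd
    refine Finset.prod_congr rfl fun k _ => Finset.prod_congr rfl fun m _ => ?_
    by_cases hk : k = 2 ∨ m = 2
    · rw [mand_killLabel, if_pos hk]; simp
    · push Not at hk
      rw [hw k hk.1, hw m hk.2]
  have h2 : bracketProd L s a w = bracketProd L s a w' := by
    unfold bracketProd
    rw [ha]
    congr 1
    · refine Finset.prod_congr rfl fun k hk => ?_
      rw [hw _ (ge k hk)]
      congr 1
      refine Finset.sum_congr rfl fun j hj => ?_
      rw [hw _ (ge j (by simp only [Finset.mem_Icc, Finset.mem_Ioc] at *; omega))]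
  have h3 : antiProd L w = antiProd L w' := by
    unfold antiProd
    rw [hw L (by omega)]
    congr 1
    refine Finset.prod_congr rfl fun k hk => ?_
    have := Finset.mem_Icc.1 hk
    rw [hw k (by omega), hw (k - 1) (by omega)]
  unfold coreIntegrand
  rw [h1, h2, h3]

lemma coreIntegrand_scaledPos (ha : (a.1 : ℕ) = 4) (hL : 4 ≤ L) (p q : ℂ)
    (x : Finset.Icc 4 L → ℂ) :
    coreIntegrand L s a (scaledPos p x) = coreIntegrand L s a (scaledPos q x) :=
  coreIntegrand_congr ha (fun k hk => by simp [scaledPos, hk]) hL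

/-- The regularized value, as an integral. -/
def limitVec (L : ℕ) (s : Mandelstam L) (a : CompIdx L) : ℂ :=
  if (a.1 : ℕ) = 4 then
    (-1 / (Real.pi : ℂ)) ^ (L - 3) * ∫ x : Finset.Icc 4 L → ℂ, coreIntegrand L s a (scaledPos 2 x)
  else 0

lemma SmallFor.integrable_coreIntegrand (h : SmallFor L ε) (hs : s ∈ convRegion L ε)
    (ha : (a.1 : ℕ) = 4) (p : ℂ) :
    Integrable fun x : Finset.Icc 4 L → ℂ => coreIntegrand L s a (scaledPos p x) := by
  obtain ⟨δ, hδ, hδ1, hadm⟩ := h.exists_admissible hs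
  have hs' := hadm.self_of_nhds
  obtain ⟨M, hM⟩ := h.exists_integral_compDom_le hδ hδ1 a (zero_lt_one (α := ℝ))
  obtain ⟨hint, -⟩ := hM 2 (by simp) (by norm_num)
  simp only [coreIntegrand_scaledPos ha h.four_le p 2]
  exact integrable_of_norm_le_compDom (measurable_coreIntegrand s a (measurable_scaledPos _)) hint
    (C := 1) fun x hx => by rw [one_mul]; exact norm_coreIntegrand_le hs' hx

lemma norm_smax_le (hs : ‖s‖ ≤ ε) : ‖smax L s‖ ≤ L ^ 2 * ε := by
  have hε : 0 ≤ ε := (norm_nonneg _).trans hs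
  have b : ∀ k m, ‖mand (killLabel 2 s) k m‖ ≤ ε := fun k m =>
    (norm_mand_le _ k m).trans ((norm_killLabel_le 2 s).trans hs)
  unfold smax
  refine (norm_sum_le_of_le (n := fun _ => L * ε) _ fun k _ => ?_).trans ?_
  · refine (norm_sum_le_of_le (n := fun _ => ε) _ fun m _ => b k m).trans ?_
    rw [Finset.sum_const, nsmul_eq_mul, Nat.card_Ioc]
    gcongr; exact_mod_cast Nat.sub_le _ _
  · rw [Finset.sum_const, nsmul_eq_mul, Nat.card_Icc, Nat.add_sub_cancel]
    exact le_of_eq (by ring)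

lemma norm_absPow_smax_le (h : Admissible L ε δ s) {z : ℂ} (hz : z ≠ 0) (hz1 : ‖z‖ ≤ 1) :
    ‖absPow z (smax L s)‖ ≤ ‖z‖ ^ (-(1 / 12) : ℝ) := by
  rw [norm_absPow hz]
  refine Real.rpow_le_rpow_of_exponent_ge (norm_pos_iff.2 hz) hz1 ?_
  have h1 := norm_smax_le h.norm_le
  have h2 := abs_le.1 (Complex.abs_re_le_norm (smax L s))
  linarith [h.small]

lemma scaleConst_pow_le (h : Admissible L ε δ s) {z : ℂ} (hz : z ≠ 0) (hz1 : ‖z‖ ≤ 1 / 2) :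
    scaleConst ε z ^ L ≤ 3 * ‖z‖ ^ (-(1 / 48) : ℝ) := by
  have z0 := norm_pos_iff.2 hz
  have hi : 2 ≤ ‖z‖⁻¹ := by
    rw [le_inv_comm₀ (by norm_num) z0]; linarith
  have hL : (4 : ℝ) ≤ L := by exact_mod_cast h.four_le
  have hεL : 2 * ε * L ≤ 1 / 48 := by
    have := h.small
    have : 4 * (L * ε) ≤ L * (L * ε) :=
      mul_le_mul_of_nonneg_right hL (by have := h.pos; positivity)
    nlinarith
  have hb : (1 + ‖z‖) * (1 + ‖z‖⁻¹) ≤ 3 * ‖z‖⁻¹ := by nlinarith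
  have hb1 : 1 ≤ 3 * ‖z‖⁻¹ := by linarith
  unfold scaleConst
  rw [← Real.rpow_mul_natCast (by positivity)]
  calc ((1 + ‖z‖) * (1 + ‖z‖⁻¹)) ^ (2 * ε * L) ≤ (3 * ‖z‖⁻¹) ^ (2 * ε * L) :=
        Real.rpow_le_rpow (by positivity) hb (by have := h.pos; positivity)
    _ ≤ (3 * ‖z‖⁻¹) ^ (1 / 48 : ℝ) := Real.rpow_le_rpow_of_exponent_le hb1 hεL
    _ = 3 ^ (1 / 48 : ℝ) * ‖z‖ ^ (-(1 / 48) : ℝ) := by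
        rw [Real.mul_rpow (by norm_num) (by positivity), Real.rpow_neg z0.le, Real.inv_rpow z0.le]
    _ ≤ _ := by
        gcongr
        calc (3 : ℝ) ^ (1 / 48 : ℝ) ≤ 3 ^ (1 : ℝ) :=
              Real.rpow_le_rpow_of_exponent_le (by norm_num) (by norm_num)
          _ = 3 := Real.rpow_one _

lemma two_le_norm_inv {z : ℂ} (hz : z ≠ 0) (hz1 : ‖z‖ ≤ 1 / 2) :
    1 ≤ ‖z⁻¹‖ ∧ 1 ≤ ‖z⁻¹ - 1‖ := by
  have z0 := norm_pos_iff.2 hz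
  have hi : 2 ≤ ‖z‖⁻¹ := by
    rw [le_inv_comm₀ (by norm_num) z0]; linarith
  rw [norm_inv]
  refine ⟨by linarith, ?_⟩
  have := norm_sub_norm_le z⁻¹ 1
  rw [norm_inv, norm_one] at this
  linarith

lemma error_bound_aux (h : Admissible L ε δ s) {z : ℂ} (hz : z ≠ 0) (hz1 : ‖z‖ ≤ 1 / 2) {C : ℝ}
    (hC : 0 ≤ C) :
    ‖absPow z (smax L s)‖ *
      (C * Real.sqrt ‖z‖ * (scaleConst ε z ^ L * sing (2 * ε) ‖z⁻¹ - 1‖)) ≤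
      3 * C * ‖z‖ ^ (1 / 4 : ℝ) := by
  have z0 := norm_pos_iff.2 hz
  have h1 := norm_absPow_smax_le h hz (by linarith)
  have h2 := scaleConst_pow_le h hz hz1
  have h3 : sing (2 * ε) ‖z⁻¹ - 1‖ = 1 := by
    unfold sing; rw [min_eq_right (two_le_norm_inv hz hz1).2, Real.one_rpow]
  rw [h3, mul_one, Real.sqrt_eq_rpow]
  have c0 : 0 ≤ scaleConst ε z ^ L :=
    pow_nonneg (zero_le_one.trans (one_le_scaleConst h.pos.le z)) _
  calc _ ≤ ‖z‖ ^ (-(1 / 12) : ℝ) * (C * ‖z‖ ^ (1 / 2 : ℝ) * (3 * ‖z‖ ^ (-(1 / 48) : ℝ))) := by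
        gcongr
    _ = 3 * C * ‖z‖ ^ (-(1 / 12) + 1 / 2 + -(1 / 48) : ℝ) := by
        rw [Real.rpow_add z0, Real.rpow_add z0]; ring
    _ ≤ _ := by
        refine mul_le_mul_of_nonneg_left ?_ (by positivity)
        exact Real.rpow_le_rpow_of_exponent_ge z0 (by linarith) (by norm_num)

theorem SmallFor.exists_norm_fhat_sub_le (h : SmallFor L ε) (hs : s ∈ convRegion L ε)
    (a : CompIdx L) :
    ∃ M : ℝ, ∀ z : ℂ, z ≠ 0 → ‖z‖ ≤ 1 / 2 →
      ‖fhat L s z a - absPow z (smax L s) * limitVec L s a‖ ≤ M * ‖z‖ ^ (1 / 4 : ℝ) := by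
  obtain ⟨δ, hδ, hδ1, hadm⟩ := h.exists_admissible hs
  have hs' := hadm.self_of_nhds
  obtain ⟨M, hM⟩ := h.exists_integral_compDom_le hδ hδ1 a (zero_lt_one (α := ℝ))
  have hM0 : 0 ≤ M := by
    refine le_trans ?_ (hM 2 (by simp) (by norm_num)).2
    exact integral_nonneg fun x => compDom_nonneg 2
  set c : ℂ := (-1 / (Real.pi : ℂ)) ^ (L - 3) with hc
  refine ⟨‖c‖ * (3 * (L * 8) * (L * M)), fun z hz hz1 => ?_⟩
  have hz' : z ≠ 1 := fun e => by rw [e, norm_one] at hz1; norm_num at hz1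
  obtain ⟨q1, q2⟩ := two_le_norm_inv hz hz1
  obtain ⟨hint, hMz⟩ := hM z⁻¹ q1 q2
  have hm := (measurable_coreIntegrand s a (measurable_scaledPos (L := L) z⁻¹)).mul
    (measurable_twoProd s z (measurable_scaledPos (L := L) z⁻¹))
  have hI : Integrable fun x : Finset.Icc 4 L → ℂ =>
      coreIntegrand L s a (scaledPos z⁻¹ x) * twoProd L s z (scaledPos z⁻¹ x) :=
    integrable_of_norm_le_compDom hm hint
    fun x hx => norm_core_mul_twoProd_le hs' hz hz' hx
  have hK := scaleFactor_nonneg (z := z) hs'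
  obtain ⟨D, hD1, hD2⟩ : ∃ D : ℂ, fhat L s z a - absPow z (smax L s) * limitVec L s a =
      absPow z (smax L s) * (c * D) ∧ ‖D‖ ≤
      L * 8 * Real.sqrt ‖z‖ * (scaleConst ε z ^ L * sing (2 * ε) ‖z⁻¹ - 1‖) * (L * M) := by
    rw [fhat_eq h.four_le s hz, limitVec]
    split_ifs with ha
    · have hI2 := h.integrable_coreIntegrand hs ha z⁻¹
      refine ⟨∫ x : Finset.Icc 4 L → ℂ,
        (coreIntegrand L s a (scaledPos z⁻¹ x) * twoProd L s z (scaledPos z⁻¹ x)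
          - coreIntegrand L s a (scaledPos z⁻¹ x)), ?_, ?_⟩
      · rw [integral_sub hI hI2]
        simp only [coreIntegrand_scaledPos ha h.four_le 2 z⁻¹]
        ring
      · exact norm_integral_le_compDom (mul_nonneg (by positivity) hK) hint hMz
          fun x hx => norm_core_mul_twoProd_sub_le hs' hz hz' hx
    · refine ⟨_, by rw [mul_zero, sub_zero], ?_⟩
      refine (norm_integral_le_compDom (mul_nonneg (by positivity) hK) hint hMz
          fun x hx => norm_core_mul_twoProd_le_of_ne hs' hz hz' hx ha).trans ?_
      have hLr : (4 : ℝ) ≤ L := by exact_mod_cast h.four_le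
      have : Real.sqrt (2 * ‖z‖) ≤ L * 8 * Real.sqrt ‖z‖ := by
        rw [Real.sqrt_mul (by norm_num)]
        refine mul_le_mul_of_nonneg_right ?_ (Real.sqrt_nonneg _)
        rw [Real.sqrt_le_iff]
        constructor <;> nlinarith
      gcongr
  rw [hD1, norm_mul, norm_mul]
  have key := error_bound_aux hs' hz hz1 (C := L * 8) (by positivity)
  calc _ ≤ ‖absPow z (smax L s)‖ * (‖c‖ * (L * 8 * Real.sqrt ‖z‖ *
        (scaleConst ε z ^ L * sing (2 * ε) ‖z⁻¹ - 1‖) * (L * M))) := by gcongr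
    _ = ‖c‖ * (L * M) * (‖absPow z (smax L s)‖ * (L * 8 * Real.sqrt ‖z‖ *
        (scaleConst ε z ^ L * sing (2 * ε) ‖z⁻¹ - 1‖))) := by ring
    _ ≤ ‖c‖ * (L * M) * (3 * (L * 8) * ‖z‖ ^ (1 / 4 : ℝ)) := by gcongr
    _ = _ := by ring

/-! ### Continuity of the limit in the variables -/

lemma continuous_absPow {u : ℂ} (hu : u ≠ 0) : Continuous fun t : ℂ => absPow u t := by
  unfold absPow
  refine continuous_iff_continuousAt.2 fun t => ?_
  exact (continuousAt_const_cpow (by simpa using hu)).comp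
    (continuous_const.mul continuous_id).continuousAt

lemma Generic.ne_of_lt {p : ℂ} {w : ℕ → ℂ} (hw : Generic L p w) (hp : p ≠ 0) (hp1 : p ≠ 1)
    {k m : ℕ} (hk : k ∈ Finset.Icc 1 L) (hm : m ∈ Finset.Ioc k L) : w k ≠ w m := by
  obtain ⟨hk1, -⟩ := Finset.mem_Icc.1 hk
  obtain ⟨hkm, hmL⟩ := Finset.mem_Ioc.1 hm
  have key : ∀ j, 4 ≤ j → j ≤ L → j ∈ Finset.Icc 4 L := fun j h1 h2 => Finset.mem_Icc.2 ⟨h1, h2⟩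
  rcases Nat.lt_or_ge m 4 with hm4 | hm4
  · have hk3 : k < 3 := by omega
    interval_cases k
    · interval_cases m
      · rw [hw.one, hw.two]; exact hp.symm
      · rw [hw.one, hw.three]; exact zero_ne_one
    · interval_cases m
      rw [hw.two, hw.three]; exact hp1
  · have hmm := key m hm4 hmL
    rcases Nat.lt_or_ge k 4 with hk4 | hk4
    · interval_cases k
      · rw [hw.one]; exact (hw.ne_zero m hmm).symm
      · rw [hw.two]; exact (hw.ne_p m hmm).symm
      · rw [hw.three]; exact (hw.ne_one m hmm).symm
    · exact hw.ne k (key k hk4 (by omega)) m hmm (by omega)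

lemma continuous_coreIntegrand {p : ℂ} {w : ℕ → ℂ} (hw : Generic L p w) (hp : p ≠ 0) (hp1 : p ≠ 1)
    (a : CompIdx L) : Continuous fun s : Mandelstam L => coreIntegrand L s a w := by
  have c := fun i j => continuous_mand (L := L) i j
  unfold coreIntegrand pairProd bracketProd
  refine Continuous.mul (Continuous.mul ?_ (Continuous.mul ?_ ?_)) continuous_const
  · refine continuous_finsetProd _ fun k hk => continuous_finsetProd _ fun m hm => ?_
    exact (continuous_absPow (sub_ne_zero.2 (hw.ne_of_lt hp hp1 hk hm))).comp
      ((c k m).comp (continuous_killLabel 2))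
  · exact continuous_finsetProd _ fun k _ => ((c _ _).div_const _).add
      (continuous_finsetSum _ fun j _ => (c _ _).div_const _)
  · exact continuous_finsetProd _ fun k _ =>
      (continuous_finsetSum _ fun j _ => (c _ _).div_const _)

theorem SmallFor.continuousAt_limitVec (h : SmallFor L ε) (hs : s ∈ convRegion L ε)
    (a : CompIdx L) : ContinuousAt (fun t => limitVec L t a) s := by
  unfold limitVec
  split_ifs with ha
  · obtain ⟨δ, hδ, hδ1, hadm⟩ := h.exists_admissible hs
    obtain ⟨M, hM⟩ := h.exists_integral_compDom_le hδ hδ1 a (zero_lt_one (α := ℝ))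
    obtain ⟨hint, -⟩ := hM 2 (by simp) (by norm_num)
    refine continuousAt_const.mul (continuousAt_of_dominated
      (bound := fun x => L * compDom L ε δ a 2 x) ?_ ?_ (hint.const_mul _) ?_)
    · exact Eventually.of_forall fun t =>
        (measurable_coreIntegrand t a (measurable_scaledPos _)).aestronglyMeasurable
    · filter_upwards [hadm] with t ht
      filter_upwards [ae_generic L 2] with x hx using norm_coreIntegrand_le ht hx
    · filter_upwards [ae_generic L 2] with x hx
      exact (continuous_coreIntegrand hx (by norm_num) (by norm_num) a).continuousAt
  · exact continuousAt_const

end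

noncomputable section

/-! ### A Cauchy–Pompeiu formula -/

/-- The function `h` is real differentiable at `w`, with Wirtinger derivatives `h₁` and `h₂`. -/
def HasWirtingerAt (h : ℂ → ℂ) (h₁ h₂ w : ℂ) : Prop :=
  HasFDerivAt h (h₁ • ContinuousLinearMap.id ℝ ℂ + h₂ • (Complex.conjCLE : ℂ →L[ℝ] ℂ)) w

lemma HasWirtingerAt.comp_hasDerivAt {h : ℂ → ℂ} {h₁ h₂ γ' : ℂ} {γ : ℝ → ℂ} {t : ℝ}
    (hh : HasWirtingerAt h h₁ h₂ (γ t)) (hγ : HasDerivAt γ γ' t) :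
    HasDerivAt (fun t => h (γ t)) (h₁ * γ' + h₂ * (starRingEnd ℂ) γ') t := by
  have := HasFDerivAt.comp_hasDerivAt t hh hγ
  simp only [add_apply, smul_apply,
    ContinuousLinearMap.id_apply, smul_eq_mul] at this
  exact this

lemma HasWirtingerAt.mul {f g : ℂ → ℂ} {f₁ f₂ g₁ g₂ w : ℂ} (hf : HasWirtingerAt f f₁ f₂ w)
    (hg : HasWirtingerAt g g₁ g₂ w) :
    HasWirtingerAt (fun u => f u * g u) (f₁ * g w + f w * g₁) (f₂ * g w + f w * g₂) w := by
  unfold HasWirtingerAt at *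
  convert! HasFDerivAt.mul hf hg using 1
  ext
  simp; ring

lemma integrableOn_polar {g : ℂ → ℂ} (hg : Measurable g) (u : ℝ → ℂ) (hu : Measurable u)
    (hu1 : ∀ θ, ‖u θ‖ = 1) (hi : Integrable fun w => g w / (starRingEnd ℂ) w) :
    Integrable (fun p : ℝ × ℝ => g (Complex.polarCoord.symm p) * u p.2)
      ((volume.restrict (Set.Ioi 0)).prod (volume.restrict (Set.Ioo (-Real.pi) Real.pi))) := by
  rw [Measure.prod_restrict, ← Measure.volume_eq_prod]
  have hm : Measurable fun p : ℝ × ℝ => Complex.polarCoord.symm p := by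
    simp only [Complex.polarCoord_symm_apply]; fun_prop
  refine ⟨((hg.comp hm).mul (hu.comp measurable_snd)).aestronglyMeasurable, ?_⟩
  have h := hi.2
  unfold HasFiniteIntegral at h ⊢
  rw [← Complex.lintegral_comp_polarCoord_symm] at h
  refine lt_of_eq_of_lt ?_ h
  refine setLIntegral_congr_fun (measurableSet_Ioi.prod measurableSet_Ioo) fun p hp => ?_
  have hp1 : 0 < p.1 := hp.1
  rw [← ofReal_norm, ← ofReal_norm, smul_eq_mul, ← ENNReal.ofReal_mul hp1.le,
    norm_mul, hu1, norm_div, RCLike.norm_conj, Complex.norm_polarCoord_symm, abs_of_pos hp1]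
  congr 1
  field_simp

lemma integral_polar (g : ℂ → ℂ) :
    ∫ w, g w / (starRingEnd ℂ) w = ∫ p in Set.Ioi 0 ×ˢ Set.Ioo (-Real.pi) Real.pi,
      g (Complex.polarCoord.symm p) * Complex.exp (p.2 * Complex.I) := by
  rw [← Complex.integral_comp_polarCoord_symm]
  refine setIntegral_congr_fun (measurableSet_Ioi.prod measurableSet_Ioo) fun p hp => ?_
  have hp1 : 0 < p.1 := hp.1
  have hc : (p.1 : ℂ) ≠ 0 := by exact_mod_cast hp1.ne'
  have e : Complex.polarCoord.symm p = p.1 * Complex.exp (p.2 * Complex.I) := by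
    rw [Complex.polarCoord_symm_apply, Complex.exp_mul_I]; simp
  have e2 : (starRingEnd ℂ) (p.1 * Complex.exp (p.2 * Complex.I)) =
      p.1 * (Complex.exp (p.2 * Complex.I))⁻¹ := by
    rw [map_mul, Complex.conj_ofReal, ← Complex.exp_conj, ← Complex.exp_neg]; simp
  have := Complex.exp_ne_zero (p.2 * Complex.I)
  rw [e, e2, Complex.real_smul]
  field_simp

lemma cauchyPompeiu_zero {h h₁ h₂ : ℂ → ℂ} {E : Set ℂ} (hE : E.Finite)
    (hd : ∀ w ∉ E, HasWirtingerAt h (h₁ w) (h₂ w) w) (hc : ContinuousAt h 0)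
    (hlim : Tendsto h (cocompact ℂ) (𝓝 0)) (m1 : Measurable h₁) (m2 : Measurable h₂)
    (i1 : Integrable fun w => h₁ w / (starRingEnd ℂ) w)
    (i2 : Integrable fun w => h₂ w / (starRingEnd ℂ) w) :
    ∫ w, h₁ w / (starRingEnd ℂ) w = -(Real.pi : ℂ) * h 0 := by
  set μ := volume.restrict (Set.Ioi (0 : ℝ)) with hμ
  set ν := volume.restrict (Set.Ioo (-Real.pi) Real.pi) with hν
  have e : ∀ r θ : ℝ, Complex.polarCoord.symm (r, θ) = r * Complex.exp (θ * Complex.I) := by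
    intro r θ
    rw [Complex.polarCoord_symm_apply, Complex.exp_mul_I]; simp
  have n1 : ∀ θ : ℝ, ‖Complex.exp (θ * Complex.I)‖ = 1 := Complex.norm_exp_ofReal_mul_I
  have n2 : ∀ θ : ℝ, ‖Complex.exp (-(θ * Complex.I))‖ = 1 := fun θ => by
    rw [Complex.exp_neg, norm_inv, n1, inv_one]
  have cexp : ∀ θ : ℝ, (starRingEnd ℂ) (Complex.exp (θ * Complex.I)) =
      Complex.exp (-(θ * Complex.I)) := fun θ => by
    rw [← Complex.exp_conj]; simp
  set F1 : ℝ × ℝ → ℂ := fun p => h₁ (Complex.polarCoord.symm p) * Complex.exp (p.2 * Complex.I)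
    with hF1
  set F2 : ℝ × ℝ → ℂ := fun p => h₂ (Complex.polarCoord.symm p) * Complex.exp (-(p.2 * Complex.I))
    with hF2
  have I1 : Integrable F1 (μ.prod ν) := integrableOn_polar m1 _ (by fun_prop) n1 i1
  have I2 : Integrable F2 (μ.prod ν) := integrableOn_polar m2 _ (by fun_prop) n2 i2
  have hA : ∫ w, h₁ w / (starRingEnd ℂ) w = ∫ p, F1 p ∂(μ.prod ν) := by
    rw [integral_polar, hμ, hν, Measure.prod_restrict, ← Measure.volume_eq_prod]
  have hpi := Real.pi_pos
  have I12 : Integrable (fun p => F1 p - F2 p) (μ.prod ν) := I1.sub I2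
  have I12' : Integrable (fun p => F1 p + F2 p) (μ.prod ν) := I1.add I2
  -- integration over the angles
  have hsub : ∫ p, (F1 p - F2 p) ∂(μ.prod ν) = 0 := by
    rw [integral_prod _ I12]
    refine integral_eq_zero_of_ae ?_
    have a1 : ∀ᵐ r ∂μ, r ∉ norm '' E :=
      ((hE.image _).countable.ae_notMem _).filter_mono (ae_mono Measure.restrict_le_self)
    filter_upwards [a1, I12.prod_right_ae, ae_restrict_mem measurableSet_Ioi]
      with r hr hir hr0
    have hr0' : (0 : ℝ) < r := hr0
    have hrc : (r : ℂ) ≠ 0 := by exact_mod_cast hr0'.ne'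
    have hder : ∀ θ : ℝ, HasDerivAt (fun θ : ℝ => h (r * Complex.exp (θ * Complex.I)))
        ((r * Complex.I) * (F1 (r, θ) - F2 (r, θ))) θ := by
      intro θ
      have hw : (r * Complex.exp (θ * Complex.I)) ∉ E := fun hw => hr ⟨_, hw, by
        rw [norm_mul, n1, mul_one, Complex.norm_real, Real.norm_of_nonneg hr0'.le]⟩
      have hγ : HasDerivAt (fun θ : ℝ => (r : ℂ) * Complex.exp (θ * Complex.I))
          (r * (Complex.exp (θ * Complex.I) * (1 * Complex.I))) θ :=
        (((hasDerivAt_id θ).ofReal_comp.mul_const Complex.I).cexp).const_mul _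
      convert! HasWirtingerAt.comp_hasDerivAt
        (γ := fun θ : ℝ => (r : ℂ) * Complex.exp (θ * Complex.I)) (hd _ hw) hγ using 1
      simp only [hF1, hF2, e, map_mul, cexp, Complex.conj_ofReal, Complex.conj_I, map_one]
      ring
    have hii : IntervalIntegrable (fun θ => (r * Complex.I) * (F1 (r, θ) - F2 (r, θ))) volume
        (-Real.pi) Real.pi := by
      rw [intervalIntegrable_iff_integrableOn_Ioo_of_le (by linarith)]
      exact hir.const_mul _
    have hF := intervalIntegral.integral_eq_sub_of_hasDerivAt (fun θ _ => hder θ) hii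
    rw [intervalIntegral.integral_of_le (by linarith), integral_Ioc_eq_integral_Ioo,
      integral_const_mul] at hF
    have e0 : Complex.exp ((Real.pi : ℝ) * Complex.I) =
        Complex.exp (((-Real.pi : ℝ) : ℂ) * Complex.I) := by
      rw [Complex.ofReal_neg, neg_mul, Complex.exp_neg, Complex.exp_pi_mul_I]; norm_num
    rw [e0, sub_self] at hF
    simpa [hrc, hr0'.ne'] using hF
  -- integration over the radii
  have hadd : ∫ p, (F1 p + F2 p) ∂(μ.prod ν) = -(2 * Real.pi : ℂ) * h 0 := by
    rw [integral_prod_symm _ I12']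
    have a1 : ∀ᵐ θ ∂ν, θ ∉ Complex.arg '' E :=
      ((hE.image _).countable.ae_notMem _).filter_mono (ae_mono Measure.restrict_le_self)
    have key : ∀ᵐ θ ∂ν, ∫ r, (F1 (r, θ) + F2 (r, θ)) ∂μ = - h 0 := by
      filter_upwards [a1, I12'.prod_left_ae, ae_restrict_mem measurableSet_Ioo]
        with θ hθ hir hθ0
      have hder : ∀ r ∈ Set.Ioi (0 : ℝ),
          HasDerivAt (fun r : ℝ => h (r * Complex.exp (θ * Complex.I)))
          (F1 (r, θ) + F2 (r, θ)) r := by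
        intro r hr
        have hw : (r * Complex.exp (θ * Complex.I)) ∉ E := fun hw => hθ ⟨_, hw, by
          rw [Complex.exp_mul_I]
          exact Complex.arg_mul_cos_add_sin_mul_I hr ⟨hθ0.1, hθ0.2.le⟩⟩
        have hγ : HasDerivAt (fun r : ℝ => (r : ℂ) * Complex.exp (θ * Complex.I))
            (1 * Complex.exp (θ * Complex.I)) r :=
          (hasDerivAt_id r).ofReal_comp.mul_const _
        convert! HasWirtingerAt.comp_hasDerivAt
          (γ := fun r : ℝ => (r : ℂ) * Complex.exp (θ * Complex.I)) (hd _ hw) hγ using 1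
        simp only [hF1, hF2, e, map_mul, cexp, map_one]
        ring
      have hcont : ContinuousWithinAt (fun r : ℝ => h (r * Complex.exp (θ * Complex.I)))
          (Set.Ici 0) 0 := by
        refine ContinuousAt.continuousWithinAt ?_
        refine ContinuousAt.comp (f := fun r : ℝ => (r : ℂ) * Complex.exp (θ * Complex.I)) ?_ ?_
        · simpa using hc
        · fun_prop
      have hl : Tendsto (fun r : ℝ => h (r * Complex.exp (θ * Complex.I))) atTop (𝓝 0) := by
        refine hlim.comp ?_
        rw [← Metric.cobounded_eq_cocompact, ← tendsto_norm_atTop_iff_cobounded]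
        simp only [norm_mul, n1, mul_one, Complex.norm_real]
        exact tendsto_norm_atTop_atTop
      have := integral_Ioi_of_hasDerivAt_of_tendsto hcont hder hir hl
      simpa using this
    rw [integral_congr_ae key, integral_const]
    have : ν.real Set.univ = 2 * Real.pi := by
      rw [measureReal_restrict_apply MeasurableSet.univ]
      simp [Real.volume_real_Ioo_of_le (by linarith : -Real.pi ≤ Real.pi)]
      ring
    rw [this, Complex.real_smul]
    push_cast; ring
  rw [integral_sub I1 I2] at hsub
  rw [integral_add I1 I2] at hadd
  rw [hA]
  linear_combination (1 / 2 : ℂ) * hsub + (1 / 2 : ℂ) * hadd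

theorem cauchyPompeiu {h h₁ h₂ : ℂ → ℂ} {E : Set ℂ} (hE : E.Finite) (b : ℂ)
    (hd : ∀ w ∉ E, HasWirtingerAt h (h₁ w) (h₂ w) w) (hc : ContinuousAt h b)
    (hlim : Tendsto h (cocompact ℂ) (𝓝 0)) (m1 : Measurable h₁) (m2 : Measurable h₂)
    (i1 : Integrable fun w => h₁ w / (starRingEnd ℂ) (w - b))
    (i2 : Integrable fun w => h₂ w / (starRingEnd ℂ) (w - b)) :
    ∫ w, h₁ w / (starRingEnd ℂ) (w - b) = -(Real.pi : ℂ) * h b := by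
  have := cauchyPompeiu_zero (h := fun w => h (w + b)) (h₁ := fun w => h₁ (w + b))
    (h₂ := fun w => h₂ (w + b)) (E := (fun w => w - b) '' E) (hE.image _) ?_ ?_ ?_
    (m1.comp (measurable_add_const b)) (m2.comp (measurable_add_const b)) ?_ ?_
  · rw [zero_add] at this
    rw [← this, ← integral_add_right_eq_self _ b]
    simp
  · intro w hw
    have hw' : w + b ∉ E := fun h' => hw ⟨_, h', by simp⟩
    exact (hasFDerivAt_comp_add_right b).2 (hd _ hw')
  · refine ContinuousAt.comp (f := fun w => w + b) ?_ (by fun_prop)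
    simpa using hc
  · exact hlim.comp (Homeomorph.addRight b).isClosedEmbedding.tendsto_cocompact
  · simpa using i1.comp_add_right b
  · simpa using i2.comp_add_right b

end

noncomputable section

/-! ### Wirtinger derivatives of products of powers -/

lemma HasWirtingerAt.comp_holomorphic {f h : ℂ → ℂ} {f' h₁ h₂ w : ℂ} (hf : HasDerivAt f f' (h w))
    (hh : HasWirtingerAt h h₁ h₂ w) :
    HasWirtingerAt (fun u => f (h u)) (f' * h₁) (f' * h₂) w := by
  unfold HasWirtingerAt at *
  convert! (hf.hasFDerivAt.restrictScalars ℝ).comp w hh using 1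
  ext
  simp; ring

lemma hasWirtingerAt_conj_sub (c w : ℂ) :
    HasWirtingerAt (fun u => (starRingEnd ℂ) (u - c)) 0 1 w := by
  unfold HasWirtingerAt
  simp only [map_sub]
  have h : HasFDerivAt (fun u : ℂ => (starRingEnd ℂ) u) (Complex.conjCLE : ℂ →L[ℝ] ℂ) w :=
    (Complex.conjCLE : ℂ →L[ℝ] ℂ).hasFDerivAt
  convert! h.sub_const ((starRingEnd ℂ) c) using 1
  ext
  simp

lemma hasWirtingerAt_sub (c w : ℂ) : HasWirtingerAt (fun u => u - c) 1 0 w := by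
  unfold HasWirtingerAt
  convert! (hasFDerivAt_id (𝕜 := ℝ) w).sub_const c using 1
  ext
  simp

lemma absPow_eq_cpow {u : ℂ} (hu : u ≠ 0) (t : ℂ) :
    absPow u t = (u * (starRingEnd ℂ) u) ^ t := by
  have h := norm_pos_iff.2 hu
  have h2 : (0 : ℝ) < ‖u‖ ^ 2 := by positivity
  unfold absPow
  rw [Complex.mul_conj, Complex.normSq_eq_norm_sq,
    Complex.cpow_def_of_ne_zero (by exact_mod_cast h.ne'),
    Complex.cpow_def_of_ne_zero (by exact_mod_cast h2.ne'), ← Complex.ofReal_log h.le,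
    ← Complex.ofReal_log h2.le, Real.log_pow]
  push_cast; ring_nf

lemma hasWirtingerAt_absPow {c w : ℂ} (h : w ≠ c) (t : ℂ) :
    HasWirtingerAt (fun u => absPow (u - c) t) (absPow (w - c) t * (t / (w - c)))
      (absPow (w - c) t * (t / (starRingEnd ℂ) (w - c))) w := by
  have h0 := sub_ne_zero.2 h
  have h0' : (starRingEnd ℂ) (w - c) ≠ 0 := (map_ne_zero _).2 h0
  have hs : (w - c) * (starRingEnd ℂ) (w - c) ∈ Complex.slitPlane := by
    rw [Complex.mul_conj, Complex.ofReal_mem_slitPlane]; exact Complex.normSq_pos.2 h0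
  have hd : HasDerivAt (fun ζ : ℂ => ζ ^ t) (t * ((w - c) * (starRingEnd ℂ) (w - c)) ^ (t - 1))
      ((w - c) * (starRingEnd ℂ) (w - c)) := by
    simpa using (hasDerivAt_id ((w - c) * (starRingEnd ℂ) (w - c))).cpow_const hs
  have key := HasWirtingerAt.comp_holomorphic
    (h := fun u => (u - c) * (starRingEnd ℂ) (u - c)) hd
    ((hasWirtingerAt_sub c w).mul (hasWirtingerAt_conj_sub c w))
  rw [Complex.cpow_sub _ _ (mul_ne_zero h0 h0'), Complex.cpow_one, ← absPow_eq_cpow h0] at key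
  unfold HasWirtingerAt at *
  refine HasFDerivAt.congr_of_eventuallyEq (f := fun u =>
    ((u - c) * (starRingEnd ℂ) (u - c)) ^ t) ?_ ?_
  · convert! key using 1
    congr 2
    · field_simp; ring
    · field_simp; ring
  · filter_upwards [isOpen_ne.mem_nhds h] with u hu
    exact absPow_eq_cpow (sub_ne_zero.2 hu) t

lemma hasWirtingerAt_prod {ι : Type*} (S : Finset ι) {f : ι → ℂ → ℂ} {α β : ι → ℂ} {w : ℂ}
    (h : ∀ l ∈ S, HasWirtingerAt (f l) (f l w * α l) (f l w * β l) w) :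
    HasWirtingerAt (fun u => ∏ l ∈ S, f l u) ((∏ l ∈ S, f l w) * ∑ l ∈ S, α l)
      ((∏ l ∈ S, f l w) * ∑ l ∈ S, β l) w := by
  classical
  induction S using Finset.induction_on with
  | empty =>
    unfold HasWirtingerAt
    simp only [Finset.prod_empty, Finset.sum_empty, mul_zero]
    convert! hasFDerivAt_const (𝕜 := ℝ) (1 : ℂ) w using 1
    ext
    simp
  | insert i S hi ih =>
    have h1 := (h i (Finset.mem_insert_self i S)).mul
      (ih fun j hj => h j (Finset.mem_insert_of_mem hj))
    simp only [Finset.prod_insert hi, Finset.sum_insert hi]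
    convert! h1 using 1 <;> ring

/-! ### The integral over one of the points -/

section onePoint

variable {ι : Type*} [Fintype ι] {y t : ι → ℂ}

/-- The Koba–Nielsen factor as a function of one of the points. -/
def knProd (y t : ι → ℂ) (w : ℂ) : ℂ := ∏ l, absPow (w - y l) (t l)

lemma continuous_knProd (ht : ∀ l, 0 < (t l).re) : Continuous (knProd y t) := by
  unfold knProd absPow
  refine continuous_finsetProd _ fun l _ => ?_
  have h : Continuous fun r : ℝ => (r : ℂ) ^ (2 * t l) :=
    Complex.continuous_ofReal_cpow_const (by simpa using ht l)
  exact h.comp (by fun_prop)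

lemma knProd_apply_eq_zero (ht : ∀ l, 0 < (t l).re) (l : ι) : knProd y t (y l) = 0 := by
  refine Finset.prod_eq_zero (Finset.mem_univ l) ?_
  unfold absPow
  have : t l ≠ 0 := fun e => by have := ht l; simp [e] at this
  simp [this]

lemma norm_knProd_le {δ : ℝ} (hδ : ∀ l, δ ≤ 2 * (t l).re) (ht : ∀ l, 0 < (t l).re)
    (hsum : 4 * ∑ l, (t l).re ≤ 1) {w : ℂ} (hw : ∀ l, w ≠ y l) :
    ‖knProd y t w‖ ≤ (∏ l, (1 + ‖y l‖) ^ (2 * (t l).re)) * (1 + ‖w‖) ^ (1 / 2 : ℝ)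
      * ∏ l, (min ‖w - y l‖ 1) ^ δ := by
  have b : ∀ l, ‖absPow (w - y l) (t l)‖ ≤
      (1 + ‖y l‖) ^ (2 * (t l).re) * (1 + ‖w‖) ^ (2 * (t l).re) * (min ‖w - y l‖ 1) ^ δ := by
    intro l
    rw [norm_absPow (sub_ne_zero.2 (hw l)), ← Real.mul_rpow (by positivity) (by positivity)]
    refine rpow_le_min (norm_pos_iff.2 (sub_ne_zero.2 (hw l))) ?_ ?_
      (abs_of_pos (ht l)).le (hδ l)
    · have := norm_sub_le w (y l)
      nlinarith [norm_nonneg w, norm_nonneg (y l), mul_nonneg (norm_nonneg w) (norm_nonneg (y l))]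
    · nlinarith [norm_nonneg w, norm_nonneg (y l), mul_nonneg (norm_nonneg w) (norm_nonneg (y l))]
  unfold knProd
  rw [norm_prod]
  refine (Finset.prod_le_prod (fun _ _ => norm_nonneg _) fun l _ => b l).trans ?_
  rw [Finset.prod_mul_distrib, Finset.prod_mul_distrib]
  have e : ∏ l, (1 + ‖w‖) ^ (2 * (t l).re) = (1 + ‖w‖) ^ (∑ l, 2 * (t l).re) := by
    rw [Real.rpow_sum_of_pos (by positivity)]
  rw [e]
  have hP : 0 ≤ ∏ l, (1 + ‖y l‖) ^ (2 * (t l).re) := Finset.prod_nonneg fun _ _ => by positivity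
  have hQ : 0 ≤ ∏ l, (min ‖w - y l‖ 1) ^ δ := Finset.prod_nonneg fun _ _ => by positivity
  gcongr
  · linarith [norm_nonneg w]
  · rw [← Finset.mul_sum]; linarith

lemma inv_mul_inv_le_inv_add {b c w : ℂ} (hbc : b ≠ c) (hb : w ≠ b) (hc : w ≠ c) :
    ‖w - c‖⁻¹ * ‖w - b‖⁻¹ ≤
      ((1 + ‖b‖) / ‖b - c‖ + 1) * ((1 + ‖w‖)⁻¹ * (‖w - c‖⁻¹ + ‖w - b‖⁻¹)) := by
  have p := norm_pos_iff.2 (sub_ne_zero.2 hb)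
  have q := norm_pos_iff.2 (sub_ne_zero.2 hc)
  have d := norm_pos_iff.2 (sub_ne_zero.2 hbc)
  have w0 : 0 < 1 + ‖w‖ := by positivity
  have h1 : ‖b - c‖ ≤ ‖w - c‖ + ‖w - b‖ := by
    have := norm_sub_le (w - c) (w - b)
    rwa [sub_sub_sub_cancel_left] at this
  have h2 : 1 + ‖w‖ ≤ ((1 + ‖b‖) / ‖b - c‖ + 1) * (‖w - c‖ + ‖w - b‖) := by
    have h3 : 1 + ‖b‖ ≤ (1 + ‖b‖) / ‖b - c‖ * (‖w - c‖ + ‖w - b‖) := by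
      rw [div_mul_eq_mul_div, le_div_iff₀ d]
      gcongr
    have h4 : ‖w‖ ≤ ‖w - b‖ + ‖b‖ := by simpa using norm_add_le (w - b) b
    nlinarith
  have e : ‖w - c‖⁻¹ + ‖w - b‖⁻¹ = (‖w - c‖ + ‖w - b‖) * (‖w - c‖⁻¹ * ‖w - b‖⁻¹) := by
    field_simp; ring
  rw [e]
  calc ‖w - c‖⁻¹ * ‖w - b‖⁻¹ = (1 + ‖w‖)⁻¹ * (1 + ‖w‖) * (‖w - c‖⁻¹ * ‖w - b‖⁻¹) := by
        rw [inv_mul_cancel₀ w0.ne', one_mul]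
    _ ≤ (1 + ‖w‖)⁻¹ * (((1 + ‖b‖) / ‖b - c‖ + 1) * (‖w - c‖ + ‖w - b‖))
        * (‖w - c‖⁻¹ * ‖w - b‖⁻¹) := by gcongr
    _ = _ := by ring

lemma integrable_stepKer {δ : ℝ} (hδ : 0 < δ) (hδ1 : δ ≤ 1) (hy1 : ∀ l, y l ≠ 1) :
    ∃ p : ℂ, Integrable (stepKer δ (1 / 2) (1 / 2) p y) := by
  classical
  obtain ⟨p, hp⟩ := Infinite.exists_notMem_finset (insert 1 (Finset.univ.image y))
  simp only [Finset.mem_insert, Finset.mem_image, Finset.mem_univ, true_and, not_or,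
    not_exists] at hp
  obtain ⟨M, hM⟩ := exists_lintegral_stepKer_le ι hδ hδ1 (η := 1 / 2) (by norm_num) le_rfl
    (κ := 1 / 2) (by norm_num) (norm_pos_iff.2 (sub_ne_zero.2 hp.1))
  refine ⟨p, (measurable_stepKer _ _ _ _ _).aestronglyMeasurable, ?_⟩
  rw [hasFiniteIntegral_iff_ofReal (ae_of_all _ fun x => stepKer_nonneg _ _ _ _ _ _)]
  exact (hM p y le_rfl hy1 hp.2).trans_lt ENNReal.ofReal_lt_top

/-- A function bounded by the Koba–Nielsen factor and three simple poles is integrable. -/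
lemma integrable_of_norm_le_poles {g : ℂ → ℂ} (hg : Measurable g) {C : ℝ} (hC : 0 ≤ C)
    (ht : ∀ l, 0 < (t l).re) (hsum : 4 * ∑ l, (t l).re ≤ 1) (hy1 : ∀ l, y l ≠ 1) {b : ℂ} {l₀ : ι}
    (hb : b = 1 ∨ ∃ l, b = y l) (hbl : b ≠ y l₀)
    (h : ∀ w, (∀ l, w ≠ y l) → w ≠ 1 → ‖g w‖ ≤ C * (‖knProd y t w‖ * (∑ l, ‖w - y l‖⁻¹)
      * (‖w - y l₀‖⁻¹ * ‖w - b‖⁻¹))) : Integrable g := by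
  obtain ⟨δ, hδt, hδ0, hδ1⟩ : ∃ δ : ℝ, (∀ l, δ ≤ 2 * (t l).re) ∧ 0 < δ ∧ δ ≤ 1 := by
    have e : ∀ᶠ δ in 𝓝[>] (0 : ℝ), ∀ l, δ ≤ 2 * (t l).re := by
      rw [Filter.eventually_all]; intro l
      filter_upwards [Ioc_mem_nhdsGT (show 0 < 2 * (t l).re by linarith [ht l])] with δ hδ
      exact hδ.2
    obtain ⟨δ, hδ, h0, h1⟩ := (e.and (Ioc_mem_nhdsGT (zero_lt_one (α := ℝ)))).exists
    exact ⟨δ, hδ, h0, h1⟩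
  obtain ⟨p, hp⟩ := integrable_stepKer hδ0 hδ1 hy1
  set C2 := ∏ l, (1 + ‖y l‖) ^ (2 * (t l).re) with hC2
  have hC20 : 0 ≤ C2 := Finset.prod_nonneg fun _ _ => by positivity
  set C3 := (1 + ‖b‖) / ‖b - y l₀‖ + 1 with hC3
  have hC30 : 0 ≤ C3 := by positivity
  refine (hp.const_mul (C * C2 * C3 * 2)).mono' hg.aestronglyMeasurable ?_
  have hae : ∀ᵐ w : ℂ, ∀ l, w ≠ y l := by
    rw [ae_all_iff]; intro l; exact Measure.ae_ne volume (y l)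
  filter_upwards [hae, Measure.ae_ne volume 1] with w hw hw1
  refine (h w hw hw1).trans ?_
  have hwb : w ≠ b := by
    rcases hb with rfl | ⟨l, rfl⟩
    · exact hw1
    · exact hw l
  set Sg := ∑ l, ‖w - y l‖⁻¹ with hSg
  have hle : ∀ l, ‖w - y l‖⁻¹ ≤ Sg := fun l =>
    Finset.single_le_sum (f := fun l => ‖w - y l‖⁻¹) (fun _ _ => by positivity) (Finset.mem_univ l)
  have hSg0 : 0 ≤ Sg := Finset.sum_nonneg fun _ _ => by positivity
  have hb' : ‖w - y l₀‖⁻¹ + ‖w - b‖⁻¹ ≤ 2 * (Sg + ‖w - 1‖⁻¹) := by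
    have h1 : 0 ≤ ‖w - 1‖⁻¹ := by positivity
    have h2 := hle l₀
    rcases hb with rfl | ⟨l, rfl⟩
    · linarith
    · linarith [hle l]
  have hK := norm_knProd_le hδt ht hsum hw
  have hP : 0 ≤ ∏ l, (min ‖w - y l‖ 1) ^ δ := Finset.prod_nonneg fun _ _ => by positivity
  have hs := one_le_sing₂ (η := 1 / 2) (p := p) hw1 (by norm_num)
  have w0 : 0 < 1 + ‖w‖ := by positivity
  have hpw : (1 + ‖w‖) ^ (1 / 2 : ℝ) * (1 + ‖w‖)⁻¹ = (1 + ‖w‖) ^ (-(1 / 2) : ℝ) := by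
    rw [← Real.rpow_neg_one (1 + ‖w‖), ← Real.rpow_add w0]; norm_num
  have hi := inv_mul_inv_le_inv_add hbl hwb (hw l₀)
  calc _ ≤ C * ((C2 * (1 + ‖w‖) ^ (1 / 2 : ℝ) * ∏ l, (min ‖w - y l‖ 1) ^ δ) * Sg
        * (C3 * ((1 + ‖w‖)⁻¹ * (2 * (Sg + ‖w - 1‖⁻¹))))) := by
        refine mul_le_mul_of_nonneg_left (mul_le_mul (mul_le_mul_of_nonneg_right hK hSg0)
          (hi.trans (by gcongr)) (by positivity) (by positivity)) hC
    _ = C * C2 * C3 * 2 * (Sg * (Sg + ‖w - 1‖⁻¹) * (∏ l, (min ‖w - y l‖ 1) ^ δ) * 1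
        * ((1 + ‖w‖) ^ (1 / 2 : ℝ) * (1 + ‖w‖)⁻¹)) := by ring
    _ ≤ C * C2 * C3 * 2 * stepKer δ (1 / 2) (1 / 2) p y w := by
        rw [hpw]
        unfold stepKer
        gcongr
        exact le_add_of_nonneg_right (by positivity)

lemma tendsto_knProd_div (ht : ∀ l, 0 < (t l).re) (hsum : 4 * ∑ l, (t l).re ≤ 1) (c : ℂ) :
    Tendsto (fun w => knProd y t w * ((starRingEnd ℂ) (w - c))⁻¹) (cocompact ℂ) (𝓝 0) := by
  set C2 := ∏ l, (1 + ‖y l‖) ^ (2 * (t l).re) with hC2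
  have hC20 : 0 ≤ C2 := Finset.prod_nonneg fun _ _ => by positivity
  have hn : Tendsto (fun w : ℂ => 1 + ‖w‖) (cocompact ℂ) atTop :=
    tendsto_atTop_add_const_left _ _ (tendsto_norm_cocompact_atTop (E := ℂ))
  have hlim : Tendsto (fun w : ℂ => C2 * 4 * (1 + ‖w‖) ^ (-(1 / 2) : ℝ)) (cocompact ℂ) (𝓝 0) := by
    simpa using ((tendsto_rpow_neg_atTop (by norm_num : (0 : ℝ) < 1 / 2)).comp hn).const_mul
      (C2 * 4)
  refine squeeze_zero_norm' ?_ hlim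
  have hbig : ∀ l, ∀ᶠ w in cocompact ℂ, w ≠ y l := fun l =>
    (isCompact_singleton (x := y l)).compl_mem_cocompact
  filter_upwards [Filter.eventually_all.2 hbig,
    (tendsto_norm_cocompact_atTop (E := ℂ)).eventually_ge_atTop (2 * ‖c‖ + 1)] with w hw hwc
  have hK := norm_knProd_le (δ := 0) (fun l => by linarith [ht l]) ht hsum hw
  simp only [Real.rpow_zero, Finset.prod_const_one, mul_one] at hK
  have w0 : 0 < 1 + ‖w‖ := by positivity
  have hd : (1 + ‖w‖) / 4 ≤ ‖w - c‖ := by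
    have := norm_sub_norm_le w c
    linarith
  have hd' : ‖w - c‖⁻¹ ≤ 4 * (1 + ‖w‖)⁻¹ := by
    calc ‖w - c‖⁻¹ ≤ ((1 + ‖w‖) / 4)⁻¹ := inv_anti₀ (by positivity) hd
      _ = _ := by rw [inv_div, div_eq_mul_inv]
  have hpw : (1 + ‖w‖) ^ (1 / 2 : ℝ) * (1 + ‖w‖)⁻¹ = (1 + ‖w‖) ^ (-(1 / 2) : ℝ) := by
    rw [← Real.rpow_neg_one (1 + ‖w‖), ← Real.rpow_add w0]; norm_num
  rw [norm_mul, norm_inv, RCLike.norm_conj]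
  calc _ ≤ C2 * (1 + ‖w‖) ^ (1 / 2 : ℝ) * (4 * (1 + ‖w‖)⁻¹) := by gcongr
    _ = C2 * 4 * ((1 + ‖w‖) ^ (1 / 2 : ℝ) * (1 + ‖w‖)⁻¹) := by ring
    _ = _ := by rw [hpw]

lemma measurable_knProd : Measurable (knProd y t) := by
  unfold knProd
  exact Finset.measurable_fun_prod _ fun l _ =>
    (measurable_absPow _).comp (measurable_id.sub_const _)

theorem integral_knProd (ht : ∀ l, 0 < (t l).re) (hsum : 4 * ∑ l, (t l).re ≤ 1)
    (hy1 : ∀ l, y l ≠ 1) {b : ℂ} {l₀ : ι} (hb : b = 1 ∨ ∃ l, b = y l) (hbl : b ≠ y l₀) :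
    ∫ w, knProd y t w * ((starRingEnd ℂ) (w - y l₀))⁻¹ * (∑ l, t l / (w - y l))
        / (starRingEnd ℂ) (w - b) =
      -(Real.pi : ℂ) * (knProd y t b * ((starRingEnd ℂ) (b - y l₀))⁻¹) := by
  have mc : Measurable fun z : ℂ => (starRingEnd ℂ) z := measurable_cbar
  have mk := measurable_knProd (y := y) (t := t)
  have m1 : Measurable fun w => knProd y t w * ((starRingEnd ℂ) (w - y l₀))⁻¹
      * (∑ l, t l / (w - y l)) :=
    (mk.mul (mc.comp (measurable_id.sub_const _)).inv).mul
      (Finset.measurable_fun_sum _ fun l _ => (measurable_id.sub_const _).const_div _)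
  have m2 : Measurable fun w => knProd y t w * ((starRingEnd ℂ) (w - y l₀))⁻¹
      * (∑ l, t l / (starRingEnd ℂ) (w - y l) - ((starRingEnd ℂ) (w - y l₀))⁻¹) :=
    (mk.mul (mc.comp (measurable_id.sub_const _)).inv).mul
      ((Finset.measurable_fun_sum _ fun l _ =>
        (mc.comp (measurable_id.sub_const _)).const_div _).sub
        (mc.comp (measurable_id.sub_const _)).inv)
  have hSg : ∀ w : ℂ, ∑ l, ‖t l‖ * ‖w - y l‖⁻¹ ≤ (∑ l, ‖t l‖) * ∑ l, ‖w - y l‖⁻¹ := by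
    intro w
    rw [Finset.sum_mul]
    refine Finset.sum_le_sum fun l _ => mul_le_mul_of_nonneg_left ?_ (norm_nonneg _)
    exact Finset.single_le_sum (f := fun l => ‖w - y l‖⁻¹) (fun _ _ => by positivity)
      (Finset.mem_univ l)
  have hT : 0 ≤ ∑ l, ‖t l‖ := Finset.sum_nonneg fun _ _ => norm_nonneg _
  refine cauchyPompeiu (E := Set.range y) (Set.finite_range y) b
    (h := fun w => knProd y t w * ((starRingEnd ℂ) (w - y l₀))⁻¹)
    (h₂ := fun w => knProd y t w * ((starRingEnd ℂ) (w - y l₀))⁻¹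
      * (∑ l, t l / (starRingEnd ℂ) (w - y l) - ((starRingEnd ℂ) (w - y l₀))⁻¹))
    ?_ ?_ (tendsto_knProd_div ht hsum _) m1 m2 ?_ ?_
  · intro w hw
    have hw' : ∀ l, w ≠ y l := fun l e => hw ⟨l, e.symm⟩
    have h1 := hasWirtingerAt_prod Finset.univ fun l _ => hasWirtingerAt_absPow (hw' l) (t l)
    have hne : (starRingEnd ℂ) (w - y l₀) ≠ 0 := (map_ne_zero _).2 (sub_ne_zero.2 (hw' l₀))
    have h2 := HasWirtingerAt.comp_holomorphic (h := fun u => (starRingEnd ℂ) (u - y l₀))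
      (hasDerivAt_inv hne) (hasWirtingerAt_conj_sub (y l₀) w)
    convert! h1.mul h2 using 1
    · unfold knProd; ring
    · unfold knProd; field_simp; ring
  · refine (continuous_knProd ht).continuousAt.mul (ContinuousAt.inv₀ ?_ ?_)
    · exact (Complex.continuous_conj.comp (continuous_id.sub continuous_const)).continuousAt
    · exact (map_ne_zero _).2 (sub_ne_zero.2 hbl)
  · refine integrable_of_norm_le_poles (m1.div (mc.comp (measurable_id.sub_const _))) hT ht hsum
      hy1 hb hbl fun w hw _ => ?_
    rw [norm_div, norm_mul, norm_mul, norm_inv, RCLike.norm_conj, RCLike.norm_conj]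
    have h1 : ‖∑ l, t l / (w - y l)‖ ≤ (∑ l, ‖t l‖) * ∑ l, ‖w - y l‖⁻¹ := by
      refine (norm_sum_le _ _).trans (le_trans (le_of_eq ?_) (hSg w))
      exact Finset.sum_congr rfl fun l _ => by rw [norm_div, div_eq_mul_inv]
    rw [div_eq_mul_inv]
    calc _ ≤ ‖knProd y t w‖ * ‖w - y l₀‖⁻¹ * ((∑ l, ‖t l‖) * ∑ l, ‖w - y l‖⁻¹) * ‖w - b‖⁻¹ := by
          gcongr
      _ = _ := by ring
  · refine integrable_of_norm_le_poles (C := ∑ l, ‖t l‖ + 1)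
      (m2.div (mc.comp (measurable_id.sub_const _))) (by linarith) ht hsum
      hy1 hb hbl fun w hw _ => ?_
    rw [norm_div, norm_mul, norm_mul, norm_inv, RCLike.norm_conj, RCLike.norm_conj]
    have h1 : ‖∑ l, t l / (starRingEnd ℂ) (w - y l) - ((starRingEnd ℂ) (w - y l₀))⁻¹‖ ≤
        (∑ l, ‖t l‖ + 1) * ∑ l, ‖w - y l‖⁻¹ := by
      rw [add_mul, one_mul]
      refine (norm_sub_le _ _).trans (add_le_add ?_ ?_)
      · refine (norm_sum_le _ _).trans (le_trans (le_of_eq ?_) (hSg w))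
        exact Finset.sum_congr rfl fun l _ => by rw [norm_div, div_eq_mul_inv, RCLike.norm_conj]
      · rw [norm_inv, RCLike.norm_conj]
        exact Finset.single_le_sum (f := fun l => ‖w - y l‖⁻¹) (fun _ _ => by positivity)
          (Finset.mem_univ l₀)
    rw [div_eq_mul_inv]
    calc _ ≤ ‖knProd y t w‖ * ‖w - y l₀‖⁻¹ * ((∑ l, ‖t l‖ + 1) * ∑ l, ‖w - y l‖⁻¹)
          * ‖w - b‖⁻¹ := by gcongr
      _ = _ := by ring

end onePoint

end

noncomputable section

/-! ### Splitting off one of the integrals -/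

/-- Insert one more coordinate. -/
def splice {κ ι : Type*} (e : Option κ ≃ ι) : (κ → ℂ) × ℂ ≃ᵐ (ι → ℂ) :=
  (MeasurableEquiv.piOptionEquivProd fun _ => ℂ).symm.trans
    (MeasurableEquiv.piCongrLeft (fun _ => ℂ) e)

lemma splice_some {κ ι : Type*} (e : Option κ ≃ ι) (q : (κ → ℂ) × ℂ) (k : κ) :
    splice e q (e (some k)) = q.1 k := by
  unfold splice
  rw [MeasurableEquiv.trans_apply, MeasurableEquiv.coe_piCongrLeft, Equiv.piCongrLeft_apply_apply]
  rfl

lemma splice_none {κ ι : Type*} (e : Option κ ≃ ι) (q : (κ → ℂ) × ℂ) :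
    splice e q (e none) = q.2 := by
  unfold splice
  rw [MeasurableEquiv.trans_apply, MeasurableEquiv.coe_piCongrLeft, Equiv.piCongrLeft_apply_apply]
  rfl

lemma measurePreserving_splice {κ ι : Type*} [Fintype κ] [Fintype ι] (e : Option κ ≃ ι) :
    MeasurePreserving (splice e) (volume.prod volume) volume := by
  have h1 : MeasurePreserving (MeasurableEquiv.piOptionEquivProd fun _ : Option κ => ℂ).symm
      (volume.prod volume) volume :=
    ⟨MeasurableEquiv.measurable _, Measure.pi_map_piOptionEquivProd fun _ : Option κ => volume⟩
  exact (volume_measurePreserving_piCongrLeft (fun _ : ι => ℂ) e).comp h1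

lemma integral_eq_integral_splice {κ ι : Type*} [Fintype κ] [Fintype ι] (e : Option κ ≃ ι)
    {f : (ι → ℂ) → ℂ} (hf : Integrable f) {g : (κ → ℂ) → ℂ} {c : ℂ}
    (h : ∀ᵐ x : κ → ℂ, ∫ w : ℂ, f (splice e (x, w)) = c * g x) :
    ∫ x, f x = c * ∫ x, g x := by
  have hi : Integrable (fun q => f (splice e q)) (volume.prod volume) :=
    (measurePreserving_splice e).integrable_comp_emb (splice e).measurableEmbedding |>.2 hf
  rw [← (measurePreserving_splice e).integral_comp (splice e).measurableEmbedding f,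
    integral_prod _ hi, integral_congr_ae h, integral_const_mul]

lemma integrable_of_integral_splice {κ ι : Type*} [Fintype κ] [Fintype ι] (e : Option κ ≃ ι)
    {f : (ι → ℂ) → ℂ} (hf : Integrable f) {g : (κ → ℂ) → ℂ} {c : ℂ} (hc : c ≠ 0)
    (h : ∀ᵐ x : κ → ℂ, ∫ w : ℂ, f (splice e (x, w)) = c * g x) : Integrable g := by
  have hi : Integrable (fun q => f (splice e q)) (volume.prod volume) :=
    (measurePreserving_splice e).integrable_comp_emb (splice e).measurableEmbedding |>.2 hf
  have h1 := (hi.integral_prod_left.congr h).const_mul c⁻¹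
  refine h1.congr (ae_of_all _ fun x => ?_)
  simp only
  rw [← mul_assoc, inv_mul_cancel₀ hc, one_mul]

/-! ### The dependence of the integrand on one of the points -/

/-- Split off one label from a product over pairs. -/
lemma prod_pairs_insert {M : Type*} [CommMonoid M] {S : Finset ℕ} {m : ℕ} (hm : m ∉ S)
    (g : ℕ → ℕ → M) (hg : ∀ k l, g k l = g l k) :
    ∏ k ∈ insert m S, ∏ l ∈ insert m S with k < l, g k l =
      (∏ l ∈ S, g m l) * ∏ k ∈ S, ∏ l ∈ S with k < l, g k l := by
  have hne : ∀ k ∈ S, k ≠ m := fun k hk e => hm (e ▸ hk)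
  rw [prod_pairs_rank (insert m S) (fun k => if k = m then 0 else k + 1) _ g hg,
    Finset.prod_insert hm]
  · congr 1
    · refine Finset.prod_congr ?_ fun _ _ => rfl
      ext l
      simp only [Finset.mem_filter, Finset.mem_insert, if_true]
      constructor
      · rintro ⟨rfl | h, h2⟩
        · simp at h2
        · exact h
      · intro h
        exact ⟨Or.inr h, by rw [if_neg (hne l h)]; omega⟩
    · refine Finset.prod_congr rfl fun k hk => Finset.prod_congr ?_ fun _ _ => rfl
      ext l
      simp only [Finset.mem_filter, Finset.mem_insert, if_neg (hne k hk)]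
      constructor
      · rintro ⟨rfl | h, h2⟩
        · simp at h2
        · rw [if_neg (hne l h)] at h2; exact ⟨h, by omega⟩
      · rintro ⟨h, h2⟩
        exact ⟨Or.inr h, by rw [if_neg (hne l h)]; omega⟩
  · intro k _ l _ h
    simp only at h
    split_ifs at h <;> omega

variable {L : ℕ} {s : Mandelstam L} {a : CompIdx L}

/-- The labels `1` and `4, …, L`, without `m`. -/
def otherLabels (L m : ℕ) : Finset ℕ := insert 1 ((Finset.Icc 4 L).erase m)

/-- The factors of the integrand of the component `(4, σ)` that do not depend on `w_m`,
where `m = σ(4)`. -/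
def restProd (L : ℕ) (s : Mandelstam L) (σ : LabelPerm L) (W : ℕ → ℂ) : ℂ :=
  (∏ k ∈ otherLabels L (σ.act 4), ∏ l ∈ otherLabels L (σ.act 4) with k < l,
      absPow (W k - W l) (mand s k l))
    * (∏ k ∈ Finset.Icc 5 L, (mand s 1 (σ.act k) / W (σ.act k)
      + ∑ j ∈ Finset.Ioc k L, mand s (σ.act k) (σ.act j) / (W (σ.act k) - W (σ.act j))))
    * ∏ k ∈ ((Finset.Icc 4 (L + 1)).erase (σ.act 4)).erase (σ.act 4 + 1),
      1 / (cbar (W k) - cbar (W (k - 1)))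

lemma pairProd_physical (hL : 4 ≤ L) (hs : IsPhysical s) (W : ℕ → ℂ) :
    pairProd L (killLabel 2 s) W =
      ∏ k ∈ insert 1 (Finset.Icc 4 L), ∏ l ∈ insert 1 (Finset.Icc 4 L) with k < l,
        absPow (W k - W l) (mand s k l) := by
  have h2 : ∀ v k, absPow v (mand (killLabel 2 s) 2 k) = 1 := fun v k => by simp [mand_killLabel]
  have h2' : ∀ v, absPow v (mand (killLabel 2 s) 1 2) = 1 := fun v => by simp [mand_killLabel]
  have h3 : ∀ k, mand s 3 k = 0 := fun k => by
    by_cases hk : k ∈ Finset.Icc 1 L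
    · exact hs k hk
    · unfold mand; rw [dif_neg fun h => hk h.2]
  have h3' : ∀ v k, absPow v (mand (killLabel 2 s) 3 k) = 1 := fun v k => by
    rw [mand_killLabel, h3]; simp
  have h13 : ∀ v, absPow v (mand (killLabel 2 s) 1 3) = 1 := fun v => by
    rw [mand_comm]; exact h3' v 1
  unfold pairProd
  rw [prod_pairs_split hL, prod_pairs_insert (by simp)
    (fun k l => absPow (W k - W l) (mand s k l))
    (fun k l => by rw [absPow_sub_comm, mand_comm])]
  simp only [h2, h2', h3', h13, Finset.prod_const_one, one_mul, mul_one]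
  congr 1
  · refine Finset.prod_congr rfl fun k hk => ?_
    have := Finset.mem_Icc.1 hk
    rw [mand_killLabel, if_neg (by omega)]
  · refine Finset.prod_congr rfl fun k hk => Finset.prod_congr rfl fun l hl => ?_
    have h1 := Finset.mem_Icc.1 hk
    have h2 := Finset.mem_Icc.1 (Finset.mem_filter.1 hl).1
    rw [mand_killLabel, if_neg (by omega)]

lemma bracketProd_four (hL : 4 ≤ L) (ha : (a.1 : ℕ) = 4) {W : ℕ → ℂ} (h1 : W 1 = 0) :
    bracketProd L s a W =
      (∑ l ∈ otherLabels L (a.2.act 4), mand s (a.2.act 4) l / (W (a.2.act 4) - W l))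
      * ∏ k ∈ Finset.Icc 5 L, (mand s 1 (a.2.act k) / W (a.2.act k)
      + ∑ j ∈ Finset.Ioc k L,
        mand s (a.2.act k) (a.2.act j) / (W (a.2.act k) - W (a.2.act j))) := by
  have e : Finset.Icc 4 L = insert 4 (Finset.Icc 5 L) := by
    ext k; simp only [Finset.mem_insert, Finset.mem_Icc]; omega
  have e' : Finset.Ioc 4 L = Finset.Icc 5 L := by
    ext k; simp only [Finset.mem_Icc, Finset.mem_Ioc]; omega
  have hm : a.2.act 4 ∈ Finset.Icc 4 L := (a.2.act_mem_iff 4).2 (Finset.mem_Icc.2 ⟨le_rfl, hL⟩)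
  unfold bracketProd otherLabels
  rw [ha, e, Finset.prod_insert (by simp), ← e, Finset.Ico_self, Finset.prod_empty, mul_one,
    Finset.sum_insert (by simp), h1, sub_zero, mand_comm s 1]
  congr 2
  set f : ℕ → ℂ := fun j => mand s (a.2.act 4) j / (W (a.2.act 4) - W j) with hf
  have h2 : ∑ j ∈ Finset.Icc 4 L, f (a.2.act j) = ∑ j ∈ Finset.Icc 4 L, f j := a.2.sum_act f
  rw [← Finset.add_sum_erase _ f hm] at h2
  conv_lhs at h2 => rw [e, Finset.sum_insert (by simp)]
  rw [e']
  exact add_left_cancel h2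

lemma antiProd_eq_neg {W : ℕ → ℂ} (hL : 4 ≤ L) (h : W (L + 1) = 0) :
    antiProd L W = -∏ k ∈ Finset.Icc 4 (L + 1), 1 / (cbar (W k) - cbar (W (k - 1))) := by
  have e : Finset.Icc 4 (L + 1) = insert (L + 1) (Finset.Icc 4 L) := by
    ext k; simp only [Finset.mem_insert, Finset.mem_Icc]; omega
  unfold antiProd
  rw [e, Finset.prod_insert (by simp), h, Nat.add_sub_cancel]
  simp [cbar, div_neg]

lemma antiProd_split {W : ℕ → ℂ} (h : W (L + 1) = 0) {m : ℕ} (hm : m ∈ Finset.Icc 4 L) :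
    antiProd L W = ((starRingEnd ℂ) (W m - W (m + 1)))⁻¹ / (starRingEnd ℂ) (W m - W (m - 1))
      * ∏ k ∈ ((Finset.Icc 4 (L + 1)).erase m).erase (m + 1),
        1 / (cbar (W k) - cbar (W (k - 1))) := by
  have hm' := Finset.mem_Icc.1 hm
  have h1 : m ∈ Finset.Icc 4 (L + 1) := Finset.mem_Icc.2 ⟨hm'.1, by omega⟩
  have h2 : m + 1 ∈ (Finset.Icc 4 (L + 1)).erase m :=
    Finset.mem_erase.2 ⟨by omega, Finset.mem_Icc.2 ⟨by omega, by omega⟩⟩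
  rw [antiProd_eq_neg (by omega) h, ← Finset.mul_prod_erase _ _ h1, ← Finset.mul_prod_erase _ _ h2,
    Nat.add_sub_cancel]
  have e : cbar (W (m + 1)) - cbar (W m) = -(starRingEnd ℂ) (W m - W (m + 1)) := by
    rw [map_sub, neg_sub]; rfl
  have e' : cbar (W m) - cbar (W (m - 1)) = (starRingEnd ℂ) (W m - W (m - 1)) := by
    rw [map_sub]; rfl
  rw [e, e', div_neg, one_div, one_div, div_eq_mul_inv]
  ring

/-- The integrand as a function of `w_m`, where `m = σ(4)`. -/
lemma coreIntegrand_four (hL : 4 ≤ L) (hs : IsPhysical s) (ha : (a.1 : ℕ) = 4) {W : ℕ → ℂ}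
    (h1 : W 1 = 0) (hL1 : W (L + 1) = 0) :
    coreIntegrand L s a W = restProd L s a.2 W *
      (knProd (fun l : otherLabels L (a.2.act 4) => W l)
          (fun l => mand s (a.2.act 4) l) (W (a.2.act 4))
        * ((starRingEnd ℂ) (W (a.2.act 4) - W (a.2.act 4 + 1)))⁻¹
        * (∑ l : otherLabels L (a.2.act 4), mand s (a.2.act 4) l / (W (a.2.act 4) - W l))
        / (starRingEnd ℂ) (W (a.2.act 4) - W (a.2.act 4 - 1))) := by
  have hm : a.2.act 4 ∈ Finset.Icc 4 L := (a.2.act_mem_iff 4).2 (Finset.mem_Icc.2 ⟨le_rfl, hL⟩)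
  have hm' := Finset.mem_Icc.1 hm
  have e : insert 1 (Finset.Icc 4 L) = insert (a.2.act 4) (otherLabels L (a.2.act 4)) := by
    unfold otherLabels
    rw [Finset.insert_comm, Finset.insert_erase hm]
  unfold coreIntegrand
  rw [pairProd_physical hL hs, e, prod_pairs_insert
    (by simp only [otherLabels, Finset.mem_insert, Finset.mem_erase]; omega)
    (fun k l => absPow (W k - W l) (mand s k l)) (fun k l => by rw [absPow_sub_comm, mand_comm]),
    bracketProd_four hL ha h1, antiProd_split hL1 hm]
  unfold restProd knProd
  rw [← Finset.sum_coe_sort (otherLabels L (a.2.act 4)),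
    ← Finset.prod_coe_sort (otherLabels L (a.2.act 4)) (fun l =>
      absPow (W (a.2.act 4) - W l) (mand s (a.2.act 4) l))]
  ring

lemma restProd_update (σ : LabelPerm L) (W : ℕ → ℂ) (w : ℂ) :
    restProd L s σ (Function.update W (σ.act 4) w) = restProd L s σ W := by
  have hs : ∀ k, k ≠ σ.act 4 → Function.update W (σ.act 4) w k = W k := fun k hk =>
    Function.update_of_ne hk _ _
  have h1 : ∀ k ∈ otherLabels L (σ.act 4), k ≠ σ.act 4 := by
    intro k hk
    rcases Finset.mem_insert.1 hk with rfl | hk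
    · intro e
      have h4 : σ.act 1 = 1 := σ.act_of_notMem (by simp)
      rw [← h4] at e
      exact absurd (σ.act.injective e) (by norm_num)
    · exact (Finset.mem_erase.1 hk).1
  have h2 : ∀ k, 5 ≤ k → σ.act k ≠ σ.act 4 := fun k hk e => by
    have := σ.act.injective e; omega
  unfold restProd
  congr 1
  · congr 1
    · refine Finset.prod_congr rfl fun k hk => Finset.prod_congr rfl fun l hl => ?_
      rw [hs k (h1 k hk), hs l (h1 l (Finset.mem_filter.1 hl).1)]
    · refine Finset.prod_congr rfl fun k hk => ?_
      have h5 := (Finset.mem_Icc.1 hk).1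
      rw [hs _ (h2 k h5)]
      congr 1
      refine Finset.sum_congr rfl fun j hj => ?_
      have := (Finset.mem_Ioc.1 hj).1
      rw [hs _ (h2 j (by omega))]
  · refine Finset.prod_congr rfl fun k hk => ?_
    rw [Finset.mem_erase, Finset.mem_erase, Finset.mem_Icc] at hk
    rw [hs k hk.2.1, hs (k - 1) (by omega)]

/-- Admissible positions of the points other than `w_m`. -/
structure GenericOff (L m : ℕ) (W : ℕ → ℂ) : Prop where
  one : W 1 = 0
  three : W 3 = 1
  last : W (L + 1) = 0
  ne_zero : ∀ k ∈ (Finset.Icc 4 L).erase m, W k ≠ 0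
  ne_one : ∀ k ∈ (Finset.Icc 4 L).erase m, W k ≠ 1
  ne : ∀ k ∈ (Finset.Icc 4 L).erase m, ∀ l ∈ (Finset.Icc 4 L).erase m, k ≠ l → W k ≠ W l

lemma SmallFor.integral_coreIntegrand_update {ε : ℝ} (h : SmallFor L ε) (hs : s ∈ convRegion L ε)
    (hp : IsPhysical s) (ha : (a.1 : ℕ) = 4) {W : ℕ → ℂ} (hW : GenericOff L (a.2.act 4) W) :
    ∫ w, coreIntegrand L s a (Function.update W (a.2.act 4) w) =
      -(Real.pi : ℂ) * (restProd L s a.2 W *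
        (knProd (fun l : otherLabels L (a.2.act 4) => W l)
          (fun l => mand s (a.2.act 4) l) (W (a.2.act 4 - 1))
        * ((starRingEnd ℂ) (W (a.2.act 4 - 1) - W (a.2.act 4 + 1)))⁻¹)) := by
  have hL := h.four_le
  have hm : a.2.act 4 ∈ Finset.Icc 4 L := (a.2.act_mem_iff 4).2 (Finset.mem_Icc.2 ⟨le_rfl, hL⟩)
  set m := a.2.act 4 with hmdef
  have hm' := Finset.mem_Icc.1 hm
  have hup : ∀ w k, k ≠ m → Function.update W m w k = W k := fun w k hk =>
    Function.update_of_ne hk _ _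
  have hne : ∀ l ∈ otherLabels L m, l ≠ m := by
    intro l hl
    rcases Finset.mem_insert.1 hl with rfl | hl
    · omega
    · exact (Finset.mem_erase.1 hl).1
  have hcore : ∀ w, coreIntegrand L s a (Function.update W m w) = restProd L s a.2 W *
      (knProd (fun l : otherLabels L m => W l) (fun l => mand s m l) w
        * ((starRingEnd ℂ) (w - W (m + 1)))⁻¹
        * (∑ l : otherLabels L m, mand s m l / (w - W l)) / (starRingEnd ℂ) (w - W (m - 1))) := by
    intro w
    rw [coreIntegrand_four hL hp ha (by rw [hup w 1 (by omega)]; exact hW.one)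
      (by rw [hup w _ (by omega)]; exact hW.last), ← hmdef, hmdef, restProd_update, ← hmdef,
      Function.update_self, hup w (m + 1) (by omega), hup w (m - 1) (by omega)]
    have e : ∀ l : otherLabels L m, Function.update W m w l = W l := fun l => hup w l (hne l l.2)
    simp only [e]
  simp only [hcore]
  rw [integral_const_mul]
  obtain ⟨l₀, hl₀, e₀⟩ : ∃ l₀ ∈ otherLabels L m, W l₀ = W (m + 1) := by
    rcases Nat.lt_or_ge m L with h' | h'
    · exact ⟨m + 1, Finset.mem_insert_of_mem (Finset.mem_erase.2
        ⟨by omega, Finset.mem_Icc.2 ⟨by omega, by omega⟩⟩), rfl⟩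
    · refine ⟨1, Finset.mem_insert_self _ _, ?_⟩
      rw [hW.one, show m = L by omega, hW.last]
  have hsub : otherLabels L m ⊆ insert 1 (Finset.Icc 4 L) :=
    Finset.insert_subset_insert _ (Finset.erase_subset _ _)
  have ht : ∀ l : otherLabels L m, 0 < (mand s m l).re := fun l =>
    hs.2 m (Finset.mem_insert_of_mem hm) l (hsub l.2) (hne l l.2).symm
  have hnorm : ‖s‖ ≤ ε := (mem_ball_zero_iff.1 hs.1).le
  have hsum : 4 * ∑ l : otherLabels L m, (mand s m l).re ≤ 1 := by
    have h1 : ∑ l : otherLabels L m, (mand s m l).re ≤ ∑ l : otherLabels L m, ε :=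
      Finset.sum_le_sum fun l _ => (Complex.re_le_norm _).trans ((norm_mand_le s m l).trans hnorm)
    have hc : (otherLabels L m).card ≤ L := by
      refine (Finset.card_insert_le _ _).trans ?_
      rw [Finset.card_erase_of_mem hm, Nat.card_Icc]; omega
    rw [Finset.sum_const, Finset.card_univ, Fintype.card_coe, nsmul_eq_mul] at h1
    have h2 : ((otherLabels L m).card : ℝ) * ε ≤ L * ε :=
      mul_le_mul_of_nonneg_right (by exact_mod_cast hc) h.pos.le
    have h3 : (4 : ℝ) ≤ L := by exact_mod_cast hL
    have h4 : 4 * (L * ε) ≤ L * (L * ε) :=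
      mul_le_mul_of_nonneg_right h3 (mul_nonneg (by linarith) h.pos.le)
    nlinarith [h.small, mul_nonneg (by linarith : (0 : ℝ) ≤ L) h.pos.le]
  have hy1 : ∀ l : otherLabels L m, W l ≠ 1 := by
    rintro ⟨l, hl⟩
    rcases Finset.mem_insert.1 hl with rfl | hl'
    · simp only; rw [hW.one]; exact zero_ne_one
    · exact hW.ne_one l hl'
  have hb : W (m - 1) = 1 ∨ ∃ l : otherLabels L m, W (m - 1) = W l := by
    rcases eq_or_ne m 4 with h4 | h4
    · left; rw [h4]; exact hW.three
    · right
      exact ⟨⟨m - 1, Finset.mem_insert_of_mem (Finset.mem_erase.2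
        ⟨by omega, Finset.mem_Icc.2 ⟨by omega, by omega⟩⟩)⟩, rfl⟩
  have hbl : W (m - 1) ≠ W (m + 1) := by
    rcases eq_or_ne m 4 with h4 | h4
    · have e3 : W (m - 1) = 1 := by rw [h4]; exact hW.three
      rw [e3, ← e₀]
      exact (hy1 ⟨l₀, hl₀⟩).symm
    · have k1 : m - 1 ∈ (Finset.Icc 4 L).erase m := Finset.mem_erase.2
        ⟨by omega, Finset.mem_Icc.2 ⟨by omega, by omega⟩⟩
      rcases Nat.lt_or_ge m L with h' | h'
      · exact hW.ne _ k1 _ (Finset.mem_erase.2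
          ⟨by omega, Finset.mem_Icc.2 ⟨by omega, by omega⟩⟩) (by omega)
      · rw [show m + 1 = L + 1 by omega, hW.last]; exact hW.ne_zero _ k1
  have key := integral_knProd (y := fun l : otherLabels L m => W l)
    (t := fun l : otherLabels L m => mand s m l) ht hsum hy1 (b := W (m - 1)) (l₀ := ⟨l₀, hl₀⟩) hb
    (by simp only; rw [e₀]; exact hbl)
  simp only [e₀] at key
  rw [key]; ring

lemma SmallFor.integral_coreIntegrand_update_eq_zero {ε : ℝ} (h : SmallFor L ε)
    (hs : s ∈ convRegion L ε) (hp : IsPhysical s) (ha : (a.1 : ℕ) = 4) {W : ℕ → ℂ}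
    (hW : GenericOff L (a.2.act 4) W) (h4 : a.2.act 4 ≠ 4) :
    ∫ w, coreIntegrand L s a (Function.update W (a.2.act 4) w) = 0 := by
  have hL := h.four_le
  have hm : a.2.act 4 ∈ Finset.Icc 4 L := (a.2.act_mem_iff 4).2 (Finset.mem_Icc.2 ⟨le_rfl, hL⟩)
  have hm' := Finset.mem_Icc.1 hm
  rw [h.integral_coreIntegrand_update hs hp ha hW]
  have hk : a.2.act 4 - 1 ∈ otherLabels L (a.2.act 4) :=
    Finset.mem_insert_of_mem (Finset.mem_erase.2
      ⟨by omega, Finset.mem_Icc.2 ⟨by omega, by omega⟩⟩)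
  have hsub : otherLabels L (a.2.act 4) ⊆ insert 1 (Finset.Icc 4 L) :=
    Finset.insert_subset_insert _ (Finset.erase_subset _ _)
  have ht : ∀ l : otherLabels L (a.2.act 4), 0 < (mand s (a.2.act 4) l).re := fun l => by
    refine hs.2 _ (Finset.mem_insert_of_mem hm) l (hsub l.2) ?_
    rintro e
    rcases Finset.mem_insert.1 l.2 with h1 | h1
    · omega
    · exact (Finset.mem_erase.1 h1).1 e.symm
  have := knProd_apply_eq_zero (y := fun l : otherLabels L (a.2.act 4) => W l) ht ⟨_, hk⟩
  simp only at this
  rw [this]; ring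

end

noncomputable section

/-! ### The physical limit -/

variable {L : ℕ} {s : Mandelstam L} {a : CompIdx L} {ε : ℝ}

lemma closedStringIntegrand_eq (hL : 4 ≤ L) (σ : LabelPerm L) (h4 : σ.act 4 = 4) {W : ℕ → ℂ}
    (h1 : W 1 = 0) (h3 : W 3 = 1) (hL1 : W (L + 1) = 0) {x : Finset.Icc 5 L → ℂ}
    (hW : ∀ k (hk : k ∈ Finset.Icc 5 L), W k = x ⟨k, hk⟩) :
    closedStringIntegrand L s σ x = (restProd L s σ W *
        (knProd (fun l : otherLabels L (σ.act 4) => W l)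
          (fun l => mand s (σ.act 4) l) (W (σ.act 4 - 1))
        * ((starRingEnd ℂ) (W (σ.act 4 - 1) - W (σ.act 4 + 1)))⁻¹)) := by
  set V : ℕ → ℂ := Function.update W 4 1 with hV
  have V4 : V 4 = 1 := Function.update_self _ _ _
  have Vne : ∀ k, k ≠ 4 → V k = W k := fun k hk => Function.update_of_ne hk _ _
  have hpos : ∀ k ∈ Finset.Icc 4 L, position' x k = V k := by
    intro k hk
    have := Finset.mem_Icc.1 hk
    unfold position'
    split_ifs with h5 h6
    · rw [Vne k (by have := Finset.mem_Icc.1 h5; omega), hW k h5]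
    · rw [h6, V4]
    · exact absurd (Finset.mem_Icc.2 ⟨by omega, this.2⟩) h5
  have h5 : ∀ k ∈ Finset.Icc 5 L, position' x k = W k := by
    intro k hk
    have := Finset.mem_Icc.1 hk
    rw [hpos k (Finset.mem_Icc.2 ⟨by omega, this.2⟩), Vne k (by omega)]
  have hσ : ∀ k ∈ Finset.Icc 5 L, σ.act k ∈ Finset.Icc 5 L := by
    intro k hk
    have h6 := Finset.mem_Icc.1 hk
    have h7 := Finset.mem_Icc.1 ((σ.act_mem_iff k).2 (Finset.mem_Icc.2 ⟨by omega, h6.2⟩))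
    refine Finset.mem_Icc.2 ⟨?_, h7.2⟩
    rcases Nat.lt_or_ge 4 (σ.act k) with h8 | h8
    · exact h8
    · have : σ.act k = σ.act 4 := by rw [h4]; omega
      have := σ.act.injective this
      omega
  have eother : otherLabels L 4 = insert 1 (Finset.Icc 5 L) := by
    unfold otherLabels
    congr 1
    ext k; simp only [Finset.mem_erase, Finset.mem_Icc]; omega
  have eIcc : Finset.Icc 4 (L + 1) = insert 4 (insert 5 (Finset.Icc 6 (L + 1))) := by
    ext k; simp only [Finset.mem_insert, Finset.mem_Icc]; omega
  have eIcc' : ((Finset.Icc 4 (L + 1)).erase 4).erase 5 = Finset.Icc 6 (L + 1) := by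
    ext k; simp only [Finset.mem_erase, Finset.mem_Icc]; omega
  -- the antiholomorphic factor
  have hanti : 1 / cbar (V L) * ∏ k ∈ Finset.Icc 5 L, 1 / (cbar (V k) - cbar (V (k - 1))) =
      ((starRingEnd ℂ) (1 - W 5))⁻¹
        * ∏ k ∈ Finset.Icc 6 (L + 1), 1 / (cbar (W k) - cbar (W (k - 1))) := by
    have e1 : Finset.Icc 5 (L + 1) = insert (L + 1) (Finset.Icc 5 L) := by
      ext k; simp only [Finset.mem_insert, Finset.mem_Icc]; omega
    have e2 : Finset.Icc 5 (L + 1) = insert 5 (Finset.Icc 6 (L + 1)) := by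
      ext k; simp only [Finset.mem_insert, Finset.mem_Icc]; omega
    have p1 : ∏ k ∈ Finset.Icc 5 (L + 1), 1 / (cbar (V k) - cbar (V (k - 1))) =
        -(1 / cbar (V L) * ∏ k ∈ Finset.Icc 5 L, 1 / (cbar (V k) - cbar (V (k - 1)))) := by
      rw [e1, Finset.prod_insert (by simp), Nat.add_sub_cancel, Vne (L + 1) (by omega), hL1]
      simp [cbar, div_neg]
    have p2 : ∏ k ∈ Finset.Icc 5 (L + 1), 1 / (cbar (V k) - cbar (V (k - 1))) =
        -(((starRingEnd ℂ) (1 - W 5))⁻¹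
          * ∏ k ∈ Finset.Icc 6 (L + 1), 1 / (cbar (W k) - cbar (W (k - 1)))) := by
      rw [e2, Finset.prod_insert (by simp), show 5 - 1 = 4 from rfl, V4, Vne 5 (by norm_num)]
      have : 1 / (cbar (W 5) - cbar 1) = -((starRingEnd ℂ) (1 - W 5))⁻¹ := by
        rw [one_div, ← inv_neg, map_sub, neg_sub]; rfl
      rw [this, neg_mul]
      congr 2
      refine Finset.prod_congr rfl fun k hk => ?_
      have := Finset.mem_Icc.1 hk
      rw [Vne k (by omega), Vne (k - 1) (by omega)]
    rw [← neg_inj, ← p1, p2]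
  have hkn : knProd (fun l : otherLabels L 4 => W l)
      (fun l => mand s 4 l) 1 = ∏ k ∈ Finset.Icc 5 L, absPow (1 - W k) (mand s 4 k) := by
    unfold knProd
    rw [Finset.prod_coe_sort (otherLabels L 4) fun l => absPow (1 - W l) (mand s 4 l), eother,
      Finset.prod_insert (by simp), h1]
    simp [absPow]
  have hpair : ∏ k ∈ insert 1 (Finset.Icc 5 L), ∏ l ∈ insert 1 (Finset.Icc 5 L) with k < l,
      absPow (W k - W l) (mand s k l) = (∏ l ∈ Finset.Icc 5 L, absPow (W l) (mand s 1 l))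
        * ∏ i ∈ Finset.Icc 5 L, ∏ j ∈ Finset.Ioc i L,
          absPow (position' x i - position' x j) (mand s i j) := by
    rw [prod_pairs_insert (by simp) (fun k l => absPow (W k - W l) (mand s k l))
      (fun k l => by rw [absPow_sub_comm, mand_comm]), h1]
    congr 1
    · simp [absPow]
    · refine Finset.prod_congr rfl fun k hk => ?_
      have hk' := Finset.mem_Icc.1 hk
      refine Finset.prod_congr ?_ fun l hl => ?_
      · ext l; simp only [Finset.mem_filter, Finset.mem_Icc, Finset.mem_Ioc]; omega
      · have hl' := Finset.mem_Ioc.1 hl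
        rw [h5 k hk, h5 l (Finset.mem_Icc.2 ⟨by omega, hl'.2⟩)]
  have hbr : ∀ k ∈ Finset.Icc 5 L, mand s 1 (σ.act k) / position' x (σ.act k)
      + ∑ j ∈ Finset.Ioc k L, mand s (σ.act k) (σ.act j)
        / (position' x (σ.act k) - position' x (σ.act j)) = mand s 1 (σ.act k) / W (σ.act k)
      + ∑ j ∈ Finset.Ioc k L, mand s (σ.act k) (σ.act j) / (W (σ.act k) - W (σ.act j)) := by
    intro k hk
    rw [h5 _ (hσ k hk)]
    congr 1
    refine Finset.sum_congr rfl fun j hj => ?_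
    have hk' := Finset.mem_Icc.1 hk
    have hj' := Finset.mem_Ioc.1 hj
    rw [h5 _ (hσ j (Finset.mem_Icc.2 ⟨by omega, hj'.2⟩))]
  have hlast : ∏ k ∈ Finset.Icc 5 L, absPow (position' x k) (mand s 1 k)
        * absPow (1 - position' x k) (mand s 4 k)
        / (cbar (position' x k) - cbar (position' x (k - 1))) =
      (∏ k ∈ Finset.Icc 5 L, absPow (W k) (mand s 1 k))
        * (∏ k ∈ Finset.Icc 5 L, absPow (1 - W k) (mand s 4 k))
        * ∏ k ∈ Finset.Icc 5 L, 1 / (cbar (V k) - cbar (V (k - 1))) := by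
    rw [← Finset.prod_mul_distrib, ← Finset.prod_mul_distrib]
    refine Finset.prod_congr rfl fun k hk => ?_
    have hk' := Finset.mem_Icc.1 hk
    rw [h5 k hk, Vne k (by omega), hpos (k - 1) (Finset.mem_Icc.2 ⟨by omega, by omega⟩),
      div_eq_mul_one_div]
  unfold closedStringIntegrand
  simp only
  rw [Finset.prod_congr rfl hbr, hlast, hpos L (Finset.mem_Icc.2 ⟨hL, le_rfl⟩)]
  unfold restProd
  rw [h4, show 4 - 1 = 3 from rfl, show 4 + 1 = 5 from rfl, h3, eIcc', eother, hpair]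
  rw [eother] at hkn
  rw [hkn]
  linear_combination ((∏ k ∈ Finset.Icc 5 L, absPow (W k) (mand s 1 k))
    * (∏ i ∈ Finset.Icc 5 L, ∏ j ∈ Finset.Ioc i L,
          absPow (position' x i - position' x j) (mand s i j))
    * (∏ k ∈ Finset.Icc 5 L, (mand s 1 (σ.act k) / W (σ.act k)
      + ∑ j ∈ Finset.Ioc k L, mand s (σ.act k) (σ.act j) / (W (σ.act k) - W (σ.act j))))
    * (∏ k ∈ Finset.Icc 5 L, absPow (1 - W k) (mand s 4 k))) * hanti

/-- The labels `5, …, L` together with `4`. -/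
def optionIccEquiv (hL : 4 ≤ L) : Option (Finset.Icc 5 L) ≃ Finset.Icc 4 L where
  toFun o := o.elim ⟨4, Finset.mem_Icc.2 ⟨le_rfl, hL⟩⟩
    fun k => ⟨k, by have := Finset.mem_Icc.1 k.2; exact Finset.mem_Icc.2 ⟨by omega, this.2⟩⟩
  invFun k := if h : (k : ℕ) ∈ Finset.Icc 5 L then some ⟨k, h⟩ else none
  left_inv o := by
    rcases o with _ | k
    · simp
    · exact dif_pos k.2
  right_inv k := by
    have hk := Finset.mem_Icc.1 k.2
    by_cases h : (k : ℕ) ∈ Finset.Icc 5 L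
    · simp only [h, dite_true, Option.elim_some]
    · simp only [h, dite_false, Option.elim_none]
      refine Subtype.ext ?_
      rw [Finset.mem_Icc] at h
      simp only; omega

/-- The configuration with `w_m` left out. -/
def offConfig {κ : Type*} (e : Option κ ≃ Finset.Icc 4 L) (x : κ → ℂ) : ℕ → ℂ :=
  scaledPos 2 (splice e (x, 0))

lemma scaledPos_splice {κ : Type*} (e : Option κ ≃ Finset.Icc 4 L) (x : κ → ℂ) (w : ℂ) :
    scaledPos 2 (splice e (x, w)) = Function.update (offConfig e x) (e none : ℕ) w := by
  ext k
  by_cases hk : k = (e none : ℕ)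
  · subst hk
    rw [Function.update_self, scaledPos, dif_pos (e none).2]
    exact splice_none e (x, w)
  · rw [Function.update_of_ne hk]
    unfold offConfig scaledPos
    split_ifs with h
    · obtain ⟨o, ho⟩ := e.surjective ⟨k, h⟩
      rcases o with _ | j
      · exact absurd (congrArg Subtype.val ho).symm hk
      · rw [← ho, splice_some, splice_some]
    · rfl
    · rfl
    · rfl

lemma offConfig_some {κ : Type*} (e : Option κ ≃ Finset.Icc 4 L) (x : κ → ℂ) (j : κ) :
    offConfig e x (e (some j) : ℕ) = x j := by
  unfold offConfig
  rw [scaledPos, dif_pos (e (some j)).2]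
  exact splice_some e (x, 0) j

lemma ae_genericOff {κ : Type*} [Fintype κ] (hL : 4 ≤ L) (e : Option κ ≃ Finset.Icc 4 L) :
    ∀ᵐ x : κ → ℂ, GenericOff L (e none : ℕ) (offConfig e x) := by
  have h : ∀ᵐ x : κ → ℂ, ∀ k l, k ≠ l → x k ≠ x l := by
    rw [ae_all_iff]; intro k; rw [ae_all_iff]; intro l
    by_cases hkl : k = l
    · simp [hkl]
    · filter_upwards [ae_ne_apply hkl] with x hx _ using hx
  filter_upwards [ae_apply_ne (ι := κ) 0, ae_apply_ne (ι := κ) 1, h] with x h0 h1 hx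
  have key : ∀ k ∈ (Finset.Icc 4 L).erase (e none : ℕ), ∃ j, k = (e (some j) : ℕ) := by
    intro k hk
    obtain ⟨hk1, hk2⟩ := Finset.mem_erase.1 hk
    obtain ⟨o, ho⟩ := e.surjective ⟨k, hk2⟩
    rcases o with _ | j
    · exact absurd (congrArg Subtype.val ho).symm hk1
    · exact ⟨j, (congrArg Subtype.val ho).symm⟩
  refine ⟨by simp [offConfig, scaledPos], by simp [offConfig, scaledPos], ?_, ?_, ?_, ?_⟩
  · unfold offConfig scaledPos
    rw [dif_neg (by simp), if_neg (by omega), if_neg (by omega)]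
  · intro k hk
    obtain ⟨j, rfl⟩ := key k hk
    rw [offConfig_some]; exact h0 j
  · intro k hk
    obtain ⟨j, rfl⟩ := key k hk
    rw [offConfig_some]; exact h1 j
  · intro k hk l hl hkl
    obtain ⟨i, rfl⟩ := key k hk
    obtain ⟨j, rfl⟩ := key l hl
    rw [offConfig_some, offConfig_some]
    exact hx i j fun e' => hkl (by rw [e'])

theorem SmallFor.limitVec_eq_zero (h : SmallFor L ε) (hs : s ∈ convRegion L ε)
    (hp : IsPhysical s) (ha : ¬ ((a.1 : ℕ) = 4 ∧ a.2.act 4 = 4)) : limitVec L s a = 0 := by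
  have hL := h.four_le
  unfold limitVec
  split_ifs with ha4
  · have h4 : a.2.act 4 ≠ 4 := fun e => ha ⟨ha4, e⟩
    have hm : a.2.act 4 ∈ Finset.Icc 4 L := (a.2.act_mem_iff 4).2 (Finset.mem_Icc.2 ⟨le_rfl, hL⟩)
    set e := (optionIccEquiv hL).trans (Equiv.swap ⟨4, Finset.mem_Icc.2 ⟨le_rfl, hL⟩⟩ ⟨_, hm⟩)
      with he
    have he0 : (e none : ℕ) = a.2.act 4 := by
      rw [he, Equiv.trans_apply]
      exact congrArg Subtype.val (Equiv.swap_apply_left _ _)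
    rw [integral_eq_integral_splice e (h.integrable_coreIntegrand hs ha4 2) (g := fun _ => 0)
      (c := 1), integral_zero, mul_zero, mul_zero]
    filter_upwards [ae_genericOff hL e] with x hx
    simp only [scaledPos_splice, mul_zero]
    rw [he0] at hx ⊢
    exact h.integral_coreIntegrand_update_eq_zero hs hp ha4 hx h4
  · rfl

lemma SmallFor.integral_coreIntegrand_splice (h : SmallFor L ε) (hs : s ∈ convRegion L ε)
    (hp : IsPhysical s) (ha : (a.1 : ℕ) = 4) (h4 : a.2.act 4 = 4) :
    ∀ᵐ x : Finset.Icc 5 L → ℂ,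
      ∫ w, coreIntegrand L s a (scaledPos 2 (splice (optionIccEquiv h.four_le) (x, w))) =
        -(Real.pi : ℂ) * closedStringIntegrand L s a.2 x := by
  filter_upwards [ae_genericOff h.four_le (optionIccEquiv h.four_le)] with x hx
  simp only [scaledPos_splice]
  have e0 : ((optionIccEquiv h.four_le none : Finset.Icc 4 L) : ℕ) = a.2.act 4 := by
    rw [h4]; rfl
  rw [e0] at hx ⊢
  rw [h.integral_coreIntegrand_update hs hp ha hx,
    closedStringIntegrand_eq h.four_le a.2 h4 hx.one hx.three hx.last]
  intro k hk
  exact offConfig_some (optionIccEquiv h.four_le) x ⟨k, hk⟩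

theorem SmallFor.integrable_closedStringIntegrand (h : SmallFor L ε) (hs : s ∈ convRegion L ε)
    (hp : IsPhysical s) (ha : (a.1 : ℕ) = 4) (h4 : a.2.act 4 = 4) :
    Integrable (closedStringIntegrand L s a.2) :=
  integrable_of_integral_splice (optionIccEquiv h.four_le) (h.integrable_coreIntegrand hs ha 2)
    (neg_ne_zero.2 (by exact_mod_cast Real.pi_ne_zero))
    (h.integral_coreIntegrand_splice hs hp ha h4)

theorem SmallFor.limitVec_eq_closedStringIntegral (h : SmallFor L ε) (hs : s ∈ convRegion L ε)
    (hp : IsPhysical s) (ha : (a.1 : ℕ) = 4) (h4 : a.2.act 4 = 4) :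
    limitVec L s a = closedStringIntegral L s a.2 := by
  have hL := h.four_le
  have hpi : (Real.pi : ℂ) ≠ 0 := by exact_mod_cast Real.pi_ne_zero
  unfold limitVec closedStringIntegral
  rw [if_pos ha, integral_eq_integral_splice (optionIccEquiv h.four_le)
    (h.integrable_coreIntegrand hs ha 2) (h.integral_coreIntegrand_splice hs hp ha h4),
    show L - 3 = L - 4 + 1 by omega, pow_succ]
  field_simp

end

noncomputable section

/-! ### The exponential of the residue matrix -/

section exponential

open scoped Matrix.Norms.Operator

variable {ι : Type*} [Fintype ι] [DecidableEq ι]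

lemma hasSum_exp_mulVec (M : Matrix ι ι ℂ) (v : ι → ℂ) :
    HasSum (fun n : ℕ => ((n.factorial : ℂ)⁻¹) • (M ^ n).mulVec v)
      ((NormedSpace.exp M).mulVec v) := by
  have h := NormedSpace.exp_series_hasSum_exp' (𝕂 := ℂ) M
  have := h.map (AddMonoidHom.mk' (fun A : Matrix ι ι ℂ => A.mulVec v)
    fun A B => Matrix.add_mulVec A B v) (by
      change Continuous fun A : Matrix ι ι ℂ => A.mulVec v
      exact Continuous.matrix_mulVec continuous_id continuous_const)
  simp only [Function.comp_def, AddMonoidHom.mk'_apply, Matrix.smul_mulVec] at this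
  exact this

lemma exp_mulVec_of_eigenvector {M : Matrix ι ι ℂ} {v : ι → ℂ} {μ : ℂ} (h : M.mulVec v = μ • v) :
    (NormedSpace.exp M).mulVec v = Complex.exp μ • v := by
  have hp : ∀ n : ℕ, (M ^ n).mulVec v = μ ^ n • v := by
    intro n
    induction n with
    | zero => simp
    | succ n ih => rw [pow_succ, ← Matrix.mulVec_mulVec, h, Matrix.mulVec_smul, ih, smul_smul,
        pow_succ, mul_comm]
  refine (hasSum_exp_mulVec M v).unique ?_
  have h1 := (NormedSpace.exp_series_hasSum_exp' (𝕂 := ℂ) μ).smul_const v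
  rw [← Complex.exp_eq_exp_ℂ] at h1
  simpa [hp, smul_smul] using h1

lemma norm_exp_mulVec_le {M : Matrix ι ι ℂ} {K : ℝ} (h : ∀ i, ∑ j, ‖M i j‖ ≤ K) (hK : 0 ≤ K)
    (v : ι → ℂ) : ‖(NormedSpace.exp M).mulVec v‖ ≤ Real.exp K * ‖v‖ := by
  have h1 : ∀ u : ι → ℂ, ‖M.mulVec u‖ ≤ K * ‖u‖ := by
    intro u
    refine (pi_norm_le_iff_of_nonneg (by positivity)).2 fun i => ?_
    refine (norm_sum_le _ _).trans ((Finset.sum_le_sum fun j _ =>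
      (norm_mul_le (M i j) (u j)).trans
        (mul_le_mul_of_nonneg_left (norm_le_pi_norm u j) (norm_nonneg _))).trans ?_)
    rw [← Finset.sum_mul]
    exact mul_le_mul_of_nonneg_right (h i) (norm_nonneg u)
  have hp : ∀ n : ℕ, ‖(M ^ n).mulVec v‖ ≤ K ^ n * ‖v‖ := by
    intro n
    induction n with
    | zero => simp
    | succ n ih =>
      rw [pow_succ', ← Matrix.mulVec_mulVec]
      refine (h1 _).trans ?_
      rw [pow_succ', mul_assoc]
      gcongr
  have hs := (NormedSpace.exp_series_hasSum_exp' (𝕂 := ℝ) K).mul_right ‖v‖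
  rw [← Real.exp_eq_exp_ℝ] at hs
  refine (hasSum_exp_mulVec M v).norm_le_of_bounded hs fun n => ?_
  rw [norm_smul, norm_inv, Complex.norm_natCast, smul_eq_mul, mul_assoc]
  gcongr
  exact hp n

end exponential

variable {L : ℕ} {s : Mandelstam L} {a b : CompIdx L} {ε : ℝ}

lemma smax_eq (hL : 4 ≤ L) (σ : LabelPerm L) :
    smax L s = mand s 1 3 + ∑ k ∈ Finset.Icc 4 L, (mand s 1 (σ.act k) + mand s 3 (σ.act k)
      + ∑ j ∈ Finset.Ioc k L, mand s (σ.act k) (σ.act j)) := by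
  have h2 : ∀ k, mand (killLabel 2 s) 2 k = 0 := fun k => by simp [mand_killLabel]
  have h12 : mand (killLabel 2 s) 1 2 = 0 := by simp [mand_killLabel]
  have h13 : mand (killLabel 2 s) 1 3 = mand s 1 3 := by rw [mand_killLabel, if_neg (by omega)]
  have hk : ∀ k ∈ Finset.Icc 4 L, ∀ j, j ≠ 2 → mand (killLabel 2 s) j k = mand s j k := by
    intro k hk j hj
    have := Finset.mem_Icc.1 hk
    rw [mand_killLabel, if_neg (by omega)]
  have hpairs : ∑ k ∈ Finset.Icc 4 L, ∑ l ∈ Finset.Icc 4 L with k < l, mand s k l =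
      ∑ k ∈ Finset.Icc 4 L, ∑ j ∈ Finset.Ioc k L, mand s (σ.act k) (σ.act j) := by
    rw [sum_pairs_rank (Finset.Icc 4 L) σ.act.symm (σ.act.symm.injective.injOn) (mand s)
      (mand_comm s), ← σ.sum_act]
    refine Finset.sum_congr rfl fun k hk => ?_
    rw [Finset.sum_filter, ← σ.sum_act, ← Finset.sum_filter]
    refine Finset.sum_congr ?_ fun _ _ => rfl
    ext j
    have := Finset.mem_Icc.1 hk
    simp only [Finset.mem_filter, Finset.mem_Icc, Finset.mem_Ioc, Equiv.symm_apply_apply]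
    omega
  unfold smax
  rw [sum_pairs_split hL, Finset.sum_add_distrib, Finset.sum_add_distrib, ← hpairs,
    σ.sum_act, σ.sum_act]
  simp only [h2, h12, h13, Finset.sum_const_zero, add_zero, zero_add]
  rw [Finset.sum_congr rfl fun k h => hk k h 1 (by norm_num),
    Finset.sum_congr rfl fun k h => hk k h 3 (by norm_num),
    Finset.sum_congr rfl fun k h => Finset.sum_congr rfl fun l h' =>
      hk l (Finset.mem_filter.1 h').1 k (by have := Finset.mem_Icc.1 h; omega)]
  ring

/-- The columns of `e_0` with `i = 4` are diagonal. -/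
lemma kzE0_of_four (hL : 4 ≤ L) (hb : (b.1 : ℕ) = 4) :
    kzE0 L s a b = if a = b then smax L s else 0 := by
  have hi := Finset.mem_Icc.1 a.1.2
  unfold kzE0
  simp only
  have hz : ((List.range' (a.1 : ℕ) (L + 1 - a.1)).sublists.map fun S : List ℕ =>
      (-1 : ℂ) ^ S.length * (mand s 1 (a.2.act (S.getLastD 0))
        + ∑ j ∈ Finset.Ioc (S.getLastD 0) L, mand s (a.2.act (S.getLastD 0)) (a.2.act j))
        * ((bracketWords (S.map a.2.act)).map fun t =>
            if fstWord b = ((List.range' (a.1 : ℕ) (L + 1 - a.1)).filter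
              (fun k => k ∉ S)).map a.2.act ∧ sndWord b = sndWord a ++ t.2
            then (t.1 : ℂ) else 0).sum).sum = 0 := by
    refine List.sum_eq_zero ?_
    intro y hy
    obtain ⟨S, hS, rfl⟩ := List.mem_map.1 hy
    rw [List.mem_sublists] at hS
    refine mul_eq_zero_of_right _ ?_
    rcases S with _ | ⟨x, S⟩
    · simp [bracketWords]
    · refine List.sum_eq_zero ?_
      intro y hy
      obtain ⟨t, ht, rfl⟩ := List.mem_map.1 hy
      rw [if_neg]
      rintro ⟨h, -⟩
      have h1 := congrArg List.length h
      have hx : x ∈ List.range' (a.1 : ℕ) (L + 1 - a.1) := hS.subset (by simp)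
      have h2 : ((List.range' (a.1 : ℕ) (L + 1 - a.1)).filter
          (fun k => k ∉ x :: S)).length < (List.range' (a.1 : ℕ) (L + 1 - a.1)).length :=
        List.length_filter_lt_length_iff_exists.2 ⟨x, hx, by simp⟩
      unfold fstWord at h1
      rw [List.length_map, List.length_map, List.length_range', hb] at h1
      rw [List.length_range'] at h2
      omega
  rw [hz, add_zero]
  split_ifs with hab
  · subst hab
    rw [hb, ← smax_eq hL]
  · rfl

lemma kzE0_mulVec_limitVec (hL : 4 ≤ L) :
    (kzE0 L s).mulVec (limitVec L s) = smax L s • limitVec L s := by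
  ext a
  unfold Matrix.mulVec dotProduct
  rw [Finset.sum_eq_single a]
  · change kzE0 L s a a * limitVec L s a = _
    by_cases ha : (a.1 : ℕ) = 4
    · rw [kzE0_of_four hL ha, if_pos rfl]; rfl
    · have : limitVec L s a = 0 := if_neg ha
      simp [this]
  · intro b _ hba
    change kzE0 L s a b * limitVec L s b = 0
    by_cases hb : (b.1 : ℕ) = 4
    · rw [kzE0_of_four hL hb, if_neg hba.symm, zero_mul]
    · have : limitVec L s b = 0 := if_neg hb
      rw [this, mul_zero]
  · simp

lemma continuous_kzE0 (a b : CompIdx L) : Continuous fun s : Mandelstam L => kzE0 L s a b := by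
  have c := fun i j => continuous_mand (L := L) i j
  unfold kzE0
  refine Continuous.add ?_ (continuous_list_sum _ fun S _ => ?_)
  · split_ifs
    · exact (c _ _).add (continuous_finsetSum _ fun k _ => ((c _ _).add (c _ _)).add
        (continuous_finsetSum _ fun j _ => c _ _))
    · exact continuous_const
  · exact (continuous_const.mul ((c _ _).add (continuous_finsetSum _ fun j _ => c _ _))).mul
      continuous_const

lemma kzE0_zero (a b : CompIdx L) : kzE0 L 0 a b = 0 := by
  have h : ∀ i j, mand (0 : Mandelstam L) i j = 0 := fun i j => by
    unfold mand; split_ifs <;> rfl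
  unfold kzE0
  simp [h]

lemma exists_sum_norm_kzE0_le (L : ℕ) :
    ∃ r : ℝ, 0 < r ∧ ∀ s : Mandelstam L, ‖s‖ < r → ∀ a, ∑ b, ‖kzE0 L s a b‖ ≤ 1 / 16 := by
  have h : ∀ᶠ s in 𝓝 (0 : Mandelstam L), ∀ a, ∑ b, ‖kzE0 L s a b‖ < 1 / 16 := by
    rw [Filter.eventually_all]
    intro a
    have hc : Continuous fun s : Mandelstam L => ∑ b, ‖kzE0 L s a b‖ :=
      continuous_finsetSum _ fun b _ => (continuous_kzE0 a b).norm
    refine hc.continuousAt.eventually_lt_const ?_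
    simp [kzE0_zero]
  obtain ⟨r, hr, hball⟩ := Metric.eventually_nhds_iff_ball.1 h
  exact ⟨r, hr, fun s hs a => (hball s (mem_ball_zero_iff.2 hs) a).le⟩

theorem SmallFor.tendsto_fhatReg (h : SmallFor L ε) (hs : s ∈ convRegion L ε)
    (hE : ∀ a, ∑ b, ‖kzE0 L s a b‖ ≤ 1 / 16) :
    Tendsto (fhatReg L s) (𝓝[≠] 0) (𝓝 (limitVec L s)) := by
  choose M hM using fun a => h.exists_norm_fhat_sub_le hs a
  have hbound : ∀ᶠ z : ℂ in 𝓝[≠] 0, ‖fhatReg L s z - limitVec L s‖ ≤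
      (∑ a, |M a|) * ‖z‖ ^ (1 / 8 : ℝ) := by
    have h2 : ∀ᶠ z : ℂ in 𝓝[≠] 0, ‖z‖ < 1 / 2 := by
      refine nhdsWithin_le_nhds ?_
      exact continuous_norm.continuousAt.eventually_lt_const (by simp)
    filter_upwards [h2, self_mem_nhdsWithin] with z hz2 hz
    have hz0 : z ≠ 0 := hz
    have z0 := norm_pos_iff.2 hz0
    have hlog : Real.log ‖z‖ ≤ 0 := Real.log_nonpos z0.le (by linarith)
    set c : ℂ := -(2 * ((Real.log ‖z‖ : ℝ) : ℂ)) with hc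
    have hcn : ‖c‖ = -2 * Real.log ‖z‖ := by
      rw [hc, norm_neg, norm_mul, RCLike.norm_ofNat, Complex.norm_real, Real.norm_eq_abs,
        abs_of_nonpos hlog]
      ring
    set v : CompIdx L → ℂ := fun a => fhat L s z a - absPow z (smax L s) * limitVec L s a with hv
    have hvn : ‖v‖ ≤ (∑ a, |M a|) * ‖z‖ ^ (1 / 4 : ℝ) := by
      refine (pi_norm_le_iff_of_nonneg (mul_nonneg (Finset.sum_nonneg fun _ _ => abs_nonneg _)
        (by positivity))).2 fun a => (hM a z hz0 hz2.le).trans ?_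
      gcongr
      exact (le_abs_self _).trans
        (Finset.single_le_sum (f := fun a => |M a|) (fun _ _ => abs_nonneg _) (Finset.mem_univ a))
    have hsplit : fhat L s z = v + absPow z (smax L s) • limitVec L s := by
      ext a; simp [hv]
    have hexp : (NormedSpace.exp (c • kzE0 L s)).mulVec (limitVec L s) =
        Complex.exp (c * smax L s) • limitVec L s := by
      refine exp_mulVec_of_eigenvector ?_
      rw [Matrix.smul_mulVec, kzE0_mulVec_limitVec h.four_le, smul_smul]
    have hone : absPow z (smax L s) * Complex.exp (c * smax L s) = 1 := by
      unfold absPow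
      rw [Complex.cpow_def_of_ne_zero (by exact_mod_cast z0.ne'), ← Complex.ofReal_log z0.le,
        ← Complex.exp_add, hc, Complex.exp_eq_one_iff]
      exact ⟨0, by push_cast; ring⟩
    have hreg : fhatReg L s z - limitVec L s = (NormedSpace.exp (c • kzE0 L s)).mulVec v := by
      unfold fhatReg
      rw [← hc, hsplit, Matrix.mulVec_add, Matrix.mulVec_smul, hexp, smul_smul, hone, one_smul,
        add_sub_cancel_right]
    rw [hreg]
    have hsum : ∀ a, ∑ b, ‖(c • kzE0 L s) a b‖ ≤ -(1 / 8) * Real.log ‖z‖ := by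
      intro a
      simp only [Matrix.smul_apply, smul_eq_mul, norm_mul, ← Finset.mul_sum, hcn]
      nlinarith [hE a]
    refine (norm_exp_mulVec_le hsum (by nlinarith) v).trans ?_
    have he : Real.exp (-(1 / 8) * Real.log ‖z‖) = ‖z‖ ^ (-(1 / 8) : ℝ) := by
      rw [Real.rpow_def_of_pos z0, mul_comm]
    rw [he]
    calc _ ≤ ‖z‖ ^ (-(1 / 8) : ℝ) * ((∑ a, |M a|) * ‖z‖ ^ (1 / 4 : ℝ)) := by gcongr
      _ = (∑ a, |M a|) * (‖z‖ ^ (-(1 / 8) : ℝ) * ‖z‖ ^ (1 / 4 : ℝ)) := by ring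
      _ = _ := by rw [← Real.rpow_add z0]; norm_num
  rw [tendsto_iff_norm_sub_tendsto_zero]
  refine squeeze_zero' (Eventually.of_forall fun _ => norm_nonneg _) hbound ?_
  have hlim : Tendsto (fun z : ℂ => (∑ a, |M a|) * ‖z‖ ^ (1 / 8 : ℝ)) (𝓝 0) (𝓝 0) := by
    have hc : Continuous fun z : ℂ => (∑ a, |M a|) * ‖z‖ ^ (1 / 8 : ℝ) :=
      continuous_const.mul (continuous_norm.rpow_const fun _ => Or.inr (by norm_num))
    have := hc.tendsto 0
    simpa using this
  exact hlim.mono_left nhdsWithin_le_nhds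

theorem SmallFor.fhatZero_eq (h : SmallFor L ε) (hs : s ∈ convRegion L ε)
    (hE : ∀ a, ∑ b, ‖kzE0 L s a b‖ ≤ 1 / 16) : fhatZero L s = limitVec L s :=
  (h.tendsto_fhatReg hs hE).limUnder_eq

end

noncomputable section

/-! ### Analytic continuation in the variables -/

variable {L : ℕ} {s : Mandelstam L} {ε : ℝ}

lemma isOpen_convRegion (L : ℕ) (ε : ℝ) : IsOpen (convRegion L ε) := by
  rw [isOpen_iff_mem_nhds]
  rintro s ⟨h1, h2⟩
  have c : ∀ᶠ t in 𝓝 s, ∀ i ∈ insert 1 (Finset.Icc 4 L),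
      ∀ j ∈ insert 1 (Finset.Icc 4 L), i ≠ j → 0 < (mand t i j).re := by
    rw [Filter.eventually_all_finset]; intro i hi
    rw [Filter.eventually_all_finset]; intro j hj
    by_cases hij : i = j
    · simp [hij]
    · have hc : Continuous fun t : Mandelstam L => (mand t i j).re :=
        Complex.continuous_re.comp (continuous_mand i j)
      filter_upwards [hc.continuousAt.eventually_const_lt (h2 i hi j hj hij)] with t ht _ using ht
  filter_upwards [c, Metric.isOpen_ball.mem_nhds h1] with t ht ht' using ⟨ht', ht⟩

lemma convRegion_inter_ball_nonempty (hL : 4 ≤ L) (hε : 0 < ε) {r : ℝ} (hr : 0 < r) :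
    (convRegion L ε ∩ Metric.ball 0 r).Nonempty := by
  set η := min ε r / 2 with hη
  have h0 : 0 < min ε r := lt_min hε hr
  have hn : ‖(fun _ => (η : ℂ) : Mandelstam L)‖ ≤ η := by
    refine (pi_norm_le_iff_of_nonneg (by positivity)).2 fun e => ?_
    rw [Complex.norm_real, Real.norm_of_nonneg (by positivity)]
  refine ⟨fun _ => (η : ℂ), ⟨mem_ball_zero_iff.2 (hn.trans_lt ?_), ?_⟩,
    mem_ball_zero_iff.2 (hn.trans_lt ?_)⟩
  · linarith [min_le_left ε r]
  · intro i hi j hj _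
    have key : ∀ k ∈ insert 1 (Finset.Icc 4 L), k ∈ Finset.Icc 1 L := by
      intro k hk
      rw [Finset.mem_insert, Finset.mem_Icc] at hk
      rw [Finset.mem_Icc]; omega
    unfold mand
    rw [dif_pos ⟨key i hi, key j hj⟩, Complex.ofReal_re]
    positivity
  · linarith [min_le_right ε r]

/-- The identity theorem on a polydisc. -/
lemma eqOn_ball_of_eqOn_convRegion (hL : 4 ≤ L) (hε : 0 < ε) {r : ℝ} {F G : Mandelstam L → ℂ}
    (hF : AnalyticOnNhd ℂ F (Metric.ball 0 r)) (hG : AnalyticOnNhd ℂ G (Metric.ball 0 r))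
    (h : ∀ s ∈ convRegion L ε ∩ Metric.ball 0 r, F s = G s) :
    ∀ s ∈ Metric.ball 0 r, F s = G s := by
  intro s hs
  have hr : 0 < r := Metric.pos_of_mem_ball hs
  obtain ⟨t, ht⟩ := convRegion_inter_ball_nonempty hL hε hr
  refine hF.eqOn_of_preconnected_of_eventuallyEq hG (convex_ball 0 r).isPreconnected ht.2 ?_ hs
  filter_upwards [((isOpen_convRegion L ε).inter Metric.isOpen_ball).mem_nhds ht] with u hu
    using h u hu

lemma analyticOnNhd_killLabel (j : ℕ) (S : Set (Mandelstam L)) :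
    AnalyticOnNhd ℂ (killLabel j : Mandelstam L → Mandelstam L) S := by
  classical
  refine AnalyticOnNhd.pi fun e => ?_
  unfold killLabel
  by_cases h : ∃ i ∈ e, (i : ℕ) = j
  · simp only [if_pos h]
    exact analyticOnNhd_const
  · simp only [if_neg h]
    exact (ContinuousLinearMap.proj (R := ℂ) e : Mandelstam L →L[ℂ] ℂ).analyticOnNhd S

lemma killLabel_mem_ball {r : ℝ} (j : ℕ) (hs : s ∈ Metric.ball 0 r) :
    killLabel j s ∈ Metric.ball 0 r :=
  mem_ball_zero_iff.2 ((norm_killLabel_le j s).trans_lt (mem_ball_zero_iff.1 hs))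

lemma killLabel_mem_convRegion (hs : s ∈ convRegion L ε) : killLabel 3 s ∈ convRegion L ε := by
  refine ⟨killLabel_mem_ball 3 hs.1, fun i hi j hj hij => ?_⟩
  rw [mand_killLabel, if_neg]
  · exact hs.2 i hi j hj hij
  · simp only [Finset.mem_insert, Finset.mem_Icc] at hi hj
    omega

lemma isPhysical_killLabel (s : Mandelstam L) : IsPhysical (killLabel 3 s) := fun i _ => by
  simp [mand_killLabel]

lemma IsPhysical.killLabel_eq (hs : IsPhysical s) : killLabel 3 s = s := by
  ext e
  unfold killLabel
  split_ifs with h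
  · obtain ⟨⟨i, hiL⟩, hi, rfl⟩ := h
    obtain ⟨j, rfl⟩ := Sym2.mem_iff_exists.1 hi
    have := hs j j.2
    unfold mand at this
    rw [dif_pos ⟨hiL, j.2⟩] at this
    exact this.symm
  · rfl

/-- The identity theorem, restricted to the physical variables. -/
lemma eq_of_eq_killLabel (hL : 4 ≤ L) (hε : 0 < ε) {r : ℝ} {F G : Mandelstam L → ℂ}
    (hF : AnalyticOnNhd ℂ F (Metric.ball 0 r)) (hG : AnalyticOnNhd ℂ G (Metric.ball 0 r))
    (h : ∀ s ∈ convRegion L ε ∩ Metric.ball 0 r, IsPhysical s → F s = G s) :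
    ∀ s ∈ Metric.ball 0 r, IsPhysical s → F s = G s := by
  intro s hs hp
  have key := eqOn_ball_of_eqOn_convRegion hL hε
    (hF.comp (analyticOnNhd_killLabel 3 _) fun t ht => killLabel_mem_ball 3 ht)
    (hG.comp (analyticOnNhd_killLabel 3 _) fun t ht => killLabel_mem_ball 3 ht)
    (fun t ht => h _ ⟨killLabel_mem_convRegion ht.1, killLabel_mem_ball 3 ht.2⟩
      (isPhysical_killLabel t)) s hs
  simp only [Function.comp_apply, hp.killLabel_eq] at key
  exact key

lemma physLimit_le_nhds (s : Mandelstam L) : physLimit s ≤ 𝓝 s := nhdsWithin_le_nhds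

lemma exists_smallFor {L : ℕ} (hL : 4 ≤ L) :
    ∃ ε, SmallFor L ε ∧ ∀ s ∈ convRegion L ε, ∀ a, ∑ b, ‖kzE0 L s a b‖ ≤ 1 / 16 := by
  obtain ⟨r, hr, h⟩ := exists_sum_norm_kzE0_le L
  have hLpos : (0 : ℝ) < L := by exact_mod_cast (by omega : 0 < L)
  set N : ℝ := 4 ^ Fintype.card (Finset.Icc 4 L) with hN
  have hN0 : 0 < N := by positivity
  refine ⟨min r (min (1 / (24 * (L : ℝ) ^ 2)) (1 / (8 * N))), ⟨hL, by positivity, ?_, ?_⟩, ?_⟩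
  · calc 24 * (L : ℝ) ^ 2 * min r (min (1 / (24 * (L : ℝ) ^ 2)) (1 / (8 * N)))
        ≤ 24 * (L : ℝ) ^ 2 * (1 / (24 * (L : ℝ) ^ 2)) := by
          gcongr
          exact (min_le_right _ _).trans (min_le_left _ _)
      _ = 1 := by field_simp
  · calc N * (4 * min r (min (1 / (24 * (L : ℝ) ^ 2)) (1 / (8 * N))))
        ≤ N * (4 * (1 / (8 * N))) := by
          gcongr
          exact (min_le_right _ _).trans (min_le_right _ _)
      _ = 1 / 2 := by field_simp; norm_num
  · intro s hs a
    exact h s ((mem_ball_zero_iff.1 hs.1).trans_le (min_le_left _ _)) a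

end


theorem mainTheorem4 (L : ℕ) (hL : 4 ≤ L) :
    ∃ ε : ℝ, 0 < ε ∧
      -- the integrals converge, and the regularized value at `0` exists;
      -- its components with `i ≥ 5` vanish
      (∀ s ∈ convRegion L ε,
        (∀ z₃ : ℂ, z₃ ≠ 0 → z₃ ≠ 1 → ∀ a : CompIdx L, Integrable (fhatIntegrand L s z₃ a)) ∧
        Tendsto (fhatReg L s) (𝓝[≠] 0) (𝓝 (fhatZero L s)) ∧
        ∀ a : CompIdx L, (a.1 : ℕ) ≠ 4 → fhatZero L s a = 0) ∧
      -- the physical limit of the regularized value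
      (∀ s ∈ convRegion L ε, IsPhysical s → ∀ a : CompIdx L,
        ((a.1 : ℕ) = 4 → a.2.act 4 = 4 →
          Integrable (closedStringIntegrand L s a.2) ∧
          Tendsto (fun t => fhatZero L t a) (physLimit s) (𝓝 (closedStringIntegral L s a.2))) ∧
        (¬((a.1 : ℕ) = 4 ∧ a.2.act 4 = 4) →
          Tendsto (fun t => fhatZero L t a) (physLimit s) (𝓝 0))) ∧
      -- the same for the analytic continuations to a neighbourhood of the origin
      (∀ (r : ℝ) (G : Mandelstam L → ℂ) (a : CompIdx L),
        AnalyticOnNhd ℂ G (Metric.ball 0 r) →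
        (∀ s ∈ convRegion L ε ∩ Metric.ball 0 r, G s = fhatZero L s a) →
        ((a.1 : ℕ) ≠ 4 → ∀ s ∈ Metric.ball 0 r, G s = 0) ∧
        ((a.1 : ℕ) = 4 → a.2.act 4 = 4 → ∀ J : Mandelstam L → ℂ,
          AnalyticOnNhd ℂ J (Metric.ball 0 r) →
          (∀ s ∈ convRegion L ε ∩ Metric.ball 0 r, J s = closedStringIntegral L s a.2) →
          ∀ s ∈ Metric.ball 0 r, IsPhysical s → Tendsto G (physLimit s) (𝓝 (J s))) ∧
        (¬((a.1 : ℕ) = 4 ∧ a.2.act 4 = 4) →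
          ∀ s ∈ Metric.ball 0 r, IsPhysical s → Tendsto G (physLimit s) (𝓝 0))) := by
  obtain ⟨ε, hε, hE⟩ := exists_smallFor hL
  have hval : ∀ s ∈ convRegion L ε, fhatZero L s = limitVec L s := fun s hs =>
    hε.fhatZero_eq hs (hE s hs)
  have hlim : ∀ s ∈ convRegion L ε, ∀ a : CompIdx L,
      Tendsto (fun t => fhatZero L t a) (physLimit s) (𝓝 (limitVec L s a)) := by
    intro s hs a
    refine Tendsto.mono_left (Tendsto.congr' ?_ (hε.continuousAt_limitVec hs a))
      (physLimit_le_nhds s)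
    filter_upwards [(isOpen_convRegion L ε).mem_nhds hs] with t ht
    rw [hval t ht]
  refine ⟨ε, hε.pos, fun s hs => ⟨fun z hz hz1 a => hε.integrable_fhatIntegrand hs hz hz1 a, ?_, ?_⟩,
    fun s hs hp a => ⟨fun ha h4 => ⟨hε.integrable_closedStringIntegrand hs hp ha h4, ?_⟩, ?_⟩,
    fun r G a hG hGs => ⟨?_, ?_, ?_⟩⟩
  · rw [hval s hs]
    exact hε.tendsto_fhatReg hs (hE s hs)
  · intro a ha
    rw [hval s hs]
    exact if_neg ha
  · rw [← hε.limitVec_eq_closedStringIntegral hs hp ha h4]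
    exact hlim s hs a
  · intro ha
    rw [← hε.limitVec_eq_zero hs hp ha]
    exact hlim s hs a
  · intro ha
    refine eqOn_ball_of_eqOn_convRegion hL hε.pos hG analyticOnNhd_const fun s hs => ?_
    rw [hGs s hs, hval s hs.1]
    exact if_neg ha
  · intro ha h4 J hJ hJs s hs hp
    have key := eq_of_eq_killLabel hL hε.pos hG hJ (fun t ht hpt => by
      rw [hGs t ht, hJs t ht, hval t ht.1, hε.limitVec_eq_closedStringIntegral ht.1 hpt ha h4])
      s hs hp
    rw [← key]
    exact (hG s hs).continuousAt.tendsto.mono_left (physLimit_le_nhds s)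
  · intro ha s hs hp
    have key := eq_of_eq_killLabel hL hε.pos hG (analyticOnNhd_const (v := (0 : ℂ)))
      (fun t ht hpt => by
        rw [hGs t ht, hval t ht.1, hε.limitVec_eq_zero ht.1 hpt ha]) s hs hp
    rw [← key]
    exact (hG s hs).continuousAt.tendsto.mono_left (physLimit_le_nhds s)
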